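/- Let $q_1,q_2,q_3\in\mathbb{C}$ satisfy $q_1q_2q_3=1$ and the genericity condition: if $q_1^Lq_2^Mq_3^N=1$ with $L,M,N\in\mathbb{Z}$, then $L=M=N$. Fix fourth roots $q_i^{1/4}$ with $q_1^{1/2}q_2^{1/2}q_3^{1/2}=1$, and put $q=q_1$, $t=q_3^{-1}$ (so $q_2=q^{-1}t$). Let $n\ge 1$, $m\ge 0$, $\vec c=(3^n)$, and let $p$ be a formal parameter. Write $\kappa_r=\prod_{i=1}^3(q_i^r-1)$ and $C^r=q_3^{nr/2}$. *Fock space.* For $k=1,\dots,n$ let $a^{[k]}_{\pm r},b^{[k]}_{\pm r}$ ($r\ge1$) be Heisenberg generators with $$[a^{[k]}_r,a^{[k]}_{-r}]=\tfrac{r}{\kappa_r}(q_3^{r/2}-q_3^{-r/2})(1-p^r),\qquad [b^{[k]}_r,b^{[k]}_{-r}]=\tfrac{r}{\kappa_r}(q_3^{r/2}-q_3^{-r/2})\tfrac{1-p^r}{p^r},$$ all other commutators being $0$, acting on the Fock space generated from a vacuum $|0\rangle$ killed by all positive modes; $\langle 0|$ is the dual vacuum, $\langle0|0\rangle=1$.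 *Vertex operators.* In one Fock space (the superscript $[k]$ being understood) let $$K^-(x)=\exp\Big(\sum_{r\ge1}\tfrac{p^r}{1-p^r}\tfrac{\kappa_r}{r}q_3^{r/4}b_{-r}x^{-r}\Big)\exp\Big(-\sum_{r\ge1}\tfrac{1}{1-p^r}\tfrac{\kappa_r}{r}q_3^{-r/4}a_{-r}x^{r}\Big),$$ $$K^+(x)=\exp\Big(-\sum_{r\ge1}\tfrac{p^r}{1-p^r}\tfrac{\kappa_r}{r}q_3^{-r/4}b_{r}x^{r}\Big)\exp\Big(\sum_{r\ge1}\tfrac{1}{1-p^r}\tfrac{\kappa_r}{r}q_3^{r/4}a_{r}x^{-r}\Big),$$ $$\eta(x)=\exp\Big(\sum_{r\ge1}\tfrac{p^r}{1-p^r}\tfrac{\kappa_r}{r}\tfrac{q_3^{r/4}b_{-r}x^{-r}}{q_3^{r/2}-q_3^{-r/2}}\Big)\exp\Big(\sum_{r\ge1}\tfrac{1}{1-p^r}\tfrac{\kappa_r}{r}\tfrac{q_3^{-r/4}a_{-r}x^{r}}{q_3^{r/2}-q_3^{-r/2}}\Big)\exp\Big(\sum_{r\ge1}\tfrac{p^r}{1-p^r}\tfrac{\kappa_r}{r}\tfrac{q_3^{-r/4}b_{r}x^{r}}{q_3^{-r}-1}\Big)\exp\Big(-\sum_{r\ge1}\tfrac{1}{1-p^r}\tfrac{\kappa_r}{r}\tfrac{q_3^{r/4}a_{r}x^{-r}}{q_3^{r}-1}\Big).$$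 For $u=(u_1,\dots,u_n)\in\mathbb{C}^n$ and $1\le j\le n$ put $$\Lambda_j(x)=u_j\,K^-(q_3^{1/2}x)\otimes K^-(q_3^{2/2}x)\otimes\cdots\otimes K^-(q_3^{(j-1)/2}x)\otimes\eta(q_3^{(j-1)/2}x)\otimes1\otimes\cdots\otimes1 .$$ Define $\tilde b_{\pm r},\tilde b'_{\pm r}$ on the $n$-fold tensor product by $$\bigotimes_{k=1}^nK^+(q_3^{-(k-1)/2}x)=e^{\sum_{r\ge1}\tilde b_rC^rx^{-r}}e^{-\sum_{r\ge1}\tilde b'_rC^{-r}x^r},\qquad \bigotimes_{k=1}^nK^-(q_3^{-(n-k)/2}x)=e^{-\sum_{r\ge1}\tilde b_{-r}x^r}e^{\sum_{r\ge1}\tilde b'_{-r}x^{-r}},$$ let $\alpha(x)=e^{-\sum_r\frac{\tilde b_{-r}x^r}{C^r-C^{-r}}}e^{-\sum_r\frac{\tilde b'_{-r}x^{-r}}{C^r-C^{-r}}}$ and $\beta(x)=e^{\sum_r\frac{\tilde b_{r}x^{-r}}{C^r-C^{-r}}}e^{\sum_r\frac{\tilde b'_{r}x^{r}}{C^r-C^{-r}}}$,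 and set $\widetilde T_1^{(3^n)}(x;p)=\sum_{j=1}^n\alpha(x)\Lambda_j(x)\beta(x)$. The correlation function $\langle0|\widetilde T^{(3^n)}_1(z_1;p)\cdots\widetilde T^{(3^n)}_1(z_m;p)|0\rangle$ is the sum over all intermediate Fock basis states of the products of matrix elements, as a formal series, expanded in powers of $p$ and then in the region $|z_1|>\cdots>|z_m|$. *Structure function.* Let $f^{(3^n)}_{11}(x;p)=\exp\big[\sum_{k\ge1}\frac{x^k}{k}\frac{g_k}{1-p^k}\big]\exp\big[\sum_{k\ge1}\frac{x^{-k}}{k}\frac{p^kg_k}{1-p^k}\big]$ with $$g_k=(q_3^{k/2}-q_3^{-k/2})(C^kq_3^{-k/2}-C^{-k}q_3^{k/2})\frac{(q_1^{k/2}-q_1^{-k/2})(q_2^{k/2}-q_2^{-k/2})}{(C^k-C^{-k})(q_3^{k/2}-q_3^{-k/2})}.$$ *Target spaces.* Let $\Lambda_{\mathbb{Q}(q,t)}(u_1,\dots,u_n)$ be the ring of symmetric polynomials over the field $\mathbb{Q}(q,t)\subset\mathbb{C}$. Let $S^k$ be the $\mathbb{Q}(q,t)$-space of symmetric functions of $z_1,\dots,z_k$,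 i.e. of power series in $p$ with coefficients in $\mathbb{Q}(q,t)(z_1,\dots,z_k)$ that are invariant under permutations of $z_1,\dots,z_k$, and let $S=\bigoplus_{k\ge0}S^k$, with the star product $$(f\star g)(z_1,\dots,z_{i+j})=\operatorname{Sym}\Big[f(z_1,\dots,z_i)\,g(z_{i+1},\dots,z_{i+j})\prod_{\substack{1\le a\le i\\ i<b\le i+j}}\frac{\theta_p(q^{-1}z_b/z_a)\,\theta_p(tz_b/z_a)\,\theta_p(qt^{-1}z_b/z_a)}{\theta_p(z_b/z_a)^3}\Big],$$ where $f\in S^i$, $g\in S^j$, $\theta_p(x)=\prod_{k\ge0}(1-p^kx)(1-p^{k+1}x^{-1})$ and $\operatorname{Sym}$ is the average over all permutations of the variables. **Theorem.** The correlation function and the functions $f^{(3^n)}_{11}(z_j/z_i;p)$, $i<j$, are well-defined formal series, and $$\prod_{1\le i<j\le m}f^{(3^n)}_{11}\Big(\frac{z_j}{z_i};p\Big)\cdot\langle0|\widetilde T^{(3^n)}_1(z_1;p)\cdots\widetilde T^{(3^n)}_1(z_m;p)|0\rangle\ \in\ \Lambda_{\mathbb{Q}(q,t)}(u_1,\dots,u_n)\otimes_{\mathbb{Q}(q,t)}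 S,$$ in the component $\Lambda_{\mathbb{Q}(q,t)}(u_1,\dots,u_n)\otimes S^m$; that is, there is one element $X$ of $\Lambda_{\mathbb{Q}(q,t)}(u_1,\dots,u_n)\otimes S^m$, independent of the values of the $u_i$, whose evaluation at any $u\in\mathbb{C}^n$, expanded in the region $|z_1|>\cdots>|z_m|$, is the left-hand side. In particular the left-hand side is symmetric in $u_1,\dots,u_n$ and, as a function, in $z_1,\dots,z_m$. -/

import Mathlib

open scoped TensorProduct

noncomputable section

namespace EllipticCorner

/-! ## Formal series in `p` and `z₁, …, zₘ`

Correlation functions are expanded first in powers of the elliptic nome `p`, and then, coefficient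
by coefficient, in the region `|z₁| > |z₂| > ⋯ > |zₘ|`.  Both expansions take place in a field of
iterated Hahn series. -/

/-- Laurent-type series in `z₁, …, zₘ` expanded in the region `|z₁| > ⋯ > |zₘ|`: the exponent vector
`v` stands for the monomial `∏ zᵢ ^ (-vᵢ)`, so that for `i < j` the ratio `z_j / z_i` has a positive
exponent in the lexicographic order. -/
abbrev ZSeries (m : ℕ) : Type := HahnSeries (Lex (Fin m → ℤ)) ℂ

/-- Laurent series in `p` whose coefficients are series in `z₁, …, zₘ`. -/
def Corr (m : ℕ) : Type := HahnSeries ℤ (ZSeries m)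

instance (m : ℕ) : Field (Corr m) := inferInstanceAs (Field (HahnSeries ℤ (ZSeries m)))

/-- The coefficient of `p^N ∏ zᵢ ^ (-vᵢ)`. -/
def Corr.coeff {m : ℕ} (f : Corr m) (N : ℤ) (v : Lex (Fin m → ℤ)) : ℂ :=
  (HahnSeries.coeff (show HahnSeries ℤ (ZSeries m) from f) N).coeff v

/-- A series in `z`, as a series in `p` that is constant in `p`. -/
def ofZ (m : ℕ) : ZSeries m →+* Corr m :=
  show ZSeries m →+* HahnSeries ℤ (ZSeries m) from HahnSeries.C

/-- The variable `z_i`. -/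
def zVar {m : ℕ} (i : Fin m) : ZSeries m := HahnSeries.single (toLex (Pi.single i (-1))) 1

/-- The variable `z_i`, as an element of `Corr m`. -/
def zc {m : ℕ} (i : Fin m) : Corr m := ofZ m (zVar i)

/-- The nome `p`. -/
def nome (m : ℕ) : Corr m :=
  show HahnSeries ℤ (ZSeries m) from HahnSeries.single 1 1

/-- A complex constant. -/
def cst (m : ℕ) : ℂ →+* Corr m := (ofZ m).comp HahnSeries.C

instance (m : ℕ) : Algebra ℂ (Corr m) := (cst m).toAlgebra

/-- `s` is the sum of the family `f`: each coefficient (of a power of `p` times a monomial in `z`)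
receives finitely many nonzero contributions, and they add up to the coefficient of `s`. -/
def HasFormalSum {m : ℕ} {ι : Type} (f : ι → Corr m) (s : Corr m) : Prop :=
  ∀ (N : ℤ) (v : Lex (Fin m → ℤ)),
    {i | (f i).coeff N v ≠ 0}.Finite ∧ s.coeff N v = ∑ᶠ i, (f i).coeff N v

theorem HasFormalSum.unique {m : ℕ} {ι : Type} {f : ι → Corr m} {s s' : Corr m}
    (h : HasFormalSum f s) (h' : HasFormalSum f s') : s = s' := by
  apply HahnSeries.ext
  funext N
  apply HahnSeries.ext
  funext v
  exact (h N v).2.trans (h' N v).2.symm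

/-- `e = exp E = ∑ₖ Eᵏ / k!`. -/
def IsExp {m : ℕ} (E e : Corr m) : Prop :=
  HasFormalSum (fun k : ℕ => cst m ((k.factorial : ℂ)⁻¹) * E ^ k) e

/-! ## Parameters

`ρ i` is a fourth root of `q_{i+1}`; half- and quarter-integral powers of the `q`'s are integral
powers of the `ρ`'s. -/

/-- `q_{i+1} ^ (k/4)`. -/
def qQuarter (ρ : Fin 3 → ℂ) (i : Fin 3) (k : ℤ) : ℂ := ρ i ^ k

/-- `q_{i+1} ^ (k/2)`. -/
def qHalf (ρ : Fin 3 → ℂ) (i : Fin 3) (k : ℤ) : ℂ := ρ i ^ (2 * k)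

/-- `q_{i+1} ^ k`. -/
def qInt (ρ : Fin 3 → ℂ) (i : Fin 3) (k : ℤ) : ℂ := ρ i ^ (4 * k)

/-- `q_{i+1} ^ (k/2) - q_{i+1} ^ (-k/2)`. -/
def qDiff (ρ : Fin 3 → ℂ) (i : Fin 3) (k : ℤ) : ℂ := qHalf ρ i k - qHalf ρ i (-k)

/-- `κ_k = (q₁ᵏ - 1)(q₂ᵏ - 1)(q₃ᵏ - 1)`. -/
def kappa (ρ : Fin 3 → ℂ) (k : ℤ) : ℂ :=
  (qInt ρ 0 k - 1) * (qInt ρ 1 k - 1) * (qInt ρ 2 k - 1)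

/-- `C ^ k` on an `n`-fold tensor product of Fock representations of colour `3`, which is
`q_c⃗ ^ (k/2) = q₃ ^ (n k / 2)`. -/
def centralPow (ρ : Fin 3 → ℂ) (n : ℕ) (k : ℤ) : ℂ := qHalf ρ 2 (n * k)

/-! ## The Fock space for `c⃗ = (3ⁿ)` -/

/-- Modes: `inl (k, r)` labels `a_{± r}` and `inr (k, r)` labels `b_{± r}` in the `k`-th tensor
factor, `r ≥ 1`. -/
abbrev Mode (n : ℕ) : Type := (Fin n × ℕ+) ⊕ (Fin n × ℕ+)

/-- The commutator `[a_r, a_{-r}] = (r / κ_r) (q₃^{r/2} - q₃^{-r/2}) (1 - p^r)`, respectively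
`[b_r, b_{-r}] = (r / κ_r) (q₃^{r/2} - q₃^{-r/2}) (1 - p^r) / p^r`. -/
def bracket (ρ : Fin 3 → ℂ) (n m : ℕ) : Mode n → Corr m
  | .inl (_, r) => cst m ((r : ℕ) / kappa ρ (r : ℕ) * qDiff ρ 2 (r : ℕ)) * (1 - nome m ^ (r : ℕ))
  | .inr (_, r) => cst m ((r : ℕ) / kappa ρ (r : ℕ) * qDiff ρ 2 (r : ℕ)) *
      ((1 - nome m ^ (r : ℕ)) / nome m ^ (r : ℕ))

/-- The Fock space `𝓗⁽³⁾ ⊗ ⋯ ⊗ 𝓗⁽³⁾` (`n` factors), with basis the monomials in the creation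
operators applied to `|0⟩ = 1`. -/
abbrev Fock (n m : ℕ) : Type := MvPolynomial (Mode n) (Corr m)

/-- The formal completion of the Fock space, in which infinite sums of basis states are allowed. -/
abbrev FockHat (n m : ℕ) : Type := MvPowerSeries (Mode n) (Corr m)

/-- Basis states: occupation numbers of the modes. -/
abbrev State (n : ℕ) : Type := Mode n →₀ ℕ

/-- Creation operators `a_{-r}`, `b_{-r}`. -/
def create (n m : ℕ) (j : Mode n) : Fock n m →ₗ[Corr m] Fock n m :=
  LinearMap.mulLeft (Corr m) (MvPolynomial.X j)

/-- Annihilation operators `a_r`, `b_r`. -/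
def annih (ρ : Fin 3 → ℂ) (n m : ℕ) (j : Mode n) : Fock n m →ₗ[Corr m] Fock n m :=
  bracket ρ n m j • (MvPolynomial.pderiv j).toLinearMap

theorem annih_vacuum (ρ : Fin 3 → ℂ) (n m : ℕ) (j : Mode n) : annih ρ n m j 1 = 0 := by
  simp [annih]

theorem heisenberg (ρ : Fin 3 → ℂ) (n m : ℕ) (i j : Mode n) (P : Fock n m) :
    annih ρ n m i (create n m j P) - create n m j (annih ρ n m i P) =
      if i = j then bracket ρ n m i • P else 0 := by
  classical
  by_cases h : i = j
  · subst h
    simp [annih, create, Derivation.leibniz, smul_add]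
  · simp [annih, create, Derivation.leibniz, MvPolynomial.pderiv_X_of_ne (Ne.symm h), h]

/-- `exp (∑ⱼ A_j · (creation operator j))`, applied to the vacuum: its component along
`∏ (creation operator j)^{ν_j} |0⟩` is `∏ A_j^{ν_j} / ν_j!`. -/
def expCreate {n m : ℕ} (A : Mode n → Corr m) : FockHat n m :=
  fun ν => ν.prod fun j k => cst m ((k.factorial : ℂ)⁻¹) * A j ^ k

/-- `∑ⱼ B_j · (annihilation operator j)`: the annihilation operator `j` is the derivation sending
the creation operator `j` to the commutator and the other creation operators to `0`. -/
def annihSum (ρ : Fin 3 → ℂ) {n m : ℕ} (B : Mode n → Corr m) :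
    Derivation (Corr m) (Fock n m) (Fock n m) :=
  MvPolynomial.mkDerivation (Corr m) fun j => MvPolynomial.C (B j * bracket ρ n m j)

theorem annihSum_single (ρ : Fin 3 → ℂ) {n m : ℕ} [DecidableEq (Mode n)] (j : Mode n) (b : Corr m)
    (P : Fock n m) : annihSum ρ (Pi.single j b) P = b • annih ρ n m j P := by
  have : annihSum ρ (Pi.single j b) = (b * bracket ρ n m j) • MvPolynomial.pderiv j := by
    apply MvPolynomial.derivation_ext
    intro i
    by_cases h : i = j
    · subst h
      simp [annihSum, MvPolynomial.mkDerivation_X, MvPolynomial.smul_eq_C_mul]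
    · simp [annihSum, MvPolynomial.mkDerivation_X, MvPolynomial.pderiv_X_of_ne h, h]
  rw [this]
  simp [annih, mul_smul]

/-- `exp (∑ⱼ B_j · (annihilation operator j))` on the Fock space; the exponent lowers the degree,
so that the exponential series terminates. -/
def expAnnih (ρ : Fin 3 → ℂ) {n m : ℕ} (B : Mode n → Corr m) (P : Fock n m) : Fock n m :=
  ∑ k ∈ Finset.range (P.totalDegree + 1),
    cst m ((k.factorial : ℂ)⁻¹) • ((annihSum ρ B : Fock n m → Fock n m)^[k] P)

/-- The normal ordered exponential
`exp (∑ⱼ A_j · (creation operator j)) exp (∑ⱼ B_j · (annihilation operator j))`. -/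
def normalOrderedExp (ρ : Fin 3 → ℂ) {n m : ℕ} (A B : Mode n → Corr m) (P : Fock n m) :
    FockHat n m :=
  expCreate A * (expAnnih ρ B P : FockHat n m)

/-- The matrix element of the normal ordered exponential between the basis states `μ` (incoming)
and `ν` (outgoing). -/
def matrixElement (ρ : Fin 3 → ℂ) {n m : ℕ} (A B : Mode n → Corr m) (ν μ : State n) : Corr m :=
  MvPowerSeries.coeff ν (normalOrderedExp ρ A B (MvPolynomial.monomial μ 1))

/-! ## Vertex operators -/

/-- The exponent of a normal ordered exponential in one Fock space `𝓗⁽³⁾`: the coefficients of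
`a_{-r}`, `b_{-r}`, `a_r`, `b_r`, `r ≥ 1`. -/
@[ext]
structure Exponent (m : ℕ) where
  aNeg : ℕ+ → Corr m
  bNeg : ℕ+ → Corr m
  aPos : ℕ+ → Corr m
  bPos : ℕ+ → Corr m

/-- `(1 / (1 - p^r)) κ_r / r`. -/
def aFac (ρ : Fin 3 → ℂ) (m : ℕ) (r : ℕ+) : Corr m :=
  1 / (1 - nome m ^ (r : ℕ)) * cst m (kappa ρ (r : ℕ) / (r : ℕ))

/-- `(p^r / (1 - p^r)) κ_r / r`. -/
def bFac (ρ : Fin 3 → ℂ) (m : ℕ) (r : ℕ+) : Corr m :=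
  nome m ^ (r : ℕ) / (1 - nome m ^ (r : ℕ)) * cst m (kappa ρ (r : ℕ) / (r : ℕ))

/-- The image of `K⁺(x; p)` in the horizontal Fock representation of colour `3`. -/
def kPlus (ρ : Fin 3 → ℂ) {m : ℕ} (x : Corr m) : Exponent m where
  aNeg _ := 0
  bNeg _ := 0
  aPos r := aFac ρ m r * cst m (qQuarter ρ 2 (r : ℕ)) * x⁻¹ ^ (r : ℕ)
  bPos r := -(bFac ρ m r * cst m (qQuarter ρ 2 (-(r : ℕ))) * x ^ (r : ℕ))

/-- The image `φ⁻(x; p)` of `K⁻(x; p)` in the horizontal Fock representation of colour `3`. -/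
def kMinus (ρ : Fin 3 → ℂ) {m : ℕ} (x : Corr m) : Exponent m where
  aNeg r := -(aFac ρ m r * cst m (qQuarter ρ 2 (-(r : ℕ))) * x ^ (r : ℕ))
  bNeg r := bFac ρ m r * cst m (qQuarter ρ 2 (r : ℕ)) * x⁻¹ ^ (r : ℕ)
  aPos _ := 0
  bPos _ := 0

/-- `η(x; p)`, the image of `E(x; p)` in the horizontal Fock representation of colour `3` without
its scalar prefactor. -/
def eta (ρ : Fin 3 → ℂ) {m : ℕ} (x : Corr m) : Exponent m where
  aNeg r := aFac ρ m r * cst m (qQuarter ρ 2 (-(r : ℕ)) / qDiff ρ 2 (r : ℕ)) * x ^ (r : ℕ)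
  bNeg r := bFac ρ m r * cst m (qQuarter ρ 2 (r : ℕ) / qDiff ρ 2 (r : ℕ)) * x⁻¹ ^ (r : ℕ)
  aPos r := -(aFac ρ m r * cst m (qQuarter ρ 2 (r : ℕ) / (qInt ρ 2 (r : ℕ) - 1)) * x⁻¹ ^ (r : ℕ))
  bPos r := bFac ρ m r * cst m (qQuarter ρ 2 (-(r : ℕ)) / (qInt ρ 2 (-(r : ℕ)) - 1)) * x ^ (r : ℕ)

/-- The identity operator. -/
def oneExp (m : ℕ) : Exponent m := ⟨0, 0, 0, 0⟩

/-- The elliptic vertex operator `Λ_j(x; p)` without the factor `u_j`, tensor factor by tensor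
factor: with the factors numbered from `0`, it is
`φ⁻(q₃^{1/2} x) ⊗ ⋯ ⊗ φ⁻(q₃^{j/2} x) ⊗ η(q₃^{j/2} x) ⊗ 1 ⊗ ⋯ ⊗ 1`. -/
def vertexExp (ρ : Fin 3 → ℂ) {n m : ℕ} (j : Fin n) (x : Corr m) (k : Fin n) : Exponent m :=
  if k < j then kMinus ρ (cst m (qHalf ρ 2 ((k : ℕ) + 1)) * x)
  else if k = j then eta ρ (cst m (qHalf ρ 2 (j : ℕ)) * x)
  else oneExp m

/-- `Δ^{(n-1)} K⁺(x) = K⁺(x) ⊗ K⁺(C₁⁻¹ x) ⊗ ⋯ ⊗ K⁺(C₁⁻¹ ⋯ C_{n-1}⁻¹ x)`. -/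
def kPlusCoprod (ρ : Fin 3 → ℂ) {n m : ℕ} (x : Corr m) (k : Fin n) : Exponent m :=
  kPlus ρ (cst m (qHalf ρ 2 (-(k : ℕ))) * x)

/-- `Δ^{(n-1)} K⁻(x) = K⁻(C₂⁻¹ ⋯ C_n⁻¹ x) ⊗ ⋯ ⊗ K⁻(C_n⁻¹ x) ⊗ K⁻(x)`. -/
def kMinusCoprod (ρ : Fin 3 → ℂ) {n m : ℕ} (x : Corr m) (k : Fin n) : Exponent m :=
  kMinus ρ (cst m (qHalf ρ 2 (-((n : ℤ) - 1 - (k : ℕ)))) * x)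

/-- `(C^r - C^{-r})⁻¹`. -/
def cDiffInv (ρ : Fin 3 → ℂ) (n m : ℕ) (r : ℕ+) : Corr m :=
  cst m (centralPow ρ n (r : ℕ) - centralPow ρ n (-(r : ℕ)))⁻¹

/-- The exponent of
`α(x) = exp (-∑ b̃_{-r} x^r / (C^r - C^{-r})) exp (-∑ b̃'_{-r} x^{-r} / (C^r - C^{-r}))`, where
`K⁻(x) = exp (-∑ b̃_{-r} x^r) exp (∑ b̃'_{-r} x^{-r})`. -/
def alphaExp (ρ : Fin 3 → ℂ) {n m : ℕ} (x : Corr m) (k : Fin n) : Exponent m where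
  aNeg r := cDiffInv ρ n m r * (kMinusCoprod ρ x k).aNeg r
  bNeg r := -(cDiffInv ρ n m r * (kMinusCoprod ρ x k).bNeg r)
  aPos _ := 0
  bPos _ := 0

/-- The exponent of
`β(x) = exp (∑ b̃_r x^{-r} / (C^r - C^{-r})) exp (∑ b̃'_r x^r / (C^r - C^{-r}))`, where
`K⁺(x) = exp (∑ b̃_r C^r x^{-r}) exp (-∑ b̃'_r C^{-r} x^r)`. -/
def betaExp (ρ : Fin 3 → ℂ) {n m : ℕ} (x : Corr m) (k : Fin n) : Exponent m where
  aNeg _ := 0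
  bNeg _ := 0
  aPos r := cDiffInv ρ n m r *
    (cst m (centralPow ρ n (-(r : ℕ))) * (kPlusCoprod ρ x k).aPos r)
  bPos r := cDiffInv ρ n m r *
    -(cst m (centralPow ρ n (r : ℕ)) * (kPlusCoprod ρ x k).bPos r)

/-- Creation part of the exponent of the decoupled elliptic vertex operator
`Λ̃_j(x; p) = α(x; p) Λ_j(x; p) β(x; p)`. Since `α` contains only creation operators and `β` only
annihilation operators, the product is already normal ordered and the exponents add up. -/
def decoupledCreate (ρ : Fin 3 → ℂ) {n m : ℕ} (j : Fin n) (x : Corr m) : Mode n → Corr m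
  | .inl (k, r) => (alphaExp ρ x k).aNeg r + (vertexExp ρ j x k).aNeg r
  | .inr (k, r) => (alphaExp ρ x k).bNeg r + (vertexExp ρ j x k).bNeg r

/-- Annihilation part of the exponent of `Λ̃_j(x; p)`. -/
def decoupledAnnih (ρ : Fin 3 → ℂ) {n m : ℕ} (j : Fin n) (x : Corr m) : Mode n → Corr m
  | .inl (k, r) => (vertexExp ρ j x k).aPos r + (betaExp ρ x k).aPos r
  | .inr (k, r) => (vertexExp ρ j x k).bPos r + (betaExp ρ x k).bPos r

/-- The matrix elements of the current `T̃₁(x; p) = ∑ⱼ Λ̃_j(x; p)` for `c⃗ = (3ⁿ)`, where `Λ̃_j`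
is `u_j` times a normal ordered exponential. -/
def currentElement (ρ : Fin 3 → ℂ) {n m : ℕ} (u : Fin n → ℂ) (x : Corr m) (ν μ : State n) :
    Corr m :=
  ∑ j : Fin n, cst m (u j) * matrixElement ρ (decoupledCreate ρ j x) (decoupledAnnih ρ j x) ν μ

/-- Sequences of states `ν₀, ν₁, …, νₘ` beginning and ending with the vacuum. -/
abbrev Path (n m : ℕ) : Type :=
  {ν : Fin (m + 1) → State n // ν 0 = 0 ∧ ν (Fin.last m) = 0}

/-- `G = ⟨0| T̃₁(z₁; p) ⋯ T̃₁(zₘ; p) |0⟩`: the sum, over all intermediate basis states, of the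
products of matrix elements. -/
def IsVacuumCorrelation (ρ : Fin 3 → ℂ) {n m : ℕ} (u : Fin n → ℂ) (G : Corr m) : Prop :=
  HasFormalSum
    (fun ν : Path n m => ∏ i : Fin m, currentElement ρ u (zc i) (ν.1 i.castSucc) (ν.1 i.succ)) G

/-! ## The structure function `f₁₁` -/

/-- The coefficient of `x^k / k · 1 / (1 - p^k)` in the exponent of `f₁₁^{(3ⁿ)}(x; p)`. -/
def structCoeff (ρ : Fin 3 → ℂ) (n : ℕ) (k : ℤ) : ℂ :=
  qDiff ρ 2 k * (centralPow ρ n k * qHalf ρ 2 (-k) - centralPow ρ n (-k) * qHalf ρ 2 k) *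
    (qDiff ρ 0 k * qDiff ρ 1 k /
      ((centralPow ρ n k - centralPow ρ n (-k)) * qDiff ρ 2 k))

/-- `φ = f₁₁^{(3ⁿ)}(x; p)`, the product of the exponentials of
`∑ (x^k / k) (1 / (1 - p^k)) (⋯)` and `∑ (x^{-k} / k) (p^k / (1 - p^k)) (⋯)`. -/
def IsStructureFunction (ρ : Fin 3 → ℂ) (n : ℕ) {m : ℕ} (x φ : Corr m) : Prop :=
  ∃ E₁ E₂ e₁ e₂ : Corr m,
    HasFormalSum (fun k : ℕ+ => x ^ (k : ℕ) * (1 / (1 - nome m ^ (k : ℕ))) *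
      cst m (structCoeff ρ n (k : ℕ) / (k : ℕ))) E₁ ∧
    HasFormalSum (fun k : ℕ+ => x⁻¹ ^ (k : ℕ) * (nome m ^ (k : ℕ) / (1 - nome m ^ (k : ℕ))) *
      cst m (structCoeff ρ n (k : ℕ) / (k : ℕ))) E₂ ∧
    IsExp E₁ e₁ ∧ IsExp E₂ e₂ ∧ φ = e₁ * e₂

/-! ## Symmetric functions and the star product -/

/-- The field `ℚ(q, t)`. -/
abbrev coefField (q t : ℂ) : IntermediateField ℚ ℂ := IntermediateField.adjoin ℚ {q, t}

def qElt (q t : ℂ) : coefField q t := ⟨q, IntermediateField.subset_adjoin ℚ _ (by simp)⟩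

def tElt (q t : ℂ) : coefField q t := ⟨t, IntermediateField.subset_adjoin ℚ _ (by simp)⟩

/-- Rational functions `F(z₁, …, z_k)`. -/
abbrev RatFn (F : Type) [Field F] (k : ℕ) : Type := FractionRing (MvPolynomial (Fin k) F)

/-- Renaming of variables `z_i ↦ z_{σ i}` in rational functions, for `σ` injective. -/
def ratRename (F : Type) [Field F] {k l : ℕ} (σ : Fin k ↪ Fin l) : RatFn F k →ₐ[F] RatFn F l :=
  IsFractionRing.liftAlgHom
    (g := (IsScalarTower.toAlgHom F (MvPolynomial (Fin l) F) (RatFn F l)).comp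
      (MvPolynomial.rename σ))
    ((IsFractionRing.injective (MvPolynomial (Fin l) F) (RatFn F l)).comp
      (MvPolynomial.rename_injective σ σ.injective))

/-- Functions of `z₁, …, z_k` and `p`: power series in `p` with rational functions of `z` as
coefficients. -/
abbrev EllFn (F : Type) [Field F] (k : ℕ) : Type := PowerSeries (RatFn F k)

/-- Renaming of variables. -/
def ellRename (F : Type) [Field F] {k l : ℕ} (σ : Fin k ↪ Fin l) : EllFn F k →ₐ[F] EllFn F l :=
  PowerSeries.mapAlgHom (ratRename F σ)

/-- The theta function `θ_p(x) = ∏_{k ≥ 0} (1 - p^k x) (1 - p^{k+1} x⁻¹)` as a power series in `p`;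
the factors with `k > N` do not affect the coefficient of `p^N`. -/
def theta {E : Type} [Field E] (x : E) : PowerSeries E :=
  PowerSeries.mk fun N => PowerSeries.coeff N
    (∏ k ∈ Finset.range (N + 1),
      (1 - PowerSeries.C x * PowerSeries.X ^ k) *
        (1 - PowerSeries.C x⁻¹ * PowerSeries.X ^ (k + 1)))

/-- `S^k`: symmetric functions in `k` variables. -/
def SymFn (q t : ℂ) (k : ℕ) : Submodule (coefField q t) (EllFn (coefField q t) k) where
  carrier := {g | ∀ σ : Equiv.Perm (Fin k), ellRename (coefField q t) σ.toEmbedding g = g}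
  add_mem' ha hb σ := by rw [map_add, ha σ, hb σ]
  zero_mem' σ := map_zero _
  smul_mem' c x hx σ := by rw [map_smul, hx σ]

theorem ratRename_comp (F : Type) [Field F] {k l r : ℕ} (τ : Fin l ↪ Fin r) (σ : Fin k ↪ Fin l)
    (f : RatFn F k) : ratRename F τ (ratRename F σ f) = ratRename F (σ.trans τ) f := by
  have h : (ratRename F τ).toRingHom.comp (ratRename F σ).toRingHom =
      (ratRename F (σ.trans τ)).toRingHom := by
    apply IsLocalization.ringHom_ext (nonZeroDivisors (MvPolynomial (Fin k) F))
    ext x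
    · simp only [RingHom.comp_apply, AlgHom.toRingHom_eq_coe, RingHom.coe_coe]
      change ratRename F τ (ratRename F σ (algebraMap F (RatFn F k) x)) =
        ratRename F (σ.trans τ) (algebraMap F (RatFn F k) x)
      simp only [AlgHom.commutes]
    · simp [ratRename, IsFractionRing.liftAlgHom]
  exact congrArg (fun g : RatFn F k →+* RatFn F r => g f) h

theorem ellRename_comp (F : Type) [Field F] {k l r : ℕ} (τ : Fin l ↪ Fin r) (σ : Fin k ↪ Fin l)
    (f : EllFn F k) : ellRename F τ (ellRename F σ f) = ellRename F (σ.trans τ) f := by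
  ext N
  simp only [ellRename, PowerSeries.mapAlgHom_apply, PowerSeries.coeff_map, RingHom.coe_coe,
    ratRename_comp]

/-- Symmetrization `(1 / k!) ∑_σ σ f`. -/
def symmetrize (q t : ℂ) (k : ℕ) : EllFn (coefField q t) k →ₗ[coefField q t] SymFn q t k where
  toFun f := ⟨((k.factorial : coefField q t)⁻¹) •
      ∑ σ : Equiv.Perm (Fin k), ellRename (coefField q t) σ.toEmbedding f, fun τ => by
    rw [map_smul, map_sum]
    congr 1
    simp only [ellRename_comp]
    exact Fintype.sum_equiv (Equiv.mulLeft τ) _ _ fun σ => rfl⟩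
  map_add' f g := by
    ext1
    simp [Finset.sum_add_distrib]
  map_smul' c f := by
    ext1
    simp only [map_smul, RingHom.id_apply, SetLike.val_smul, ← Finset.smul_sum]
    rw [smul_comm]

/-- The variable `z_i` in the field of rational functions. -/
def ratVar (F : Type) [Field F] {k : ℕ} (i : Fin k) : RatFn F k :=
  algebraMap (MvPolynomial (Fin k) F) (RatFn F k) (MvPolynomial.X i)

/-- A constant, as a rational function. -/
def ratConst (F : Type) [Field F] {k : ℕ} (c : F) : RatFn F k := algebraMap F (RatFn F k) c

/-- `θ_p(q⁻¹ x) θ_p(t x) θ_p(q t⁻¹ x) / θ_p(x)³`. -/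
def starFactor (q t : ℂ) {k : ℕ} (x : RatFn (coefField q t) k) : EllFn (coefField q t) k :=
  theta (ratConst _ (qElt q t)⁻¹ * x) * theta (ratConst _ (tElt q t) * x) *
    theta (ratConst _ (qElt q t * (tElt q t)⁻¹) * x) * (theta x ^ 3)⁻¹

/-- The star product `S^i ⊗ S^j → S^{i+j}`. -/
def star (q t : ℂ) {i j : ℕ} (f : SymFn q t i) (g : SymFn q t j) : SymFn q t (i + j) :=
  symmetrize q t (i + j)
    (ellRename (coefField q t) (Fin.castAddEmb j) f * ellRename (coefField q t) (Fin.natAddEmb i) g *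
      ∏ a : Fin i, ∏ b : Fin j,
        starFactor q t (ratVar _ (Fin.natAdd i b) / ratVar _ (Fin.castAdd j a)))

instance (q t : ℂ) : DirectSum.GNonUnitalNonAssocSemiring fun k => SymFn q t k where
  mul f g := star q t f g
  mul_zero f := by simp [star]
  zero_mul f := by simp [star]
  mul_add f g h := by simp [star, mul_add, add_mul]
  add_mul f g h := by simp [star, add_mul]

/-- `S = ⨁ₖ S^k`, with the star product as its multiplication. -/
abbrev StarAlgebra (q t : ℂ) : Type := DirectSum ℕ fun k => SymFn q t k

/-- `Λ_{ℚ(q,t)}(u₁, …, uₙ)`: symmetric polynomials in `u₁, …, uₙ`. -/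
abbrev SymPoly (q t : ℂ) (n : ℕ) : Subalgebra (coefField q t) (MvPolynomial (Fin n) (coefField q t)) :=
  MvPolynomial.symmetricSubalgebra (Fin n) (coefField q t)

/-! ## Expansion of functions of `z₁, …, zₘ` in the region `|z₁| > ⋯ > |zₘ|` -/

/-- Polynomials in `z` as series. -/
def polyExpand (q t : ℂ) (m : ℕ) :
    MvPolynomial (Fin m) (coefField q t) →ₐ[coefField q t] ZSeries m :=
  MvPolynomial.aeval zVar

theorem polyExpand_monomial (q t : ℂ) (m : ℕ) (d : Fin m →₀ ℕ) (c : coefField q t) :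
    polyExpand q t m (MvPolynomial.monomial d c) =
      HahnSeries.single (toLex fun i => -(d i : ℤ)) (c : ℂ) := by
  have hz : ∀ (i : Fin m) (k : ℕ), (zVar i : ZSeries m) ^ k =
      HahnSeries.single (toLex (Pi.single i (-(k : ℤ)))) 1 := by
    intro i k
    rw [zVar, HahnSeries.single_pow, one_pow]
    have : k • (Pi.single i (-1) : Fin m → ℤ) = Pi.single i (-(k : ℤ)) := by
      rw [← Pi.single_smul]
      simp
    rw [← this]
    rfl
  have hprod : ∀ s : Finset (Fin m), ∏ i ∈ s, (zVar i : ZSeries m) ^ d i =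
      HahnSeries.single (toLex (∑ i ∈ s, Pi.single i (-(d i : ℤ)))) 1 := by
    intro s
    induction s using Finset.induction_on with
    | empty => simp
    | insert a s ha ih =>
      rw [Finset.prod_insert ha, ih, hz, HahnSeries.single_mul_single, one_mul,
        Finset.sum_insert ha, toLex_add]
  rw [polyExpand, MvPolynomial.aeval_monomial, Finsupp.prod_fintype _ _ (by simp), hprod]
  have hc : algebraMap (coefField q t) (ZSeries m) c = HahnSeries.C (c : ℂ) := rfl
  rw [hc, HahnSeries.C_apply, HahnSeries.single_mul_single, zero_add, mul_one]
  congr 1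
  congr 1
  exact Finset.univ_sum_single fun i => -(d i : ℤ)

theorem polyExpand_injective (q t : ℂ) (m : ℕ) : Function.Injective (polyExpand q t m) := by
  rw [injective_iff_map_eq_zero]
  intro P hP
  ext d
  have key : (polyExpand q t m P).coeff (toLex fun i => -(d i : ℤ)) = ((MvPolynomial.coeff d P : coefField q t) : ℂ) := by
    conv_lhs => rw [P.as_sum]
    rw [map_sum, HahnSeries.coeff_sum]
    simp only [polyExpand_monomial]
    rw [Finset.sum_eq_single d]
    · simp
    · intro e _ hed
      apply HahnSeries.coeff_single_of_ne
      intro h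
      apply hed
      ext i
      have := congrFun (toLex.injective h) i
      simpa using this.symm
    · intro h
      simp [MvPolynomial.notMem_support_iff.mp h]
  rw [hP] at key
  simpa using key.symm

/-- The expansion of a rational function of `z`. -/
def ratExpand (q t : ℂ) (m : ℕ) : RatFn (coefField q t) m →ₐ[coefField q t] ZSeries m :=
  IsFractionRing.liftAlgHom (polyExpand_injective q t m)

/-- The expansion of a power series in `p` whose coefficients are rational functions of `z`. -/
def ellExpand (q t : ℂ) (m : ℕ) : EllFn (coefField q t) m →ₐ[coefField q t] Corr m where
  toRingHom := show EllFn (coefField q t) m →+* HahnSeries ℤ (ZSeries m) from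
    (HahnSeries.ofPowerSeries ℤ (ZSeries m)).comp
      (PowerSeries.map (ratExpand q t m : RatFn (coefField q t) m →+* ZSeries m))
  commutes' c := by
    have h₁ : algebraMap (coefField q t) (EllFn (coefField q t) m) c =
        PowerSeries.C (algebraMap (coefField q t) (RatFn (coefField q t) m) c) :=
      PowerSeries.algebraMap_apply
    have h₂ : ratExpand q t m (algebraMap (coefField q t) (RatFn (coefField q t) m) c) =
        HahnSeries.C (c : ℂ) := (ratExpand q t m).commutes c
    change HahnSeries.ofPowerSeries ℤ (ZSeries m) (PowerSeries.map _ _) =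
      HahnSeries.C (HahnSeries.C (c : ℂ))
    rw [h₁, PowerSeries.map_C, HahnSeries.ofPowerSeries_C]
    exact congrArg _ h₂

/-- Specialization of the variables `u_i` to complex numbers and expansion of the component of
degree `m` in `z`: the linear map `Λ ⊗ S → Corr m` sending `P ⊗ g` to `P(u) g_m(z; p)`. -/
def realize (q t : ℂ) {n : ℕ} (m : ℕ) (u : Fin n → ℂ) :
    SymPoly q t n ⊗[coefField q t] StarAlgebra q t →ₗ[coefField q t] Corr m :=
  TensorProduct.lift
    ((LinearMap.mul (coefField q t) (Corr m)).compl₁₂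
      ((Algebra.ofId ℂ (Corr m)).toLinearMap.restrictScalars (coefField q t) ∘ₗ
        (MvPolynomial.aeval u).toLinearMap ∘ₗ (SymPoly q t n).val.toLinearMap)
      ((ellExpand q t m).toLinearMap ∘ₗ (SymFn q t m).subtype ∘ₗ
        DirectSum.component (coefField q t) ℕ (fun k => SymFn q t k) m))

/-- The subspace `Λ ⊗ S^m` of `Λ ⊗ S`. -/
def degreePart (q t : ℂ) (n m : ℕ) :
    Submodule (coefField q t) (SymPoly q t n ⊗[coefField q t] StarAlgebra q t) :=
  LinearMap.range (LinearMap.lTensor (SymPoly q t n)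
    (DirectSum.lof (coefField q t) ℕ (fun k => SymFn q t k) m))

end EllipticCorner

end

open EllipticCorner

/-! Wick's theorem turns the correlation function into an explicit sum. Expanding every current into
its `n` vertex operators gives a sum over maps `j` from positions `1, …, m` to indices `1, …, n`,
and each term is `∏ u_{j_i}` times the exponential of a sum of pairwise contractions. The structure
function is built so that, multiplied with the contraction of the operators at `z_i` and `z_l` (`i <
l`), it leaves `1` if `j_i = j_l`, `F(z_l / z_i)` if `j_i < j_l` and `F(z_i / z_l)` if `j_i > j_l`,
where `F(w) = θ(q₁⁻¹w) θ(q₂⁻¹w) / (θ(w) θ(q₃w))`. Hence the left-hand side is the expansion of `∑_j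
∏ u_{j_i} ∏_{j_i < j_l} F(z_l / z_i)` (`ofPow_currentSum`).

In this form the coefficients visibly lie in `ℚ(q, t)(z)⟦p⟧`, and a permutation of the `z_i` only
permutes the maps `j`. What remains is the symmetry in `u`. It is enough to exchange two adjacent
values `a`, `b`. Merging them groups the maps `j` into fibres, and over each fibre the dependence on
`u_a`, `u_b` is the sum over decompositions `S = I ⊔ J` of `u_a^{|I|} u_b^{|J|} ∏_{i ∈ I, l ∈ J}
F(x_l / x_i)`. The symmetry of this sum in `u_a`, `u_b` is Ruijsenaars' identity (`decompSum_comm`).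

Ruijsenaars' identity is proved by induction on `|S|`. Let `δ` be the difference of the two sums. As
a function of one point `z = x_s`, `δ` times its common denominator `∏ θ(z/x_i) θ(q₃z/x_i)
θ(q₃⁻¹z/x_i)` is quasi-periodic under `z ↦ pz`, with the same degree and multiplier as the
denominator. It vanishes at all the zeros of the denominator: at `x_i` because residues cancel, at
`q₃^{±1} x_i` by the induction hypothesis. A quasi-periodic series of degree `d` with more than `d`
zeros is zero (`IsQuasiPeriodic.eq_zero`), so `δ` does not depend on `x_s`. All points may therefore
be moved to `l / x_i` for a generic `l`. But inversion interchanges `I` and `J`, hence `u_a` and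
`u_b`, so `δ = -δ`.

Two devices keep everything formal. Contractions and exponentials are computed in a ring of ordinary
power series in `z_{k+1} / z_k`, `1 / z_m` and `p z₁`, where all exponents have no constant term,
and are then mapped to iterated Hahn series by `expand`. Wick's theorem is proved combinatorially:
both the amplitude of a path of occupation numbers and the sum over all contractions producing that
path satisfy one recursion, which removes a single quantum (`pathProd_eq_sum_fiber`). The element of
`Λ ⊗ S` is obtained by averaging over the permutations of the `u`'s and of the `z`'s; only the
vector space structure of `S` enters, not the star product. -/

noncomputable section

namespace EllipticCorner

/-! ## The theta function -/

section Theta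

open PowerSeries

/-- The partial products of `∏_{k ≥ 0} (1 - p^k x) (1 - p^{k+1} y)`. -/
def thetaProd {A : Type*} [CommRing A] (x y : A) (K : ℕ) : PowerSeries A :=
  ∏ k ∈ Finset.range K, (1 - C x * X ^ k) * (1 - C y * X ^ (k + 1))

/-- `∏_{k ≥ 0} (1 - p^k x) (1 - p^{k+1} y)`. -/
def thetaSeries {A : Type*} [CommRing A] (x y : A) : PowerSeries A :=
  PowerSeries.mk fun N => coeff N (thetaProd x y (N + 1))

variable {A B : Type*} [CommRing A] [CommRing B]

theorem coeff_mul_one_add_X_pow (f g : PowerSeries A) {N K : ℕ} (h : N < K) :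
    coeff N (f * (1 + X ^ K * g)) = coeff N f := by
  have : f * (1 + X ^ K * g) = f + X ^ K * (f * g) := by ring
  rw [this, map_add, coeff_X_pow_mul', if_neg (by omega), add_zero]

/-- The factor with index `K` is `1` modulo `p^K`, so the coefficient of `p^N` no longer changes
once `K > N`. -/
theorem coeff_thetaProd (x y : A) {N K : ℕ} (h : N < K) :
    coeff N (thetaProd x y K) = coeff N (thetaSeries x y) := by
  rw [thetaSeries, coeff_mk]
  induction K, (show N + 1 ≤ K from h) using Nat.le_induction with
  | base => rfl
  | succ K hK ih =>
    rw [← ih (by omega), thetaProd, Finset.prod_range_succ]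
    have : (1 - C x * X ^ K) * (1 - C y * X ^ (K + 1)) =
        1 + X ^ K * (-C x - C y * X + C x * C y * X ^ (K + 1)) := by ring
    rw [this, coeff_mul_one_add_X_pow _ _ (by omega)]
    rfl

theorem theta_eq_thetaSeries {E : Type} [Field E] (x : E) : theta x = thetaSeries x x⁻¹ := rfl

theorem map_thetaProd (g : A →+* B) (x y : A) (K : ℕ) :
    PowerSeries.map g (thetaProd x y K) = thetaProd (g x) (g y) K := by
  simp [thetaProd, map_prod]

theorem map_thetaSeries (g : A →+* B) (x y : A) :
    PowerSeries.map g (thetaSeries x y) = thetaSeries (g x) (g y) := by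
  ext N
  rw [coeff_map, thetaSeries, coeff_mk, ← coeff_map, map_thetaProd, thetaSeries, coeff_mk]

theorem map_theta {E F : Type} [Field E] [Field F] (g : E →+* F) (x : E) :
    PowerSeries.map g (theta x) = theta (g x) := by
  rw [theta_eq_thetaSeries, theta_eq_thetaSeries, map_thetaSeries, map_inv₀]

theorem constantCoeff_theta {E : Type} [Field E] (x : E) :
    constantCoeff (theta x) = 1 - x := by
  rw [theta_eq_thetaSeries, ← coeff_zero_eq_constantCoeff_apply, ← coeff_thetaProd _ _ zero_lt_one]
  simp [thetaProd]

/-- The constant term in `p` is `1 - x`. For formal `p` the only zero to avoid is therefore `x = 1`,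
not the whole orbit `p^ℤ`. -/
theorem theta_ne_zero {E : Type} [Field E] {x : E} (h : x ≠ 1) : theta x ≠ 0 := fun h0 => by
  have := constantCoeff_theta x
  rw [h0, map_zero] at this
  exact h (sub_eq_zero.mp this.symm).symm

/-- Shifting the index by one in the partial products. -/
theorem thetaProd_shift (x y : A) (K : ℕ) :
    thetaProd x y K * ((1 - C y) * (1 - C x * X ^ K)) =
      thetaProd y x K * ((1 - C x) * (1 - C y * X ^ K)) := by
  induction K with
  | zero => simp [thetaProd]; ring
  | succ K ih =>
    simp only [thetaProd, Finset.prod_range_succ] at ih ⊢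
    linear_combination ((1 - C y * X ^ (K + 1)) * (1 - C x * X ^ (K + 1))) * ih

/-- The limit `K → ∞` of `thetaProd_shift`. It is the inversion formula of the theta function
without any division and with `x` and `y` independent. -/
theorem thetaSeries_swap (x y : A) :
    thetaSeries x y * (1 - C y) = thetaSeries y x * (1 - C x) := by
  have aux : ∀ (x y : A) (N : ℕ), coeff N (thetaSeries x y * (1 - C y)) =
      coeff N (thetaProd x y (N + 1) * ((1 - C y) * (1 - C x * X ^ (N + 1)))) := by
    intro x y N
    have : (1 - C x * X ^ (N + 1)) = 1 + X ^ (N + 1) * (-C x) := by ring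
    rw [← mul_assoc, this, coeff_mul_one_add_X_pow _ _ (by omega), mul_sub, mul_sub, mul_one,
      mul_one, map_sub, map_sub, coeff_mul_C, coeff_mul_C, coeff_thetaProd _ _ (by omega)]
  ext N
  rw [aux, aux, thetaProd_shift]

theorem theta_inv {E : Type} [Field E] {x : E} (hx : x ≠ 0) :
    theta x⁻¹ = - C x⁻¹ * theta x := by
  -- At `x = 1` the factor `1 - x` of the swap identity cannot be cancelled; there both sides are
  -- zero.
  by_cases h1 : x = 1
  · subst h1
    ext N
    have h0 : ∀ N, coeff N (theta (1 : E)) = 0 := by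
      intro N
      rw [theta_eq_thetaSeries, ← coeff_thetaProd _ _ (Nat.lt_succ_self N), thetaProd,
        Finset.prod_range_succ']
      simp
    simp [h0]
  · have key := thetaSeries_swap x⁻¹ x
    rw [theta_eq_thetaSeries, theta_eq_thetaSeries, inv_inv]
    have hne : (1 - C x : PowerSeries E) ≠ 0 := fun h => by
      have := congrArg constantCoeff h
      simp at this
      exact h1 (sub_eq_zero.mp this).symm
    apply mul_right_cancel₀ hne
    rw [key]
    have : C x⁻¹ * C x = (1 : PowerSeries E) := by rw [← map_mul, inv_mul_cancel₀ hx, map_one]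
    linear_combination (-thetaSeries x x⁻¹) * this

theorem theta_one {E : Type} [Field E] : theta (1 : E) = 0 := by
  ext N
  rw [theta_eq_thetaSeries, ← coeff_thetaProd _ _ (Nat.lt_succ_self N), thetaProd,
        Finset.prod_range_succ']
  simp

end Theta

/-! ## Quasi-periodic series -/

section QuasiPeriodic

open PowerSeries

variable {L : Type*} [Field L]

/-- The coefficient of `p^N z^k`. -/
def biCoeff (f : PowerSeries (LaurentPolynomial L)) (N k : ℤ) : L :=
  if 0 ≤ N then (coeff N.toNat f).coeff k else 0

theorem biCoeff_of_neg (f : PowerSeries (LaurentPolynomial L)) {N : ℤ} (k : ℤ) (h : N < 0) :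
    biCoeff f N k = 0 := if_neg (by omega)

theorem biCoeff_natCast (f : PowerSeries (LaurentPolynomial L)) (N : ℕ) (k : ℤ) :
    biCoeff f N k = (coeff N f).coeff k := by simp [biCoeff]

theorem biCoeff_sub (f g : PowerSeries (LaurentPolynomial L)) (N k : ℤ) :
    biCoeff (f - g) N k = biCoeff f N k - biCoeff g N k := by
  unfold biCoeff
  split_ifs
  · simp
  · simp

theorem biCoeff_add (f g : PowerSeries (LaurentPolynomial L)) (N k : ℤ) :
    biCoeff (f + g) N k = biCoeff f N k + biCoeff g N k := by
  unfold biCoeff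
  split_ifs
  · simp
  · simp

theorem biCoeff_mul_monomial (f : PowerSeries (LaurentPolynomial L)) (c : L) (e : ℤ) (K : ℕ)
    (N k : ℤ) :
    biCoeff (f * (C (LaurentPolynomial.C c * LaurentPolynomial.T e) * X ^ K)) N k =
      c * biCoeff f (N - K) (k - e) := by
  have hsing : LaurentPolynomial.C c * LaurentPolynomial.T e = AddMonoidAlgebra.single e c :=
    (LaurentPolynomial.single_eq_C_mul_T c e).symm
  have : f * (C (LaurentPolynomial.C c * LaurentPolynomial.T e) * X ^ K) =
      C (LaurentPolynomial.C c * LaurentPolynomial.T e) * (f * X ^ K) := by ring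
  rw [this]
  rcases le_or_gt 0 N with hN | hN
  · lift N to ℕ using hN
    rw [biCoeff_natCast, coeff_C_mul, coeff_mul_X_pow', hsing,
      AddMonoidAlgebra.coeff_single_mul_apply]
    split_ifs with h
    · rw [show (N : ℤ) - K = ((N - K : ℕ) : ℤ) by omega, biCoeff_natCast]
      congr 2
      ring_nf
    · rw [biCoeff_of_neg _ _ (by omega)]
      simp
  · rw [biCoeff_of_neg _ _ hN, biCoeff_of_neg _ _ (by omega), mul_zero]

/-- `f(p z) = c z^{-d} f(z)`. -/
def IsQuasiPeriodic (d : ℤ) (c : L) (f : PowerSeries (LaurentPolynomial L)) : Prop :=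
  -- The substitution `z ↦ pz` turns `p^M z^k` into `p^(M+k) z^k`. Both sides are compared at `p^N
  -- z^k`, with integer exponents since negative powers of `p` may arise on the left.
  ∀ N k : ℤ, biCoeff f (N - k) k = c * biCoeff f N (k + d)

theorem IsQuasiPeriodic.sub {d : ℤ} {c : L} {f g : PowerSeries (LaurentPolynomial L)}
    (hf : IsQuasiPeriodic d c f) (hg : IsQuasiPeriodic d c g) : IsQuasiPeriodic d c (f - g) := by
  intro N k
  rw [biCoeff_sub, biCoeff_sub, hf, hg]
  ring

theorem IsQuasiPeriodic.add {d : ℤ} {c : L} {f g : PowerSeries (LaurentPolynomial L)}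
    (hf : IsQuasiPeriodic d c f) (hg : IsQuasiPeriodic d c g) : IsQuasiPeriodic d c (f + g) := by
  intro N k
  rw [biCoeff_add, biCoeff_add, hf, hg]
  ring

theorem isQuasiPeriodic_zero (d : ℤ) (c : L) : IsQuasiPeriodic d c 0 := by
  intro N k
  simp [biCoeff]

theorem IsQuasiPeriodic.sum {ι : Type*} {s : Finset ι} {d : ℤ} {c : L}
    {f : ι → PowerSeries (LaurentPolynomial L)} (h : ∀ i ∈ s, IsQuasiPeriodic d c (f i)) :
    IsQuasiPeriodic d c (∑ i ∈ s, f i) := by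
  classical
  induction s using Finset.induction_on with
  | empty => exact isQuasiPeriodic_zero d c
  | insert a s ha ih =>
    rw [Finset.sum_insert ha]
    exact (h a (by simp)).add (ih fun i hi => h i (by simp [hi]))

theorem hasFiniteSupport_biCoeff_mul (f g : PowerSeries (LaurentPolynomial L)) (N k : ℤ) :
    (Function.support fun y : ℤ × ℤ => biCoeff f y.1 y.2 * biCoeff g (N - y.1) (k - y.2)).Finite := by
  apply Set.Finite.subset (s := ⋃ M ∈ Set.Icc 0 N, {M} ×ˢ (((coeff M.toNat f).coeff).support : Set ℤ))
  · exact (Set.finite_Icc 0 N).biUnion fun M _ => (Set.finite_singleton M).prod (Finset.finite_toSet _)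
  · rintro ⟨M, x⟩ h
    have h1 : 0 ≤ M := by
      by_contra hM
      exact h (by simp [biCoeff_of_neg f x (not_le.mp hM)])
    have h2 : M ≤ N := by
      by_contra hM
      exact h (by simp [biCoeff_of_neg g (k - x) (show N - M < 0 by omega)])
    simp only [Set.mem_iUnion]
    refine ⟨M, ⟨h1, h2⟩, rfl, ?_⟩
    have h3 : biCoeff f M x ≠ 0 := left_ne_zero_of_mul h
    simpa [biCoeff, h1] using h3

/-- Indexing the convolution by the whole of `ℤ × ℤ` makes the multiplicativity of quasi-periodicity
a mere change of variables in the plane. -/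
theorem biCoeff_mul (f g : PowerSeries (LaurentPolynomial L)) (N k : ℤ) :
    biCoeff (f * g) N k =
      ∑ᶠ y : ℤ × ℤ, biCoeff f y.1 y.2 * biCoeff g (N - y.1) (k - y.2) := by
  rw [finsum_curry _ (hasFiniteSupport_biCoeff_mul f g N k)]
  rcases le_or_gt 0 N with hN | hN
  · lift N to ℕ using hN
    have inner : ∀ F G : LaurentPolynomial L,
        (F * G).coeff k = ∑ᶠ x, F.coeff x * G.coeff (k - x) := by
      intro F G
      rw [AddMonoidAlgebra.coeff_mul, finsum_eq_sum_of_support_subset (s := F.coeff.support)]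
      · refine Finset.sum_congr rfl fun x _ => ?_
        have : ∀ y, (x + y = k) ↔ y = k - x := fun y => by constructor <;> intro h <;> omega
        simp only [this, Finsupp.sum, Finset.sum_ite_eq']
        split_ifs with h
        · rfl
        · rw [Finsupp.notMem_support_iff.mp h, mul_zero]
      · intro x hx
        simpa using left_ne_zero_of_mul hx
    rw [biCoeff_natCast, coeff_mul, AddMonoidAlgebra.coeff_sum, Finsupp.finsetSum_apply]
    rw [finsum_eq_sum_of_support_subset (s := (Finset.HasAntidiagonal.antidiagonal (N : ℕ) : Finset (ℕ × ℕ)).image fun a : ℕ × ℕ => (a.1 : ℤ))]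
    · rw [Finset.sum_image]
      · refine Finset.sum_congr rfl fun a ha => ?_
        rw [inner]
        have : (N : ℤ) - a.1 = (a.2 : ℕ) := by
          have := Finset.HasAntidiagonal.mem_antidiagonal.mp ha
          omega
        simp only [this, biCoeff_natCast]
      · intro a ha b hb hab
        have h1 := Finset.HasAntidiagonal.mem_antidiagonal.mp ha
        have h2 := Finset.HasAntidiagonal.mem_antidiagonal.mp hb
        have h3 : a.1 = b.1 := Nat.cast_injective (R := ℤ) hab
        ext
        · exact h3
        · omega
    · intro M hM
      have h1 : 0 ≤ M := by
        by_contra h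
        apply hM
        simp [biCoeff_of_neg f _ (not_le.mp h)]
      have h2 : M ≤ N := by
        by_contra h
        apply hM
        simp [biCoeff_of_neg g _ (show (N : ℤ) - M < 0 by omega)]
      lift M to ℕ using h1
      simp only [Finset.coe_image, Set.mem_image, Finset.mem_coe, Finset.HasAntidiagonal.mem_antidiagonal]
      exact ⟨(M, N - M), by simp; omega, rfl⟩
  · rw [biCoeff_of_neg _ _ hN]
    symm
    apply finsum_eq_zero_of_forall_eq_zero
    intro M
    apply finsum_eq_zero_of_forall_eq_zero
    intro x
    rcases lt_or_ge M 0 with h | h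
    · simp [biCoeff_of_neg f _ h]
    · simp [biCoeff_of_neg g _ (show N - M < 0 by omega)]

theorem IsQuasiPeriodic.mul {d d' : ℤ} {c c' : L} {f g : PowerSeries (LaurentPolynomial L)}
    (hf : IsQuasiPeriodic d c f) (hg : IsQuasiPeriodic d' c' g) :
    IsQuasiPeriodic (d + d') (c * c') (f * g) := by
  intro N k
  rw [biCoeff_mul, biCoeff_mul, mul_finsum]
  -- Quasi-periodicity of `f` at `(M, x - d)` relates the term `(M - (x - d), x - d)` of the left
  -- convolution to the term `(M, x)` of the right one; `e` is this substitution.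
  let e : ℤ × ℤ ≃ ℤ × ℤ :=
    { toFun := fun y => (y.1 - (y.2 - d), y.2 - d)
      invFun := fun y => (y.1 + y.2, y.2 + d)
      left_inv := fun y => by ext <;> simp
      right_inv := fun y => by ext <;> simp }
  rw [← finsum_comp_equiv e]
  congr 1
  ext y
  have h1 := hf y.1 (y.2 - d)
  have h2 := hg (N - y.1) (k - (y.2 - d))
  simp only [e, Equiv.coe_fn_mk]
  rw [h1, show N - k - (y.1 - (y.2 - d)) = N - y.1 - (k - (y.2 - d)) by ring, h2]
  rw [show y.2 - d + d = y.2 by ring, show k - (y.2 - d) + d' = k + (d + d') - y.2 by ring]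
  ring

theorem isQuasiPeriodic_one : IsQuasiPeriodic 0 (1 : L) 1 := by
  intro N k
  by_cases hk : k = 0
  · simp [hk]
  · have : ∀ M, biCoeff (1 : PowerSeries (LaurentPolynomial L)) M k = 0 := by
      intro M
      rcases lt_or_ge M 0 with h | h
      · exact biCoeff_of_neg _ _ h
      · lift M to ℕ using h
        rw [biCoeff_natCast, coeff_one]
        split_ifs
        · rw [← LaurentPolynomial.T_zero, LaurentPolynomial.T_apply, if_neg (Ne.symm hk)]
        · simp
    simp [this]

theorem isQuasiPeriodic_const (g : PowerSeries L) :
    IsQuasiPeriodic 0 (1 : L) (PowerSeries.map LaurentPolynomial.C g) := by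
  intro N k
  by_cases hk : k = 0
  · simp [hk]
  · have : ∀ M, biCoeff (PowerSeries.map LaurentPolynomial.C g) M k = 0 := by
      intro M
      rcases lt_or_ge M 0 with h | h
      · exact biCoeff_of_neg _ _ h
      · lift M to ℕ using h
        rw [biCoeff_natCast, coeff_map, LaurentPolynomial.C_apply, if_neg hk]
    simp [this]

theorem IsQuasiPeriodic.prod {ι : Type*} {s : Finset ι} {d : ℤ} {c : ι → L}
    {f : ι → PowerSeries (LaurentPolynomial L)} (h : ∀ i ∈ s, IsQuasiPeriodic d (c i) (f i)) :
    IsQuasiPeriodic (s.card * d) (∏ i ∈ s, c i) (∏ i ∈ s, f i) := by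
  classical
  induction s using Finset.induction_on with
  | empty => simpa using isQuasiPeriodic_one
  | insert a s ha ih =>
    rw [Finset.prod_insert ha, Finset.prod_insert ha, Finset.card_insert_of_notMem ha]
    have := (h a (by simp)).mul (ih fun i hi => h i (by simp [hi]))
    convert this using 1
    push_cast
    ring

theorem IsQuasiPeriodic.const_mul {d : ℤ} {c : L} {f : PowerSeries (LaurentPolynomial L)}
    (hf : IsQuasiPeriodic d c f) (g : PowerSeries L) :
    IsQuasiPeriodic d c (PowerSeries.map LaurentPolynomial.C g * f) := by
  simpa using (isQuasiPeriodic_const g).mul hf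

/-- `θ_p(a z)` as a series in `p` whose coefficients are Laurent polynomials in `z`. -/
def thetaLaurent (a : L) : PowerSeries (LaurentPolynomial L) :=
  thetaSeries (LaurentPolynomial.C a * LaurentPolynomial.T 1)
    (LaurentPolynomial.C a⁻¹ * LaurentPolynomial.T (-1))

/-- The coefficient of `p^N z^k` in `P(pz) (1 - p^K / (az)) = -(az)⁻¹ P(z) (1 - p^K az)`, where `P`
is the `K`-th partial product of `θ(az)`. -/
theorem biCoeff_thetaProd_shift {a : L} (ha : a ≠ 0) (K : ℕ) (N k : ℤ) :
    let P := biCoeff (thetaProd (LaurentPolynomial.C a * LaurentPolynomial.T 1)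
      (LaurentPolynomial.C a⁻¹ * LaurentPolynomial.T (-1)) K)
    P (N - k) k - a⁻¹ * P (N - K - (k + 1)) (k + 1) = -a⁻¹ * (P N (k + 1) - a * P (N - K) k) := by
  intro P
  induction K generalizing N k with
  | zero =>
    have hP : ∀ M j : ℤ, P M j = if M = 0 ∧ j = 0 then 1 else 0 := by
      intro M j
      simp only [P, thetaProd, Finset.range_zero, Finset.prod_empty]
      rcases lt_or_ge M 0 with h | h
      · rw [biCoeff_of_neg _ _ h, if_neg (by omega)]
      · lift M to ℕ using h
        rw [biCoeff_natCast, coeff_one]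
        by_cases hM : M = 0
        · simp only [hM, if_true, Nat.cast_zero, true_and]
          rw [← LaurentPolynomial.T_zero, LaurentPolynomial.T_apply]
          simp only [eq_comm]
        · simp [hM]
    simp only [hP]
    by_cases h1 : N = 0 <;> by_cases h2 : k = 0 <;> by_cases h3 : k = -1 <;>
      simp_all <;> try omega
    all_goals grind
  | succ K ih =>
    have step : ∀ M j : ℤ, P M j =
        let Q := biCoeff (thetaProd (LaurentPolynomial.C a * LaurentPolynomial.T 1)
          (LaurentPolynomial.C a⁻¹ * LaurentPolynomial.T (-1)) K)
        Q M j - a * Q (M - K) (j - 1) - a⁻¹ * Q (M - (K + 1)) (j + 1)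
          + Q (M - (K + 1) - K) j := by
      intro M j
      generalize hQ : biCoeff (thetaProd (LaurentPolynomial.C a * LaurentPolynomial.T 1)
          (LaurentPolynomial.C a⁻¹ * LaurentPolynomial.T (-1)) K) = Q
      have h1 : ∀ (f : PowerSeries (LaurentPolynomial L)) (x : LaurentPolynomial L) (J : ℕ),
        f * (1 - C x * X ^ J) = f - f * (C x * X ^ J) := fun f x J => by ring
      simp only [P]
      rw [thetaProd, Finset.prod_range_succ, ← mul_assoc, h1, h1]
      simp only [biCoeff_sub, biCoeff_mul_monomial]
      rw [thetaProd] at hQ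
      rw [hQ]
      push_cast
      rw [show M - (K + 1) - K = M - ((K:ℤ) + 1) - K by ring,
        show j - -1 - 1 = j by ring, show j - -1 = j + 1 by ring]
      field_simp
      ring
    simp only [step]
    generalize hQ : biCoeff (thetaProd (LaurentPolynomial.C a * LaurentPolynomial.T 1)
          (LaurentPolynomial.C a⁻¹ * LaurentPolynomial.T (-1)) K) = Q at ih
    -- Passing from `K` to `K + 1` multiplies both sides by `(1 - p^(K+1) az) (1 - p^(K+1) / (az))`.
    -- The four shifted instances of the induction hypothesis belong to the four monomials of this
    -- factor.
    have i1 := ih N k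
    have i2 := ih (N - (K + 1)) (k - 1)
    have i3 := ih (N - (K + 1)) (k + 1)
    have i4 := ih (N - (K + 1) - (K + 1)) k
    simp only at i1 i2 i3 i4 ⊢
    push_cast
    ring_nf at i1 i2 i3 i4 ⊢
    linear_combination i1 - a * i2 - a⁻¹ * i3 + i4 + (mul_inv_cancel₀ ha) *
      (Q (-2 + N - k - K * 2) k - Q (-1 + N - k - K * 2) k +
        a⁻¹ * (Q (-2 + N - K * 2) (1 + k) - Q (-1 + N - K * 2) (1 + k)))

theorem isQuasiPeriodic_thetaLaurent {a : L} (ha : a ≠ 0) :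
    IsQuasiPeriodic 1 (-a⁻¹) (thetaLaurent a) := by
  intro N k
  -- Large enough for both correction terms carrying `p^K` to fall into negative powers of `p`, and
  -- for the two other coefficients of the partial product to be those of the limit.
  set K : ℕ := (N.natAbs + k.natAbs + 2) with hK
  have key := biCoeff_thetaProd_shift ha K N k
  have stable : ∀ M j : ℤ, M < K → biCoeff (thetaProd
      (LaurentPolynomial.C a * LaurentPolynomial.T 1)
      (LaurentPolynomial.C a⁻¹ * LaurentPolynomial.T (-1)) K) M j =
        biCoeff (thetaLaurent a) M j := by
    intro M j hM
    unfold biCoeff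
    split_ifs
    · rw [coeff_thetaProd _ _ (by omega)]
      rfl
    · rfl
  simp only at key
  rw [biCoeff_of_neg _ _ (show N - K - (k + 1) < 0 by omega),
    biCoeff_of_neg _ _ (show N - K < 0 by omega), stable _ _ (by omega),
    stable _ _ (by omega)] at key
  linear_combination key

/-- Evaluation at `z = b`. -/
def laurentEval (b : Lˣ) : PowerSeries (LaurentPolynomial L) →+* PowerSeries L :=
  PowerSeries.map (LaurentPolynomial.eval₂ (RingHom.id L) b)

theorem laurentEval_const (b : Lˣ) (g : PowerSeries L) :
    laurentEval b (PowerSeries.map LaurentPolynomial.C g) = g := by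
  ext N
  simp [laurentEval]

theorem laurentEval_thetaLaurent {E : Type} [Field E] (a : E) (b : Eˣ) :
    laurentEval b (thetaLaurent a) = theta (a * b) := by
  rw [laurentEval, thetaLaurent, map_thetaSeries, theta_eq_thetaSeries,
    LaurentPolynomial.eval₂_C_mul_T, LaurentPolynomial.eval₂_C_mul_T]
  simp [mul_comm]

/-- A quasi-periodic series of degree `d` with more than `d` zeros vanishes. -/
theorem IsQuasiPeriodic.eq_zero {d : ℕ} {c : L} (hc : c ≠ 0)
    {f : PowerSeries (LaurentPolynomial L)} (hf : IsQuasiPeriodic d c f) (s : Finset Lˣ)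
    (hs : d < s.card) (hz : ∀ b ∈ s, laurentEval b f = 0) : f = 0 := by
  have main : ∀ N : ℕ, coeff N f = 0 := by
    intro N
    induction N using Nat.strong_induction_on with
    | _ N ih =>
      have low : ∀ (M : ℤ) (j : ℤ), M < N → biCoeff f M j = 0 := by
        intro M j hM
        rcases lt_or_ge M 0 with h | h
        · exact biCoeff_of_neg _ _ h
        · lift M to ℕ using h
          rw [biCoeff_natCast, ih M (by omega)]
          simp
      -- Quasi-periodicity relates a coefficient with `k < 0` or `k > d` to one at a smaller power
      -- of `p`, which is zero by induction. The coefficient of `p^N` is thus a polynomial of degree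
      -- at most `d` in `z`, with more than `d` roots.
      have hneg : ∀ k : ℤ, k < 0 → (coeff N f).coeff k = 0 := by
        intro k hk
        rw [← biCoeff_natCast]
        have := hf (N + k) k
        rw [show (N : ℤ) + k - k = N by ring, low (N + k) _ (by omega), mul_zero] at this
        exact this
      have hpos : ∀ k : ℤ, d < k → (coeff N f).coeff k = 0 := by
        intro k hk
        rw [← biCoeff_natCast]
        have := hf N (k - d)
        rw [low _ _ (by omega), show k - d + d = k by ring] at this
        exact (mul_eq_zero.mp this.symm).resolve_left hc
      set P : Polynomial L := ∑ j ∈ Finset.range (d + 1),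
        Polynomial.monomial j ((coeff N f).coeff (j : ℤ)) with hP
      have hPc : ∀ j : ℕ, P.coeff j = (coeff N f).coeff (j : ℤ) := by
        intro j
        simp only [hP, Polynomial.finsetSum_coeff, Polynomial.coeff_monomial,
          Finset.sum_ite_eq', Finset.mem_range]
        split_ifs with h
        · rfl
        · exact (hpos _ (by omega)).symm
      have hPf : P.toLaurent = coeff N f := by
        apply LaurentPolynomial.ext
        intro k
        rcases lt_or_ge k 0 with h | h
        · rw [hneg k h, ← Finsupp.notMem_support_iff, LaurentPolynomial.support_coeff_toLaurent]
          simp only [Finset.mem_map, not_exists, not_and]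
          intro x _ hx
          have : (x : ℤ) = k := hx
          omega
        · lift k to ℕ using h
          rw [← hPc, LaurentPolynomial.coeff_toLaurent]
          exact Finsupp.mapDomain_apply Nat.cast_injective _ _
      have hP0 : P = 0 := by
        apply Polynomial.eq_zero_of_natDegree_lt_card_of_eval_eq_zero' P
          (s.map ⟨fun u : Lˣ => (u : L), Units.val_injective⟩)
        · intro x hx
          obtain ⟨b, hb, rfl⟩ := Finset.mem_map.mp hx
          have := congrArg (coeff N) (hz b hb)
          rw [laurentEval, coeff_map, ← hPf, LaurentPolynomial.eval₂_toLaurent, map_zero] at this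
          simpa [Polynomial.eval₂_id] using this
        · rw [Finset.card_map]
          refine lt_of_le_of_lt ?_ hs
          rw [Polynomial.natDegree_le_iff_coeff_eq_zero]
          intro j hj
          rw [hPc]
          exact hpos _ (by omega)
      rw [← hPf, hP0, map_zero]
  ext N : 1
  rw [main N, map_zero]

end QuasiPeriodic

/-! ## Ruijsenaars' identity -/

section Ruijsenaars

open PowerSeries

variable {E : Type} [Field E]

/-- The theta function at a unit. -/
def thetaU (w : Eˣ) : PowerSeries E := theta (w : E)

theorem thetaU_inv (w : Eˣ) : thetaU w⁻¹ = -C (w⁻¹ : E) * thetaU w := by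
  rw [thetaU, Units.val_inv_eq_inv_val, theta_inv w.ne_zero, thetaU]

theorem thetaU_one : thetaU (1 : Eˣ) = 0 := by simp [thetaU, theta_one]

theorem thetaU_ne_zero {w : Eˣ} (h : w ≠ 1) : thetaU w ≠ 0 :=
  theta_ne_zero fun h' => h (Units.ext h')

theorem inv_mul_thetaU {w : Eˣ} (h : w ≠ 1) : (thetaU w)⁻¹ * thetaU w = 1 := by
  apply PowerSeries.inv_mul_cancel
  rw [thetaU, constantCoeff_theta]
  exact fun h' => h (Units.ext (sub_eq_zero.mp h').symm)

/-- `θ_p(q₁⁻¹ w) θ_p(q₂⁻¹ w) / (θ_p(w) θ_p(q₃ w))`. -/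
def kernel (q : Fin 3 → Eˣ) (w : Eˣ) : PowerSeries E :=
  thetaU ((q 0)⁻¹ * w) * thetaU ((q 1)⁻¹ * w) * (thetaU w)⁻¹ * (thetaU (q 2 * w))⁻¹

/-- `θ_p(w) θ_p(q₃ w) θ_p(q₃⁻¹ w)`. -/
def thetaDen (q : Fin 3 → Eˣ) (w : Eˣ) : PowerSeries E :=
  thetaU w * thetaU (q 2 * w) * thetaU ((q 2)⁻¹ * w)

/-- `θ_p(q₁⁻¹ w) θ_p(q₂⁻¹ w) θ_p(q₃⁻¹ w)`. -/
def thetaNeg (q : Fin 3 → Eˣ) (w : Eˣ) : PowerSeries E :=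
  thetaU ((q 0)⁻¹ * w) * thetaU ((q 1)⁻¹ * w) * thetaU ((q 2)⁻¹ * w)

/-- `θ_p(q₁ w) θ_p(q₂ w) θ_p(q₃ w)`. -/
def thetaPos (q : Fin 3 → Eˣ) (w : Eˣ) : PowerSeries E :=
  thetaU (q 0 * w) * thetaU (q 1 * w) * thetaU (q 2 * w)

variable {q : Fin 3 → Eˣ}

/-- Up to units, `thetaDen` is the least common denominator of `F(w)` and `F(w⁻¹)`: the two share
`θ(w)`, and contribute `θ(q₃w)` and `θ(q₃⁻¹w)` respectively. -/
theorem kernel_mul_thetaDen {w : Eˣ} (h1 : w ≠ 1) (h2 : q 2 * w ≠ 1) :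
    kernel q w * thetaDen q w = thetaNeg q w := by
  have e1 := inv_mul_thetaU h1
  have e2 := inv_mul_thetaU h2
  calc kernel q w * thetaDen q w = thetaNeg q w * ((thetaU w)⁻¹ * thetaU w) *
        ((thetaU (q 2 * w))⁻¹ * thetaU (q 2 * w)) := by
        unfold kernel thetaDen thetaNeg; ring
    _ = _ := by rw [e1, e2, mul_one, mul_one]

theorem thetaDen_inv (w : Eˣ) :
    thetaDen q w⁻¹ = -C ((w⁻¹ : E) ^ 3) * thetaDen q w := by
  have h1 : q 2 * w⁻¹ = ((q 2)⁻¹ * w)⁻¹ := by rw [mul_inv, inv_inv]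
  have h2 : (q 2)⁻¹ * w⁻¹ = (q 2 * w)⁻¹ := by rw [mul_inv]
  rw [thetaDen, h1, h2, thetaU_inv, thetaU_inv, thetaU_inv, thetaDen]
  have : C (w⁻¹ : E) * C ((((q 2)⁻¹ * w : Eˣ) : E)⁻¹) * C (((q 2 * w : Eˣ) : E)⁻¹) =
      C ((w⁻¹ : E) ^ 3) := by
    rw [← map_mul, ← map_mul]
    congr 1
    push_cast
    field_simp
  linear_combination (-(thetaU w * thetaU (q 2 * w) * thetaU ((q 2)⁻¹ * w))) * this

theorem thetaNeg_inv (hq : q 0 * q 1 * q 2 = 1) (w : Eˣ) :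
    thetaNeg q w⁻¹ = -C ((w⁻¹ : E) ^ 3) * thetaPos q w := by
  rw [thetaNeg, ← mul_inv, ← mul_inv, ← mul_inv, thetaU_inv, thetaU_inv, thetaU_inv, thetaPos]
  have : C ((((q 0) * w : Eˣ) : E)⁻¹) * C ((((q 1) * w : Eˣ) : E)⁻¹) * C (((q 2 * w : Eˣ) : E)⁻¹) =
      C ((w⁻¹ : E) ^ 3) := by
    rw [← map_mul, ← map_mul]
    congr 1
    have hq' : (q 0 : E) * q 1 * q 2 = 1 := by
      rw [← Units.val_mul, ← Units.val_mul, hq, Units.val_one]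
    push_cast
    have h0 := (q 0).ne_zero
    have h1 := (q 1).ne_zero
    have h2 := (q 2).ne_zero
    have hw := w.ne_zero
    field_simp
    linear_combination -hq'
  linear_combination (-(thetaU (q 0 * w) * thetaU (q 1 * w) * thetaU (q 2 * w))) * this

theorem kernel_inv_mul_thetaDen (hq : q 0 * q 1 * q 2 = 1) {w : Eˣ} (h1 : w ≠ 1) (h2 : w ≠ q 2) :
    kernel q w⁻¹ * thetaDen q w = thetaPos q w := by
  have key := kernel_mul_thetaDen (q := q) (w := w⁻¹) (by simpa using h1)
    (by rw [Ne, mul_inv_eq_one]; exact h2.symm)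
  rw [thetaDen_inv, thetaNeg_inv hq] at key
  have hne : -C ((w⁻¹ : E) ^ 3) ≠ 0 := by simp
  apply mul_left_cancel₀ hne
  linear_combination key

/-- Because `q₁q₂q₃ = 1`, shifting `w` by `q₃⁻¹` turns the numerator factors `θ(q₁⁻¹w) θ(q₂⁻¹w)` of
`F(w)` into those of `F(w⁻¹)`. So `F(w⁻¹)` is also a quotient of thetas at the shifted point. This
makes the values of the numerator at `q₃⁻¹ x_t` factor. -/
theorem kernel_inv_mul_thetaDen_shift (hq : q 0 * q 1 * q 2 = 1) {w : Eˣ} (h1 : w ≠ 1)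
    (h2 : w ≠ q 2) (h3 : q 2 * w ≠ 1) :
    kernel q w⁻¹ * thetaDen q ((q 2)⁻¹ * w) = thetaNeg q ((q 2)⁻¹ * w) := by
  have key := kernel_inv_mul_thetaDen hq h1 h2
  have e0 : (q 0)⁻¹ * ((q 2)⁻¹ * w) = q 1 * w := by
    rw [← mul_assoc, ← mul_inv, inv_mul_eq_iff_eq_mul, ← mul_assoc,
      mul_right_comm (q 0) (q 2) (q 1), hq, one_mul]
  have e1 : (q 1)⁻¹ * ((q 2)⁻¹ * w) = q 0 * w := by
    rw [← mul_assoc, ← mul_inv, inv_mul_eq_iff_eq_mul, ← mul_assoc,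
      ← mul_rotate (q 0) (q 1) (q 2), hq, one_mul]
  have e2 : q 2 * ((q 2)⁻¹ * w) = w := mul_inv_cancel_left _ _
  rw [thetaDen, thetaNeg, e0, e1, e2]
  rw [thetaDen, thetaPos] at key
  have := thetaU_ne_zero h3
  apply mul_right_cancel₀ this
  linear_combination (thetaU ((q 2)⁻¹ * ((q 2)⁻¹ * w))) * key

theorem kernel_mul_thetaDen_shift (hq : q 0 * q 1 * q 2 = 1) {w : Eˣ} (h1 : w ≠ 1)
    (h2 : q 2 * w ≠ 1) (h3 : w ≠ q 2) :
    kernel q w * thetaDen q (q 2 * w) = thetaPos q (q 2 * w) := by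
  have key := kernel_mul_thetaDen h1 h2
  have e0 : q 0 * (q 2 * w) = (q 1)⁻¹ * w := by
    rw [eq_inv_mul_iff_mul_eq, ← mul_assoc, ← mul_assoc,
      mul_comm (q 1), hq, one_mul]
  have e1 : q 1 * (q 2 * w) = (q 0)⁻¹ * w := by
    rw [eq_inv_mul_iff_mul_eq, ← mul_assoc, ← mul_assoc, hq, one_mul]
  have e2 : (q 2)⁻¹ * (q 2 * w) = w := inv_mul_cancel_left _ _
  rw [thetaDen, thetaPos, e0, e1, e2]
  rw [thetaDen, thetaNeg] at key
  have : thetaU ((q 2)⁻¹ * w) ≠ 0 := thetaU_ne_zero (by rw [Ne, inv_mul_eq_one]; exact h3.symm)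
  apply mul_right_cancel₀ this
  linear_combination (thetaU (q 2 * (q 2 * w))) * key

/-- The sign by which the residues at coinciding points cancel. -/
theorem thetaPos_one_add_thetaNeg_one (hq : q 0 * q 1 * q 2 = 1) :
    thetaPos q 1 + thetaNeg q 1 = 0 := by
  have := thetaNeg_inv hq 1
  rw [inv_one] at this
  rw [this]
  simp

/-! ### Sums over decompositions of a finite set of points: poles, zeros and the inversion symmetry
-/

variable {ι : Type}

/-- The points `x_i`, `i ∈ S`, are in general position. -/
def InGeneralPosition (q : Fin 3 → Eˣ) (S : Finset ι) (x : ι → Eˣ) : Prop :=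
  ∀ i ∈ S, ∀ j ∈ S, i ≠ j → x i ≠ x j ∧ x i ≠ q 2 * x j ∧ x i ≠ q 2 ^ 2 * x j

theorem InGeneralPosition.mono {S T : Finset ι} {x : ι → Eˣ} (h : InGeneralPosition q S x)
    (hT : T ⊆ S) : InGeneralPosition q T x :=
  fun i hi j hj => h i (hT hi) j (hT hj)

theorem InGeneralPosition.div_ne {S : Finset ι} {x : ι → Eˣ} (h : InGeneralPosition q S x)
    {i j : ι} (hi : i ∈ S) (hj : j ∈ S) (hij : i ≠ j) :
    x i / x j ≠ 1 ∧ x i / x j ≠ q 2 ∧ q 2 * (x i / x j) ≠ 1 := by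
  refine ⟨fun h' => (h i hi j hj hij).1 (div_eq_one.mp h'),
    fun h' => (h i hi j hj hij).2.1 (div_eq_iff_eq_mul.mp h'),
    fun h' => (h j hj i hi hij.symm).2.1 ?_⟩
  rw [← mul_div_assoc, div_eq_one] at h'
  exact h'.symm

variable [DecidableEq ι]

/-- The sum over all decompositions `S = I ⊔ J` of `u^{|I|} v^{|J|} ∏_{i ∈ I, j ∈ J} F(x_j / x_i)`. -/
def decompSum (q : Fin 3 → Eˣ) (S : Finset ι) (x : ι → Eˣ) (u v : PowerSeries E) : PowerSeries E :=
  ∑ I ∈ S.powerset, u ^ I.card * v ^ (S \ I).card * ∏ i ∈ I, ∏ j ∈ S \ I, kernel q (x j / x i)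

/-- The numerator of `decompSum` as a function of one more variable `z`. -/
def decompNum (q : Fin 3 → Eˣ) (S : Finset ι) (x : ι → Eˣ) (u v : PowerSeries E) (z : Eˣ) :
    PowerSeries E :=
  ∑ I ∈ S.powerset, (u ^ I.card * v ^ (S \ I).card * ∏ i ∈ I, ∏ j ∈ S \ I, kernel q (x j / x i)) *
    (v * ((∏ i ∈ I, thetaNeg q (z / x i)) * ∏ j ∈ S \ I, thetaDen q (z / x j)) +
      u * ((∏ i ∈ I, thetaDen q (z / x i)) * ∏ j ∈ S \ I, thetaPos q (z / x j)))

theorem insert_sdiff_of_subset {s : ι} {S I : Finset ι} (hs : s ∉ S) (hI : I ⊆ S) :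
    insert s S \ I = insert s (S \ I) :=
  Finset.insert_sdiff_of_notMem _ fun h => hs (hI h)

theorem insert_sdiff_insert_of_notMem {s : ι} {S I : Finset ι} (hs : s ∉ S) :
    insert s S \ insert s I = S \ I := by
  rw [Finset.insert_sdiff_insert]
  ext a
  simp only [Finset.mem_sdiff, Finset.mem_insert]
  constructor
  · rintro ⟨h1, h2⟩
    exact ⟨h1, fun h => h2 (Or.inr h)⟩
  · rintro ⟨h1, h2⟩
    refine ⟨h1, ?_⟩
    rintro (rfl | h)
    · exact hs h1
    · exact h2 h

/-- The decompositions of `S ∪ {s}` are sorted by the side that receives `s`, which isolates the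
dependence on `x_s`. -/
theorem decompSum_insert {s : ι} {S : Finset ι} (hs : s ∉ S) (x : ι → Eˣ) (u v : PowerSeries E) :
    decompSum q (insert s S) x u v = ∑ I ∈ S.powerset,
      (u ^ I.card * v ^ (S \ I).card * ∏ i ∈ I, ∏ j ∈ S \ I, kernel q (x j / x i)) *
        (v * ∏ i ∈ I, kernel q (x s / x i) + u * ∏ j ∈ S \ I, kernel q (x j / x s)) := by
  rw [decompSum, Finset.sum_powerset_insert hs, ← Finset.sum_add_distrib]
  refine Finset.sum_congr rfl fun I hI => ?_
  have hI' := Finset.mem_powerset.mp hI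
  have hsI : s ∉ I := fun h => hs (hI' h)
  have hsJ : s ∉ S \ I := fun h => hs (Finset.mem_sdiff.mp h).1
  rw [insert_sdiff_of_subset hs hI', insert_sdiff_insert_of_notMem hs,
    Finset.card_insert_of_notMem hsI, Finset.card_insert_of_notMem hsJ, Finset.prod_insert hsI]
  simp only [Finset.prod_insert hsJ, Finset.prod_mul_distrib]
  ring

/-- At a zero of the denominator belonging to `x_t`, one half of every summand dies. The other half
always contains `uv`, since `t` and the new point lie on opposite sides. -/
theorem decompNum_insert {t : ι} {S : Finset ι} (ht : t ∉ S) (x : ι → Eˣ) (u v : PowerSeries E)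
    {z : Eˣ} (hz : thetaDen q (z / x t) = 0) :
    decompNum q (insert t S) x u v z = u * v * ∑ I ∈ S.powerset,
      (u ^ I.card * v ^ (S \ I).card * ∏ i ∈ I, ∏ j ∈ S \ I, kernel q (x j / x i)) *
        (thetaPos q (z / x t) * ((∏ i ∈ I, kernel q (x t / x i) * thetaDen q (z / x i)) *
            ∏ j ∈ S \ I, thetaPos q (z / x j)) +
          thetaNeg q (z / x t) * ((∏ i ∈ I, thetaNeg q (z / x i)) *
            ∏ j ∈ S \ I, kernel q (x t / x j)⁻¹ * thetaDen q (z / x j))) := by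
  rw [decompNum, Finset.sum_powerset_insert ht, ← Finset.sum_add_distrib, Finset.mul_sum]
  refine Finset.sum_congr rfl fun I hI => ?_
  have hI' := Finset.mem_powerset.mp hI
  have hsI : t ∉ I := fun h => ht (hI' h)
  have hsJ : t ∉ S \ I := fun h => ht (Finset.mem_sdiff.mp h).1
  rw [insert_sdiff_of_subset ht hI', insert_sdiff_insert_of_notMem ht,
    Finset.card_insert_of_notMem hsI, Finset.card_insert_of_notMem hsJ]
  simp only [Finset.prod_insert hsJ, Finset.prod_insert hsI, Finset.prod_mul_distrib, hz,
    inv_div]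
  ring

theorem decompSum_mul_prod_thetaDen (hq : q 0 * q 1 * q 2 = 1) {s : ι} {S : Finset ι} (hs : s ∉ S)
    {x : ι → Eˣ} (hx : InGeneralPosition q (insert s S) x) (u v : PowerSeries E) :
    decompSum q (insert s S) x u v * ∏ i ∈ S, thetaDen q (x s / x i) =
      decompNum q S x u v (x s) := by
  rw [decompSum_insert hs, decompNum, Finset.sum_mul]
  refine Finset.sum_congr rfl fun I hI => ?_
  have hI' := Finset.mem_powerset.mp hI
  have hne : ∀ i ∈ S, s ≠ i := fun i hi h => hs (h ▸ hi)
  have e1 : ∏ i ∈ I, thetaNeg q (x s / x i) =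
      (∏ i ∈ I, kernel q (x s / x i)) * ∏ i ∈ I, thetaDen q (x s / x i) := by
    rw [← Finset.prod_mul_distrib]
    refine Finset.prod_congr rfl fun i hi => ?_
    obtain ⟨h1, h2, h3⟩ := hx.div_ne (Finset.mem_insert_self s S)
      (Finset.mem_insert_of_mem (hI' hi)) (hne i (hI' hi))
    rw [kernel_mul_thetaDen h1 h3]
  have e2 : ∏ j ∈ S \ I, thetaPos q (x s / x j) =
      (∏ j ∈ S \ I, kernel q (x j / x s)) * ∏ j ∈ S \ I, thetaDen q (x s / x j) := by
    rw [← Finset.prod_mul_distrib]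
    refine Finset.prod_congr rfl fun j hj => ?_
    have hj' := (Finset.mem_sdiff.mp hj).1
    obtain ⟨h1, h2, h3⟩ := hx.div_ne (Finset.mem_insert_self s S)
      (Finset.mem_insert_of_mem hj') (hne j hj')
    rw [← inv_div (x s) (x j), kernel_inv_mul_thetaDen hq h1 h2]
  rw [e1, e2, ← Finset.prod_sdiff hI']
  ring

/-- At `z = x_t` the two surviving terms of a summand (`t` on one side or on the other) agree except
for the factors `thetaPos q 1` and `thetaNeg q 1`, whose sum is zero. The poles at coinciding points
thus cancel for all `u`, `v`, before antisymmetrization. -/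
theorem decompNum_eq_zero (hq : q 0 * q 1 * q 2 = 1) {S : Finset ι} {x : ι → Eˣ}
    (hx : InGeneralPosition q S x) (u v : PowerSeries E) {t : ι} (ht : t ∈ S) :
    decompNum q S x u v (x t) = 0 := by
  obtain ⟨S, ht', rfl⟩ : ∃ S', t ∉ S' ∧ insert t S' = S :=
    ⟨S.erase t, Finset.notMem_erase _ _, Finset.insert_erase ht⟩
  rw [decompNum_insert ht']
  · rw [Finset.sum_eq_zero, mul_zero]
    intro I hI
    have hI' := Finset.mem_powerset.mp hI
    have hne : ∀ i ∈ S, t ≠ i := fun i hi h => ht' (h ▸ hi)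
    have e1 : ∏ i ∈ I, kernel q (x t / x i) * thetaDen q (x t / x i) =
        ∏ i ∈ I, thetaNeg q (x t / x i) := Finset.prod_congr rfl fun i hi => by
      obtain ⟨h1, h2, h3⟩ := hx.div_ne ht (Finset.mem_insert_of_mem (hI' hi)) (hne i (hI' hi))
      rw [kernel_mul_thetaDen h1 h3]
    have e2 : ∏ j ∈ S \ I, kernel q (x t / x j)⁻¹ * thetaDen q (x t / x j) =
        ∏ j ∈ S \ I, thetaPos q (x t / x j) := Finset.prod_congr rfl fun j hj => by
      have hj' := (Finset.mem_sdiff.mp hj).1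
      obtain ⟨h1, h2, h3⟩ := hx.div_ne ht (Finset.mem_insert_of_mem hj') (hne j hj')
      rw [kernel_inv_mul_thetaDen hq h1 h2]
    rw [e1, e2, div_self', ← add_mul, thetaPos_one_add_thetaNeg_one hq, zero_mul, mul_zero]
  · rw [div_self', thetaDen, thetaU_one, zero_mul, zero_mul]

/-- At `z = q₃⁻¹ x_t` the factor `thetaPos` vanishes, and the remaining theta functions combine into
a product over all of `S` that does not see the decomposition. The residue is a multiple, symmetric
in `u` and `v`, of the sum for the smaller set `S`; this is what the induction feeds on. -/
theorem decompNum_shift_inv (hq : q 0 * q 1 * q 2 = 1) {t : ι} {S : Finset ι} (ht' : t ∉ S)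
    {x : ι → Eˣ} (hx : InGeneralPosition q (insert t S) x) (u v : PowerSeries E) :
    decompNum q (insert t S) x u v ((q 2)⁻¹ * x t) = u * v * thetaNeg q (q 2)⁻¹ *
      (∏ i ∈ S, thetaNeg q ((q 2)⁻¹ * x t / x i)) * decompSum q S x u v := by
  have hz : (q 2)⁻¹ * x t / x t = (q 2)⁻¹ := by rw [mul_div_assoc, div_self', mul_one]
  rw [decompNum_insert ht', decompSum, hz, Finset.mul_sum, Finset.mul_sum]
  · refine Finset.sum_congr rfl fun I hI => ?_
    have hI' := Finset.mem_powerset.mp hI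
    have hne : ∀ i ∈ S, t ≠ i := fun i hi h => ht' (h ▸ hi)
    have e1 : thetaPos q (q 2)⁻¹ = 0 := by
      rw [thetaPos, mul_inv_cancel (q 2), thetaU_one, mul_zero]
    have e2 : ∏ j ∈ S \ I, kernel q (x t / x j)⁻¹ * thetaDen q ((q 2)⁻¹ * x t / x j) =
        ∏ j ∈ S \ I, thetaNeg q ((q 2)⁻¹ * x t / x j) := Finset.prod_congr rfl fun j hj => by
      have hj' := (Finset.mem_sdiff.mp hj).1
      obtain ⟨h1, h2, h3⟩ := hx.div_ne (Finset.mem_insert_self t S)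
        (Finset.mem_insert_of_mem hj') (hne j hj')
      rw [mul_div_assoc, kernel_inv_mul_thetaDen_shift hq h1 h2 h3]
    rw [e1, e2, ← Finset.prod_sdiff hI']
    ring
  · rw [hz, thetaDen, mul_inv_cancel (q 2), thetaU_one, mul_zero, zero_mul]

/-- The mirror image of `decompNum_shift_inv`: here `thetaNeg` vanishes and `thetaPos` supplies the
common product. -/
theorem decompNum_shift (hq : q 0 * q 1 * q 2 = 1) {t : ι} {S : Finset ι} (ht' : t ∉ S)
    {x : ι → Eˣ} (hx : InGeneralPosition q (insert t S) x) (u v : PowerSeries E) :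
    decompNum q (insert t S) x u v (q 2 * x t) = u * v * thetaPos q (q 2) *
      (∏ i ∈ S, thetaPos q (q 2 * x t / x i)) * decompSum q S x u v := by
  have hz : q 2 * x t / x t = q 2 := by rw [mul_div_assoc, div_self', mul_one]
  rw [decompNum_insert ht', decompSum, hz, Finset.mul_sum, Finset.mul_sum]
  · refine Finset.sum_congr rfl fun I hI => ?_
    have hI' := Finset.mem_powerset.mp hI
    have hne : ∀ i ∈ S, t ≠ i := fun i hi h => ht' (h ▸ hi)
    have e1 : thetaNeg q (q 2) = 0 := by
      rw [thetaNeg, inv_mul_cancel (q 2), thetaU_one, mul_zero]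
    have e2 : ∏ i ∈ I, kernel q (x t / x i) * thetaDen q (q 2 * x t / x i) =
        ∏ i ∈ I, thetaPos q (q 2 * x t / x i) := Finset.prod_congr rfl fun i hi => by
      obtain ⟨h1, h2, h3⟩ := hx.div_ne (Finset.mem_insert_self t S)
        (Finset.mem_insert_of_mem (hI' hi)) (hne i (hI' hi))
      rw [mul_div_assoc, kernel_mul_thetaDen_shift hq h1 h3 h2]
    rw [e1, e2, ← Finset.prod_sdiff hI']
    ring
  · rw [hz, thetaDen, inv_mul_cancel (q 2), thetaU_one, mul_zero]

/-- `θ_p(w z)` as a series in `p` with coefficients Laurent polynomials in `z`. -/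
def thetaL (w : Eˣ) : PowerSeries (LaurentPolynomial E) := thetaLaurent (w : E)

theorem laurentEval_thetaL (w b : Eˣ) : laurentEval b (thetaL w) = thetaU (w * b) := by
  rw [thetaL, laurentEval_thetaLaurent, thetaU, Units.val_mul]

theorem isQuasiPeriodic_thetaL (w : Eˣ) : IsQuasiPeriodic 1 (-(w⁻¹ : E)) (thetaL w) :=
  isQuasiPeriodic_thetaLaurent w.ne_zero

/-- The product of `θ_p(a w z)`, `θ_p(b w z)`, `θ_p(c w z)`. -/
def thetaTriple (a b c w : Eˣ) : PowerSeries (LaurentPolynomial E) :=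
  thetaL (a * w) * thetaL (b * w) * thetaL (c * w)

/-- Since `abc = 1`, the multiplier depends on `w` alone. Hence `thetaDen`, `thetaNeg` and
`thetaPos` all transform in the same way under `z ↦ pz`; this is the role of `q₁q₂q₃ = 1`. -/
theorem isQuasiPeriodic_thetaTriple {a b c : Eˣ} (h : a * b * c = 1) (w : Eˣ) :
    IsQuasiPeriodic 3 (-(w⁻¹ : E) ^ 3) (thetaTriple a b c w) := by
  have key := ((isQuasiPeriodic_thetaL (a * w)).mul (isQuasiPeriodic_thetaL (b * w))).mul
    (isQuasiPeriodic_thetaL (c * w))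
  have h' : (a : E) * b * c = 1 := by
    rw [← Units.val_mul, ← Units.val_mul, h, Units.val_one]
  have e : (-(w⁻¹ : E) ^ 3) = -((a * w : Eˣ) : E)⁻¹ * -((b * w : Eˣ) : E)⁻¹ *
      -((c * w : Eˣ) : E)⁻¹ := by
    push_cast
    have h0 := a.ne_zero
    have h1 := b.ne_zero
    have h2 := c.ne_zero
    have hw := w.ne_zero
    field_simp
    linear_combination -h'
  rw [e]
  exact key

/-- The numerator of `decompSum` as a series with coefficients Laurent polynomials in `z`. -/
def decompNumL (q : Fin 3 → Eˣ) (S : Finset ι) (x : ι → Eˣ) (u v : PowerSeries E) :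
    PowerSeries (LaurentPolynomial E) :=
  ∑ I ∈ S.powerset,
    (PowerSeries.map LaurentPolynomial.C ((u ^ I.card * v ^ (S \ I).card *
        ∏ i ∈ I, ∏ j ∈ S \ I, kernel q (x j / x i)) * v) *
      ((∏ i ∈ I, thetaTriple (q 0)⁻¹ (q 1)⁻¹ (q 2)⁻¹ (x i)⁻¹) *
        ∏ j ∈ S \ I, thetaTriple 1 (q 2) (q 2)⁻¹ (x j)⁻¹) +
    PowerSeries.map LaurentPolynomial.C ((u ^ I.card * v ^ (S \ I).card *
        ∏ i ∈ I, ∏ j ∈ S \ I, kernel q (x j / x i)) * u) *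
      ((∏ i ∈ I, thetaTriple 1 (q 2) (q 2)⁻¹ (x i)⁻¹) *
        ∏ j ∈ S \ I, thetaTriple (q 0) (q 1) (q 2) (x j)⁻¹))

theorem laurentEval_thetaTriple (a b c w z : Eˣ) : laurentEval z (thetaTriple a b c w⁻¹) =
    thetaU (a * (z / w)) * thetaU (b * (z / w)) * thetaU (c * (z / w)) := by
  rw [thetaTriple, map_mul, map_mul, laurentEval_thetaL, laurentEval_thetaL, laurentEval_thetaL,
    div_eq_inv_mul, mul_assoc a, mul_assoc b, mul_assoc c]

theorem laurentEval_thetaDen (w z : Eˣ) :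
    laurentEval z (thetaTriple 1 (q 2) (q 2)⁻¹ w⁻¹) = thetaDen q (z / w) := by
  rw [laurentEval_thetaTriple, one_mul, thetaDen]

theorem laurentEval_decompNumL (S : Finset ι) (x : ι → Eˣ) (u v : PowerSeries E) (z : Eˣ) :
    laurentEval z (decompNumL q S x u v) = decompNum q S x u v z := by
  rw [decompNumL, decompNum, map_sum]
  refine Finset.sum_congr rfl fun I _ => ?_
  simp only [map_add, map_mul, map_prod, laurentEval_const, laurentEval_thetaTriple, one_mul,
    thetaNeg, thetaPos, thetaDen]
  ring

/-- Each summand contains exactly one theta triple for every point of `S`, whatever the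
decomposition, so degree and multiplier are common to all summands. -/
theorem isQuasiPeriodic_decompNumL (hq : q 0 * q 1 * q 2 = 1) (S : Finset ι) (x : ι → Eˣ)
    (u v : PowerSeries E) :
    IsQuasiPeriodic ((3 * S.card : ℕ) : ℤ) (∏ i ∈ S, -((x i)⁻¹⁻¹ : E) ^ 3)
      (decompNumL q S x u v) := by
  have hq' : (q 0)⁻¹ * (q 1)⁻¹ * (q 2)⁻¹ = 1 := by rw [← mul_inv, ← mul_inv, hq, inv_one]
  have hq'' : 1 * q 2 * (q 2)⁻¹ = 1 := by rw [one_mul, mul_inv_cancel]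
  have aux : ∀ I ⊆ S, ∀ f g : ι → PowerSeries (LaurentPolynomial E),
      (∀ i, IsQuasiPeriodic 3 (-((x i)⁻¹⁻¹ : E) ^ 3) (f i)) →
      (∀ i, IsQuasiPeriodic 3 (-((x i)⁻¹⁻¹ : E) ^ 3) (g i)) →
      IsQuasiPeriodic ((3 * S.card : ℕ) : ℤ) (∏ i ∈ S, -((x i)⁻¹⁻¹ : E) ^ 3)
        ((∏ i ∈ I, f i) * ∏ j ∈ S \ I, g j) := by
    intro I hI f g hf hg
    have := (IsQuasiPeriodic.prod (s := I) fun i _ => hf i).mul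
      (IsQuasiPeriodic.prod (s := S \ I) fun i _ => hg i)
    rw [← Finset.prod_sdiff hI, mul_comm (∏ i ∈ S \ I, _)]
    convert this using 1
    rw [← Finset.card_sdiff_add_card_eq_card hI]
    push_cast
    ring
  have e : ∀ (a b c : Eˣ), a * b * c = 1 → ∀ i,
      IsQuasiPeriodic 3 (-((x i)⁻¹⁻¹ : E) ^ 3) (thetaTriple a b c (x i)⁻¹) := by
    intro a b c h i
    simpa using isQuasiPeriodic_thetaTriple h (x i)⁻¹
  refine IsQuasiPeriodic.sum fun I hI => ?_
  have hI' := Finset.mem_powerset.mp hI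
  exact ((aux I hI' _ _ (e _ _ _ hq') (e _ _ _ hq'')).const_mul _).add
    ((aux I hI' _ _ (e _ _ _ hq'') (e _ _ _ hq)).const_mul _)

/-- The antisymmetrized numerator and the denominator are quasi-periodic with the same degree `3|S|`
and multiplier, and both vanish at the `3|S|` points `x_t`, `q₃x_t`, `q₃⁻¹x_t`. They are therefore
proportional, which is stated by cross multiplication with the values at one further point `y`. -/
theorem decompNum_sub_mul_prod_thetaDen (hq : q 0 * q 1 * q 2 = 1) (h3 : q 2 ≠ 1)
    (h3' : q 2 ^ 2 ≠ 1) {S : Finset ι} {x : ι → Eˣ} (hx : InGeneralPosition q S x)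
    (u v : PowerSeries E)
    (ih : ∀ t ∈ S, decompSum q (S.erase t) x u v = decompSum q (S.erase t) x v u) {y : Eˣ}
    (hy : ∀ i ∈ S, y ≠ x i ∧ y ≠ q 2 * x i ∧ x i ≠ q 2 * y) (z : Eˣ) :
    (decompNum q S x u v z - decompNum q S x v u z) * ∏ i ∈ S, thetaDen q (y / x i) =
      (decompNum q S x u v y - decompNum q S x v u y) * ∏ i ∈ S, thetaDen q (z / x i) := by
  classical
  set P := decompNumL q S x u v - decompNumL q S x v u with hP
  have hPe : ∀ z, laurentEval z P = decompNum q S x u v z - decompNum q S x v u z := by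
    intro z
    rw [hP, map_sub, laurentEval_decompNumL, laurentEval_decompNumL]
  set D := ∏ i ∈ S, thetaTriple 1 (q 2) (q 2)⁻¹ (x i)⁻¹ with hD
  have hDe : ∀ z, laurentEval z D = ∏ i ∈ S, thetaDen q (z / x i) := by
    intro z
    rw [hD, map_prod]
    exact Finset.prod_congr rfl fun i _ => laurentEval_thetaDen _ _
  have hDq : IsQuasiPeriodic ((3 * S.card : ℕ) : ℤ) (∏ i ∈ S, -((x i)⁻¹⁻¹ : E) ^ 3) D := by
    have := IsQuasiPeriodic.prod (s := S) fun i _ => isQuasiPeriodic_thetaTriple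
      (show 1 * q 2 * (q 2)⁻¹ = 1 by rw [one_mul, mul_inv_cancel]) (x i)⁻¹
    convert this using 1
    · push_cast
      ring
    · simp
  have hPq : IsQuasiPeriodic ((3 * S.card : ℕ) : ℤ) (∏ i ∈ S, -((x i)⁻¹⁻¹ : E) ^ 3) P :=
    (isQuasiPeriodic_decompNumL hq S x u v).sub (isQuasiPeriodic_decompNumL hq S x v u)
  -- Besides the common zeros of `P` and `D`, this combination vanishes at `y`, one zero more than
  -- its degree allows.
  set R := PowerSeries.map LaurentPolynomial.C (laurentEval y D) * P -
    PowerSeries.map LaurentPolynomial.C (laurentEval y P) * D with hR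
  have hRe : ∀ z, laurentEval z R = laurentEval y D * laurentEval z P -
      laurentEval y P * laurentEval z D := by
    intro z
    rw [hR, map_sub, map_mul, map_mul, laurentEval_const, laurentEval_const]
  have hzero : ∀ t ∈ S, ∀ a ∈ ({1, q 2, (q 2)⁻¹} : Finset Eˣ), laurentEval (a * x t) R = 0 := by
    intro t ht a ha
    have hD0 : laurentEval (a * x t) D = 0 := by
      rw [hDe]
      apply Finset.prod_eq_zero ht
      rw [mul_div_assoc, div_self', mul_one, thetaDen]
      simp only [Finset.mem_insert, Finset.mem_singleton] at ha
      rcases ha with rfl | rfl | rfl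
      · rw [thetaU_one, zero_mul, zero_mul]
      · rw [inv_mul_cancel, thetaU_one, mul_zero]
      · rw [mul_inv_cancel, thetaU_one, mul_zero, zero_mul]
    -- At `x_t` both numerators vanish separately. At `q₃^{±1} x_t` they are the same multiple of
    -- the two sums for `S` without `t`, which agree by `ih`.
    have hP0 : laurentEval (a * x t) P = 0 := by
      rw [hPe]
      have hS : insert t (S.erase t) = S := Finset.insert_erase ht
      have hx' : InGeneralPosition q (insert t (S.erase t)) x := hS.symm ▸ hx
      have ht' := Finset.notMem_erase t S
      simp only [Finset.mem_insert, Finset.mem_singleton] at ha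
      rcases ha with rfl | rfl | rfl
      · rw [one_mul, decompNum_eq_zero hq hx u v ht, decompNum_eq_zero hq hx v u ht, sub_zero]
      · have e1 := decompNum_shift hq ht' hx' u v
        have e2 := decompNum_shift hq ht' hx' v u
        rw [hS] at e1 e2
        rw [e1, e2, ih t ht]
        ring
      · have e1 := decompNum_shift_inv hq ht' hx' u v
        have e2 := decompNum_shift_inv hq ht' hx' v u
        rw [hS] at e1 e2
        rw [e1, e2, ih t ht]
        ring
    rw [hRe, hD0, hP0]
    ring
  have hcard : ({1, q 2, (q 2)⁻¹} : Finset Eˣ).card = 3 := by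
    rw [Finset.card_eq_three]
    refine ⟨1, q 2, (q 2)⁻¹, h3.symm, fun h => h3 (inv_eq_one.mp h.symm), fun h => h3' ?_, rfl⟩
    rw [sq]
    nth_rewrite 2 [h]
    exact mul_inv_cancel _
  set Z : Finset Eˣ := (({1, q 2, (q 2)⁻¹} : Finset Eˣ) ×ˢ S).image fun a => a.1 * x a.2 with hZ
  -- Quotients of two elements of `{1, q₃, q₃⁻¹}` are powers of `q₃` with exponent between `-2` and
  -- `2`; this is why general position also excludes `x_i = q₃² x_j`.
  have hZcard : Z.card = 3 * S.card := by
    rw [hZ, Finset.card_image_of_injOn, Finset.card_product, hcard]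
    rintro ⟨a, s⟩ has ⟨b, t⟩ hbt hab
    simp only [Finset.coe_product, Set.mem_prod, Finset.mem_coe] at has hbt
    simp only at hab
    by_cases hst : s = t
    · subst hst
      rw [mul_right_cancel hab]
    · exfalso
      obtain ⟨g1, g2, g3⟩ := hx s has.2 t hbt.2 hst
      obtain ⟨k1, k2, k3⟩ := hx t hbt.2 s has.2 (Ne.symm hst)
      have ha := has.1
      have hb := hbt.1
      simp only [Finset.mem_insert, Finset.mem_singleton] at ha hb
      rw [← eq_inv_mul_iff_mul_eq] at hab
      have hab' := hab
      rw [eq_inv_mul_iff_mul_eq, ← inv_mul_eq_iff_eq_mul] at hab'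
      rcases ha with rfl | rfl | rfl <;> rcases hb with rfl | rfl | rfl <;>
        simp_all [sq, mul_assoc]
  have hyZ : y ∉ Z := by
    intro h
    obtain ⟨⟨a, t⟩, hat, hay⟩ := Finset.mem_image.mp h
    obtain ⟨ha, ht⟩ := Finset.mem_product.mp hat
    obtain ⟨g1, g2, g3⟩ := hy t ht
    simp only [Finset.mem_insert, Finset.mem_singleton] at ha
    simp only at hay
    rcases ha with rfl | rfl | rfl
    · exact g1 (by rw [← hay, one_mul])
    · exact g2 hay.symm
    · exact g3 (by rw [← hay, mul_inv_cancel_left])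
  have hR0 : R = 0 := by
    refine IsQuasiPeriodic.eq_zero (d := 3 * S.card) ?_
      ((hPq.const_mul (laurentEval y D)).sub (hDq.const_mul (laurentEval y P))) (insert y Z) ?_ ?_
    · exact Finset.prod_ne_zero_iff.mpr fun i _ => by simp
    · rw [Finset.card_insert_of_notMem hyZ, hZcard]
      omega
    · intro b hb
      rcases Finset.mem_insert.mp hb with rfl | hb
      · rw [hRe]
        ring
      · obtain ⟨⟨a, t⟩, hat, rfl⟩ := Finset.mem_image.mp hb
        obtain ⟨ha, ht⟩ := Finset.mem_product.mp hat
        exact hzero t ht a ha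
  have := hRe z
  rw [hR0, map_zero, hPe, hPe, hDe, hDe] at this
  linear_combination -this

theorem decompNum_congr {S : Finset ι} {x y : ι → Eˣ} (h : ∀ i ∈ S, x i = y i)
    (u v : PowerSeries E) (z : Eˣ) : decompNum q S x u v z = decompNum q S y u v z := by
  refine Finset.sum_congr rfl fun I hI => ?_
  have hI' := Finset.mem_powerset.mp hI
  have hI : ∀ i ∈ I, x i = y i := fun i hi => h i (hI' hi)
  have hJ : ∀ i ∈ S \ I, x i = y i := fun i hi => h i (Finset.mem_sdiff.mp hi).1
  have e1 : ∏ i ∈ I, ∏ j ∈ S \ I, kernel q (x j / x i) =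
      ∏ i ∈ I, ∏ j ∈ S \ I, kernel q (y j / y i) :=
    Finset.prod_congr rfl fun i hi => Finset.prod_congr rfl fun j hj => by rw [hI i hi, hJ j hj]
  have e2 : ∀ f : Eˣ → PowerSeries E, ∏ i ∈ I, f (x i) = ∏ i ∈ I, f (y i) := fun f =>
    Finset.prod_congr rfl fun i hi => by rw [hI i hi]
  have e3 : ∀ f : Eˣ → PowerSeries E, ∏ i ∈ S \ I, f (x i) = ∏ i ∈ S \ I, f (y i) := fun f =>
    Finset.prod_congr rfl fun i hi => by rw [hJ i hi]
  rw [e1, e2 fun w => thetaNeg q (z / w), e2 fun w => thetaDen q (z / w),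
    e3 fun w => thetaDen q (z / w), e3 fun w => thetaPos q (z / w)]

/-- Dividing the proportionality of numerator and denominator by the nonzero denominators: the
difference of the two sums does not change when a single point is moved. -/
theorem decompSum_sub_update (hq : q 0 * q 1 * q 2 = 1) (h3 : q 2 ≠ 1)
    (h3' : q 2 ^ 2 ≠ 1) {s : ι} {S : Finset ι} (hs : s ∉ S) {x : ι → Eˣ} {y : Eˣ}
    (hx : InGeneralPosition q (insert s S) x)
    (hy : InGeneralPosition q (insert s S) (Function.update x s y)) (u v : PowerSeries E)
    (ih : ∀ t ∈ S, decompSum q (S.erase t) x u v = decompSum q (S.erase t) x v u) :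
    decompSum q (insert s S) (Function.update x s y) u v -
        decompSum q (insert s S) (Function.update x s y) v u =
      decompSum q (insert s S) x u v - decompSum q (insert s S) x v u := by
  have hne : ∀ i ∈ S, i ≠ s := fun i hi h => hs (h ▸ hi)
  have hup : ∀ i ∈ S, Function.update x s y i = x i := fun i hi =>
    Function.update_of_ne (hne i hi) _ _
  have hys : Function.update x s y s = y := Function.update_self _ _ _
  have k1 := decompSum_mul_prod_thetaDen hq hs hx u v
  have k2 := decompSum_mul_prod_thetaDen hq hs hx v u
  have k3 := decompSum_mul_prod_thetaDen hq hs hy u v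
  have k4 := decompSum_mul_prod_thetaDen hq hs hy v u
  rw [decompNum_congr hup, hys] at k3 k4
  rw [Finset.prod_congr rfl fun i hi => by rw [hup i hi]] at k3 k4
  have key := decompNum_sub_mul_prod_thetaDen hq h3 h3' (hx.mono (Finset.subset_insert s S)) u v ih
    (y := y) (fun i hi => by
      have g := hy s (Finset.mem_insert_self s S) i (Finset.mem_insert_of_mem hi) (hne i hi).symm
      have g' := hy i (Finset.mem_insert_of_mem hi) s (Finset.mem_insert_self s S) (hne i hi)
      rw [hup i hi, hys] at g g'
      exact ⟨g.1, g.2.1, g'.2.1⟩) (x s)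
  rw [← k1, ← k2, ← k3, ← k4] at key
  have den : ∀ {x : ι → Eˣ}, InGeneralPosition q (insert s S) x →
      ∏ i ∈ S, thetaDen q (x s / x i) ≠ 0 := by
    intro x hx
    refine Finset.prod_ne_zero_iff.mpr fun i hi => ?_
    obtain ⟨h1, h2, h3⟩ := hx.div_ne (Finset.mem_insert_self s S) (Finset.mem_insert_of_mem hi)
      (hne i hi).symm
    refine mul_ne_zero (mul_ne_zero (thetaU_ne_zero h1) (thetaU_ne_zero h3)) (thetaU_ne_zero ?_)
    rw [Ne, inv_mul_eq_one]
    exact h2.symm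
  have d1 := den hx
  have d2 := den hy
  rw [hys, Finset.prod_congr rfl fun i hi => by rw [hup i hi]] at d2
  apply mul_right_cancel₀ (mul_ne_zero d1 d2)
  linear_combination -key

/-- Inverting the points inverts all ratios `x_j / x_i`, which amounts to exchanging `I` with its
complement. -/
theorem decompSum_inv (S : Finset ι) (x : ι → Eˣ) (l : Eˣ) (u v : PowerSeries E) :
    decompSum q S (fun i => l / x i) u v = decompSum q S x v u := by
  have key : ∀ I ∈ S.powerset, u ^ I.card * v ^ (S \ I).card *
      ∏ i ∈ I, ∏ j ∈ S \ I, kernel q (l / x j / (l / x i)) =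
      (fun J => v ^ J.card * u ^ (S \ J).card * ∏ i ∈ J, ∏ j ∈ S \ J, kernel q (x j / x i))
        (S \ I) := by
    intro I hI
    have e : ∏ i ∈ I, ∏ j ∈ S \ I, kernel q (l / x j / (l / x i)) =
        ∏ i ∈ S \ I, ∏ j ∈ I, kernel q (x j / x i) := by
      simp only [div_div_div_cancel_left]
      exact Finset.prod_comm
    beta_reduce
    rw [e, Finset.sdiff_sdiff_eq_self (Finset.mem_powerset.mp hI), mul_comm (u ^ I.card)]
  rw [decompSum, decompSum, Finset.sum_congr rfl key]
  generalize (fun J => v ^ J.card * u ^ (S \ J).card *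
    ∏ i ∈ J, ∏ j ∈ S \ J, kernel q (x j / x i)) = F
  refine Finset.sum_nbij' (fun I => S \ I) (fun I => S \ I) ?_ ?_ ?_ ?_ fun _ _ => rfl
  · exact fun I _ => Finset.mem_powerset.mpr Finset.sdiff_subset
  · exact fun I _ => Finset.mem_powerset.mpr Finset.sdiff_subset
  · exact fun I hI => Finset.sdiff_sdiff_eq_self (Finset.mem_powerset.mp hI)
  · exact fun I hI => Finset.sdiff_sdiff_eq_self (Finset.mem_powerset.mp hI)

theorem decompSum_congr {S : Finset ι} {x y : ι → Eˣ} (h : ∀ i ∈ S, x i = y i)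
    (u v : PowerSeries E) : decompSum q S x u v = decompSum q S y u v := by
  rw [decompSum, decompSum]
  refine Finset.sum_congr rfl fun I hI => ?_
  have hI' := Finset.mem_powerset.mp hI
  have e : ∏ i ∈ I, ∏ j ∈ S \ I, kernel q (x j / x i) =
      ∏ i ∈ I, ∏ j ∈ S \ I, kernel q (y j / y i) :=
    Finset.prod_congr rfl fun i hi => Finset.prod_congr rfl fun j hj => by
      rw [h i (hI' hi), h j (Finset.mem_sdiff.mp hj).1]
  rw [e]

/-- The functional identity underlying the commutativity of the elliptic Ruijsenaars operators. -/
theorem decompSum_comm [CharZero E] (hq : q 0 * q 1 * q 2 = 1) (h3 : q 2 ≠ 1)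
    (h3' : q 2 ^ 2 ≠ 1) (u v : PowerSeries E) (S : Finset ι) (x : ι → Eˣ)
    (hx : InGeneralPosition q S x) : decompSum q S x u v = decompSum q S x v u := by
  induction hn : S.card using Nat.strong_induction_on generalizing S x with
  | _ n ih =>
    have : Infinite E := Infinite.of_injective _ (Nat.cast_injective (R := E))
    classical
    -- Only finitely many values of `l` are excluded and `E` is infinite. The excluded values are
    -- those for which some configuration with a part of the points replaced by `l / x_i` leaves
    -- general position.
    obtain ⟨l, hl⟩ : ∃ l : Eˣ, ∀ i ∈ S, ∀ j ∈ S,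
        ∀ a ∈ ({1, q 2, q 2 ^ 2, (q 2)⁻¹, (q 2)⁻¹ ^ 2} : Finset Eˣ), l ≠ a * (x i * x j) := by
      obtain ⟨e, he⟩ := Infinite.exists_notMem_finset (insert (0 : E)
        (({1, q 2, q 2 ^ 2, (q 2)⁻¹, (q 2)⁻¹ ^ 2} ×ˢ S ×ˢ S).image
          fun a : Eˣ × ι × ι => ((a.1 * (x a.2.1 * x a.2.2) : Eˣ) : E)))
      rw [Finset.mem_insert, not_or] at he
      refine ⟨Units.mk0 e he.1, fun i hi j hj a ha h => he.2 ?_⟩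
      refine Finset.mem_image.mpr ⟨(a, i, j), by simp only [Finset.mem_product]; exact ⟨ha, hi, hj⟩, ?_⟩
      rw [← h, Units.val_mk0]
    set y : Finset ι → ι → Eˣ := fun T i => if i ∈ T then l / x i else x i with hy
    have hgen : ∀ T ⊆ S, InGeneralPosition q S (y T) := by
      intro T _ i hi j hj hij
      obtain ⟨g1, g2, g3⟩ := hx i hi j hj hij
      obtain ⟨k1, k2, k3⟩ := hx j hj i hi hij.symm
      have h0 := hl i hi j hj
      simp only [Finset.mem_insert, Finset.mem_singleton, forall_eq_or_imp, forall_eq] at h0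
      obtain ⟨h1, h2, h4, h5, h6⟩ := h0
      simp only [hy]
      by_cases hiT : i ∈ T <;> by_cases hjT : j ∈ T <;> simp only [hiT, hjT, if_true, if_false]
      · have aux : ∀ a : Eˣ, l / x i = a * (l / x j) → x j = a * x i := by
          intro a h
          rw [div_eq_iff_eq_mul, mul_div_assoc', div_mul_eq_mul_div, eq_div_iff_mul_eq'] at h
          apply mul_left_cancel (a := l)
          rw [mul_comm l, mul_comm (x j), h]
          ac_rfl
        exact ⟨fun h => k1 (by simpa using aux 1 (by simpa using h)), fun h => k2 (aux _ h),
          fun h => k3 (aux _ h)⟩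
      · have aux : ∀ a : Eˣ, l / x i = a * x j → l = a * (x i * x j) := by
          intro a h
          rw [div_eq_iff_eq_mul] at h
          rw [h]
          ac_rfl
        exact ⟨fun h => h1 (aux 1 (by simpa using h)), fun h => h2 (aux _ h),
          fun h => h4 (aux _ h)⟩
      · have aux : ∀ a : Eˣ, x i = a * (l / x j) → l = a⁻¹ * (x i * x j) := by
          intro a h
          rw [h, mul_assoc, inv_mul_cancel_left, div_mul_cancel]
        refine ⟨fun h => h1 (by simpa using aux 1 (by simpa using h)), fun h => h5 (aux _ h),
          fun h => h6 (by simpa using aux _ h)⟩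
      · exact ⟨g1, g2, g3⟩
    -- The points are inverted one at a time, each move leaving the difference unchanged. The moves
    -- need the identity for `S` with two points removed, available from the outer induction.
    have move : ∀ T ⊆ S, decompSum q S (y T) u v - decompSum q S (y T) v u =
        decompSum q S x u v - decompSum q S x v u := by
      intro T
      induction T using Finset.induction_on with
      | empty => intro _; simp [hy]
      | insert s T hsT ihT =>
        intro hT
        have hTS : T ⊆ S := fun i hi => hT (Finset.mem_insert_of_mem hi)
        have hsS : s ∈ S := hT (Finset.mem_insert_self s T)
        have hup : y (insert s T) = Function.update (y T) s (l / x s) := by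
          funext i
          by_cases his : i = s
          · subst his
            simp [hy]
          · simp [hy, his]
        have hins := Finset.insert_erase hsS
        have g1 := hgen T hTS
        have g2 := hgen _ hT
        rw [← ihT hTS, hup]
        rw [hup] at g2
        have key := decompSum_sub_update (S := S.erase s) hq h3 h3' (Finset.notMem_erase s S)
          (x := y T) (y := l / x s) (by rwa [hins]) (by rwa [hins]) u v (fun t ht => by
            have hlt : ((S.erase s).erase t).card < n := by
              rw [← hn]
              exact (Finset.card_lt_card (Finset.erase_ssubset ht)).trans
                (Finset.card_lt_card (Finset.erase_ssubset hsS))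
            exact ih _ hlt _ _ (g1.mono ((Finset.erase_subset _ _).trans (Finset.erase_subset _ _)))
              rfl)
        rw [hins] at key
        exact key
    -- Once all points are inverted, `u` and `v` have changed places: the difference equals its
    -- negative, and `2` is invertible.
    have key := move S subset_rfl
    have hyS : ∀ u v, decompSum q S (y S) u v = decompSum q S x v u := by
      intro u v
      rw [← decompSum_inv S x l]
      exact decompSum_congr (fun i hi => by simp [hy, hi]) u v
    rw [hyS, hyS] at key
    have h2 : (2 : PowerSeries E) ≠ 0 := by
      intro h
      have := congrArg (constantCoeff (R := E)) h
      rw [map_ofNat, map_zero] at this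
      exact two_ne_zero this
    apply mul_left_cancel₀ h2
    linear_combination -key

end Ruijsenaars

/-! ## Symmetry in `u` -/

section USymmetry

open PowerSeries

variable {E : Type} [Field E] {ι : Type} [Fintype ι] {n : ℕ}

/-- `∏ F(x_l / x_i)` over all `i`, `l` with `j_i < j_l`. -/
def pairProd (q : Fin 3 → Eˣ) (x : ι → Eˣ) (j : ι → Fin n) : PowerSeries E :=
  ∏ i, ∏ l, if j i < j l then kernel q (x l / x i) else 1

/-- Permuting the points is absorbed by relabelling `j`; the symmetry in `z` of the sum over all `j`
follows. -/
theorem pairProd_comp (q : Fin 3 → Eˣ) (x : ι → Eˣ) (j : ι → Fin n) (τ : Equiv.Perm ι) :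
    pairProd q (x ∘ τ) j = pairProd q x (j ∘ τ.symm) := by
  rw [pairProd, pairProd, ← Equiv.prod_comp τ.symm]
  refine Finset.prod_congr rfl fun i _ => ?_
  rw [← Equiv.prod_comp τ.symm]
  simp

variable [DecidableEq ι]

/-- `∑_j ∏ u_{j_i} ∏_{j_i < j_l} F(x_l / x_i)`. -/
def currentSum (q : Fin 3 → Eˣ) (x : ι → Eˣ) (u : Fin n → PowerSeries E) : PowerSeries E :=
  ∑ j : ι → Fin n, (∏ i, u (j i)) * pairProd q x j

/-- Merges the value `b` into the value `a`. -/
def mergeMap (a b : Fin n) (j : ι → Fin n) : ι → Fin n := fun i => if j i = b then a else j i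

/-- Splits the value `a` of `j`: outside of `I` it becomes `b`. -/
def splitMap (a b : Fin n) (j : ι → Fin n) (I : Finset ι) : ι → Fin n :=
  fun i => if j i = a ∧ i ∉ I then b else j i

/-- A map that merges to `j₀` is determined by the positions, among those where `j₀` equals `a`,
which keep the value `a`; this subset is arbitrary. -/
theorem sum_mergeMap_fiber {a b : Fin n} (hab : a ≠ b) {j₀ : ι → Fin n} (hj₀ : ∀ i, j₀ i ≠ b)
    (f : (ι → Fin n) → PowerSeries E) :
    ∑ j with mergeMap a b j = j₀, f j =
      ∑ I ∈ (Finset.univ.filter fun i => j₀ i = a).powerset, f (splitMap a b j₀ I) := by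
  refine Finset.sum_bij' (fun j _ => Finset.univ.filter fun i => j i = a)
    (fun I _ => splitMap a b j₀ I) ?_ ?_ ?_ ?_ ?_
  · intro j hj
    have hj := (Finset.mem_filter.mp hj).2
    rw [Finset.mem_powerset]
    intro i hi
    simp only [Finset.mem_filter, Finset.mem_univ, true_and] at hi ⊢
    rw [← hj, mergeMap, hi, if_neg hab]
  · intro I hI
    rw [Finset.mem_filter]
    refine ⟨Finset.mem_univ _, ?_⟩
    funext i
    have := hj₀ i
    by_cases h : j₀ i = a ∧ i ∉ I
    · have e : splitMap a b j₀ I i = b := if_pos h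
      simp [mergeMap, e, h.1]
    · have e : splitMap a b j₀ I i = j₀ i := if_neg h
      simp [mergeMap, e, this]
  · intro j hj
    have hj := (Finset.mem_filter.mp hj).2
    funext i
    have h := congrFun hj i
    simp only [mergeMap] at h
    simp only [splitMap, Finset.mem_filter, Finset.mem_univ, true_and, ← h]
    by_cases h1 : j i = b
    · simp [h1, hab.symm]
    · simp [h1]
  · intro I hI
    have hI' := Finset.mem_powerset.mp hI
    ext i
    rw [Finset.mem_filter, and_iff_right (Finset.mem_univ i)]
    constructor
    · intro h
      by_contra hi
      by_cases h' : j₀ i = a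
      · have e : splitMap a b j₀ I i = b := if_pos ⟨h', hi⟩
        exact hab (h.symm.trans e)
      · have e : splitMap a b j₀ I i = j₀ i := if_neg fun h2 => h' h2.1
        exact h' (e.symm.trans h)
    · intro hi
      have e : splitMap a b j₀ I i = j₀ i := if_neg fun h => h.2 hi
      exact e.trans (Finset.mem_filter.mp (hI' hi)).2
  · intro j hj
    have hj := (Finset.mem_filter.mp hj).2
    congr 1
    funext i
    have h := congrFun hj i
    simp only [mergeMap] at h
    simp only [splitMap, Finset.mem_filter, Finset.mem_univ, true_and, ← h]
    by_cases h1 : j i = b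
    · simp [h1, hab.symm]
    · simp [h1]

/-- By `hcov` no value lies strictly between `a` and `b`. Splitting therefore creates new
inequalities only between positions inside the preimage of `a`, from `I` to its complement, and
leaves all others intact. -/
theorem pairProd_splitMap (q : Fin 3 → Eˣ) (x : ι → Eˣ) {a b : Fin n} (hab : a < b)
    (hcov : ∀ c, c ≠ a → c ≠ b → (c < a ↔ c < b)) {j₀ : ι → Fin n} (hj₀ : ∀ i, j₀ i ≠ b)
    {I : Finset ι} (hI : I ⊆ Finset.univ.filter fun i => j₀ i = a) :
    pairProd q x (splitMap a b j₀ I) = pairProd q x j₀ *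
      ∏ i ∈ I, ∏ l ∈ (Finset.univ.filter fun i => j₀ i = a) \ I, kernel q (x l / x i) := by
  have h1 : ∏ i ∈ I, ∏ l ∈ (Finset.univ.filter fun i => j₀ i = a) \ I, kernel q (x l / x i) =
      ∏ i, ∏ l, if i ∈ I ∧ (j₀ l = a ∧ l ∉ I) then kernel q (x l / x i) else 1 := by
    rw [← Finset.prod_subset (Finset.subset_univ I)]
    · refine Finset.prod_congr rfl fun i hi => ?_
      rw [← Finset.prod_filter]
      refine Finset.prod_congr ?_ fun _ _ => rfl
      ext l
      simp [hi]
    · intro i _ hi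
      simp [hi]
  rw [h1, pairProd, pairProd, ← Finset.prod_mul_distrib]
  refine Finset.prod_congr rfl fun i _ => ?_
  rw [← Finset.prod_mul_distrib]
  refine Finset.prod_congr rfl fun l _ => ?_
  have hIi : i ∈ I → j₀ i = a := fun h => (Finset.mem_filter.mp (hI h)).2
  have hIl : l ∈ I → j₀ l = a := fun h => (Finset.mem_filter.mp (hI h)).2
  have hi := hj₀ i
  have hl := hj₀ l
  have ci := hcov (j₀ i)
  have cl := hcov (j₀ l)
  simp only [splitMap]
  generalize kernel q (x l / x i) = K
  by_cases e1 : j₀ i = a <;> by_cases e2 : j₀ l = a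
  · by_cases e3 : i ∈ I <;> by_cases e4 : l ∈ I <;> simp [e1, e2, e3, e4, hab, not_lt.mpr hab.le]
  · have e4 : l ∉ I := fun h => e2 (hIl h)
    have : (a < j₀ l ↔ b < j₀ l) := by
      have := cl e2 hl
      constructor
      · intro h
        exact lt_of_le_of_ne (not_lt.mp fun h' => absurd (this.mpr h') (not_lt.mpr h.le)) hl.symm
      · intro h
        exact hab.trans h
    by_cases e3 : i ∈ I <;> simp [e1, e2, e3, this]
  · have e3 : i ∉ I := fun h => e1 (hIi h)
    have := ci e1 hi
    by_cases e4 : l ∈ I <;> simp [e1, e2, e3, e4, this]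
  · have e3 : i ∉ I := fun h => e1 (hIi h)
    simp [e1, e2, e3]

theorem prod_splitMap (u : Fin n → PowerSeries E) {a b : Fin n} {j₀ : ι → Fin n}
    {I : Finset ι} (hI : I ⊆ Finset.univ.filter fun i => j₀ i = a) :
    ∏ i, u (splitMap a b j₀ I i) = (∏ i with j₀ i ≠ a, u (j₀ i)) *
      (u a ^ I.card * u b ^ ((Finset.univ.filter fun i => j₀ i = a) \ I).card) := by
  rw [← Finset.prod_filter_mul_prod_filter_not Finset.univ (fun i => j₀ i = a), mul_comm]
  congr 1
  · refine Finset.prod_congr rfl fun i hi => ?_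
    have := (Finset.mem_filter.mp hi).2
    rw [splitMap, if_neg (fun h => this h.1)]
  · rw [← Finset.prod_sdiff hI, mul_comm]
    congr 1
    · rw [← Finset.prod_const]
      refine Finset.prod_congr rfl fun i hi => ?_
      rw [splitMap, if_neg (fun h => h.2 hi), (Finset.mem_filter.mp (hI hi)).2]
    · rw [← Finset.prod_const]
      refine Finset.prod_congr rfl fun i hi => ?_
      obtain ⟨h1, h2⟩ := Finset.mem_sdiff.mp hi
      rw [splitMap, if_pos ⟨(Finset.mem_filter.mp h1).2, h2⟩]

theorem sum_fiber_eq (q : Fin 3 → Eˣ) (x : ι → Eˣ) {a b : Fin n} (hab : a < b)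
    (hcov : ∀ c, c ≠ a → c ≠ b → (c < a ↔ c < b)) {j₀ : ι → Fin n} (hj₀ : ∀ i, j₀ i ≠ b)
    (u : Fin n → PowerSeries E) :
    ∑ j with mergeMap a b j = j₀, (∏ i, u (j i)) * pairProd q x j =
      (∏ i with j₀ i ≠ a, u (j₀ i)) * pairProd q x j₀ *
        decompSum q (Finset.univ.filter fun i => j₀ i = a) x (u a) (u b) := by
  rw [sum_mergeMap_fiber hab.ne hj₀ fun j => (∏ i, u (j i)) * pairProd q x j, decompSum,
    Finset.mul_sum]
  refine Finset.sum_congr rfl fun I hI => ?_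
  have hI' := Finset.mem_powerset.mp hI
  rw [pairProd_splitMap q x hab hcov hj₀ hI', prod_splitMap u hI']
  ring

/-- On each fibre of the merging map the variables `u_a`, `u_b` enter only through a decomposition
sum, to which Ruijsenaars' identity applies. -/
theorem currentSum_swap [CharZero E] {q : Fin 3 → Eˣ} (hq : q 0 * q 1 * q 2 = 1) (h3 : q 2 ≠ 1)
    (h3' : q 2 ^ 2 ≠ 1) {x : ι → Eˣ} (hx : InGeneralPosition q Finset.univ x) {a b : Fin n}
    (hab : a < b) (hcov : ∀ c, c ≠ a → c ≠ b → (c < a ↔ c < b)) (u : Fin n → PowerSeries E) :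
    currentSum q x (u ∘ Equiv.swap a b) = currentSum q x u := by
  rw [currentSum, currentSum, ← Finset.sum_fiberwise Finset.univ (mergeMap a b)
    fun j => (∏ i, (u ∘ Equiv.swap a b) (j i)) * pairProd q x j,
    ← Finset.sum_fiberwise Finset.univ (mergeMap a b) fun j => (∏ i, u (j i)) * pairProd q x j]
  refine Finset.sum_congr rfl fun j₀ _ => ?_
  by_cases hj₀ : ∀ i, j₀ i ≠ b
  · rw [sum_fiber_eq q x hab hcov hj₀, sum_fiber_eq q x hab hcov hj₀]
    simp only [Function.comp_apply, Equiv.swap_apply_left, Equiv.swap_apply_right]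
    rw [decompSum_comm hq h3 h3' (u b) (u a) _ x (hx.mono (Finset.subset_univ _))]
    congr 2
    refine Finset.prod_congr rfl fun i hi => ?_
    rw [Equiv.swap_apply_of_ne_of_ne (Finset.mem_filter.mp hi).2 (hj₀ i)]
  -- A map that takes the value `b` is never the result of merging, so its fibre is empty.
  · push Not at hj₀
    obtain ⟨i, hi⟩ := hj₀
    have : (Finset.univ.filter fun j : ι → Fin n => mergeMap a b j = j₀) = ∅ := by
      rw [Finset.filter_eq_empty_iff]
      intro j _ hj
      have := congrFun hj i
      rw [mergeMap, hi] at this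
      split_ifs at this with h
      · exact hab.ne this
      · exact h this
    rw [this, Finset.sum_empty, Finset.sum_empty]

/-- Adjacent transpositions generate the symmetric group. -/
theorem currentSum_perm [CharZero E] {q : Fin 3 → Eˣ} (hq : q 0 * q 1 * q 2 = 1) (h3 : q 2 ≠ 1)
    (h3' : q 2 ^ 2 ≠ 1) {x : ι → Eˣ} (hx : InGeneralPosition q Finset.univ x)
    (σ : Equiv.Perm (Fin n)) (u : Fin n → PowerSeries E) :
    currentSum q x (u ∘ σ) = currentSum q x u := by
  rcases n with _ | n
  · rw [Subsingleton.elim σ 1]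
    rfl
  · have hσ : σ ∈ Submonoid.closure
        (Set.range fun i : Fin n => Equiv.swap i.castSucc i.succ) := by
      rw [Equiv.Perm.mclosure_swap_castSucc_succ]
      trivial
    induction hσ using Submonoid.closure_induction generalizing u with
    | mem σ h =>
      obtain ⟨i, rfl⟩ := h
      refine currentSum_swap hq h3 h3' hx (Fin.castSucc_lt_succ) (fun c h1 h2 => ?_) u
      rw [Fin.lt_def, Fin.lt_def]
      rw [Ne, Fin.ext_iff] at h1 h2
      simp only [Fin.val_castSucc, Fin.val_succ] at h1 h2 ⊢
      omega
    | one => rfl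
    | mul σ τ _ _ h1 h2 =>
      rw [Equiv.Perm.coe_mul, ← Function.comp_assoc, h2, h1]

end USymmetry

/-! ## Formal sums and exponentials of multivariate power series -/

section FormalSums

open MvPowerSeries

variable {σ 𝕜 ι κ : Type} [Field 𝕜]

/-- `s` is the coefficientwise sum of the family `f`. -/
def FSum (f : ι → MvPowerSeries σ 𝕜) (s : MvPowerSeries σ 𝕜) : Prop :=
  ∀ d, ∃ t : Finset ι, (∀ i ∉ t, coeff d (f i) = 0) ∧ coeff d s = ∑ i ∈ t, coeff d (f i)

namespace FSum

variable {f g : ι → MvPowerSeries σ 𝕜} {s s' : MvPowerSeries σ 𝕜}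

theorem sum_eq (h : FSum f s) (d : σ →₀ ℕ) (T : Finset ι) (hT : ∀ i ∉ T, coeff d (f i) = 0) :
    coeff d s = ∑ i ∈ T, coeff d (f i) := by
  classical
  obtain ⟨t, ht, hs⟩ := h d
  rw [hs, Finset.sum_subset (Finset.subset_union_left (s₂ := T)) fun i _ hi => ht i hi,
    Finset.sum_subset (Finset.subset_union_right (s₁ := t)) fun i _ hi => hT i hi]

theorem unique (h : FSum f s) (h' : FSum f s') : s = s' := by
  ext d
  obtain ⟨t, ht, hs⟩ := h' d
  rw [h.sum_eq d t ht, hs]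

theorem of_finite (h : ∀ d, {i | coeff d (f i) ≠ 0}.Finite) :
    FSum f fun d => ∑ᶠ i, coeff d (f i) := by
  intro d
  refine ⟨(h d).toFinset, fun i hi => by simpa using hi, ?_⟩
  exact finsum_eq_sum_of_support_subset _ (by intro i hi; simpa using hi)

theorem finite (h : FSum f s) (d : σ →₀ ℕ) : {i | coeff d (f i) ≠ 0}.Finite := by
  obtain ⟨t, ht, -⟩ := h d
  refine t.finite_toSet.subset fun i hi => ?_
  by_contra hit
  exact hi (ht i hit)

theorem coeff_eq (h : FSum f s) (d : σ →₀ ℕ) : coeff d s = ∑ᶠ i, coeff d (f i) := by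
  rw [h.sum_eq d (h.finite d).toFinset fun i hi => by simpa using hi]
  exact (finsum_eq_sum_of_support_subset _ (by intro i hi; simpa using hi)).symm

theorem mul_left (h : FSum f s) (a : MvPowerSeries σ 𝕜) : FSum (fun i => a * f i) (a * s) := by
  classical
  intro d
  choose t ht hs using h
  set T := (Finset.HasAntidiagonal.antidiagonal d).biUnion fun ab => t ab.2
  have hT : ∀ ab ∈ Finset.HasAntidiagonal.antidiagonal d, ∀ i ∉ T, coeff ab.2 (f i) = 0 :=
    fun ab hab i hi => ht _ _ fun h' => hi (Finset.mem_biUnion.mpr ⟨ab, hab, h'⟩)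
  refine ⟨T, fun i hi => ?_, ?_⟩
  · rw [coeff_mul]
    exact Finset.sum_eq_zero fun ab hab => by rw [hT ab hab i hi, mul_zero]
  · simp only [coeff_mul]
    rw [Finset.sum_comm]
    refine Finset.sum_congr rfl fun ab hab => ?_
    rw [sum_eq (fun d => ⟨t d, ht d, hs d⟩) ab.2 T (hT ab hab), Finset.mul_sum]

theorem add (h : FSum f s) (h' : FSum g s') : FSum (fun i => f i + g i) (s + s') := by
  classical
  intro d
  obtain ⟨t, ht, hs⟩ := h d
  obtain ⟨t', ht', hs'⟩ := h' d
  refine ⟨t ∪ t', fun i hi => ?_, ?_⟩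
  · rw [Finset.mem_union, not_or] at hi
    rw [map_add, ht i hi.1, ht' i hi.2, add_zero]
  · simp only [map_add, Finset.sum_add_distrib]
    rw [h.sum_eq d (t ∪ t') fun i hi => ht i fun hh => hi (Finset.mem_union_left _ hh),
      h'.sum_eq d (t ∪ t') fun i hi => ht' i fun hh => hi (Finset.mem_union_right _ hh)]

theorem pderiv (h : FSum f s) (e : σ) :
    FSum (fun i => pderiv 𝕜 e (f i)) (MvPowerSeries.pderiv 𝕜 e s) := by
  intro d
  obtain ⟨t, ht, hs⟩ := h (d + Finsupp.single e 1)
  refine ⟨t, fun i hi => by rw [coeff_pderiv, ht i hi, zero_mul], ?_⟩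
  simp only [coeff_pderiv]
  rw [hs, Finset.sum_mul]

theorem sumElim {g : κ → MvPowerSeries σ 𝕜} (h : FSum f s) (h' : FSum g s') :
    FSum (Sum.elim f g) (s + s') := by
  intro d
  obtain ⟨t, ht, hs⟩ := h d
  obtain ⟨t', ht', hs'⟩ := h' d
  refine ⟨t.disjSum t', ?_, by simp [Finset.sum_disjSum, hs, hs']⟩
  rintro (i | i) hi
  · exact ht i fun hh => hi (Finset.inl_mem_disjSum.mpr hh)
  · exact ht' i fun hh => hi (Finset.inr_mem_disjSum.mpr hh)

theorem prod [Fintype κ] {f : κ → ι → MvPowerSeries σ 𝕜} {s : κ → MvPowerSeries σ 𝕜}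
    (h : ∀ k, FSum (f k) (s k)) : FSum (fun x : κ × ι => f x.1 x.2) (∑ k, s k) := by
  classical
  intro d
  choose t ht hs using h
  set T := Finset.univ.biUnion fun k => t k d
  have hT : ∀ k, ∀ i ∉ T, coeff d (f k i) = 0 := fun k i hi =>
    ht _ _ _ fun hh => hi (Finset.mem_biUnion.mpr ⟨k, Finset.mem_univ _, hh⟩)
  refine ⟨Finset.univ ×ˢ T, ?_, ?_⟩
  · rintro ⟨k, i⟩ hi
    exact hT k i fun hh => hi (Finset.mem_product.mpr ⟨Finset.mem_univ _, hh⟩)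
  · rw [Finset.sum_product, map_sum]
    refine Finset.sum_congr rfl fun k _ => ?_
    exact sum_eq (fun d => ⟨t k d, ht k d, hs k d⟩) d T (hT k)

theorem of_succ {f : ℕ → MvPowerSeries σ 𝕜} (h : FSum f s) (h0 : f 0 = 0) :
    FSum (fun k => f (k + 1)) s := by
  classical
  intro d
  obtain ⟨t, ht, hs⟩ := h d
  refine ⟨(t.erase 0).image Nat.pred, fun k hk => ht _ fun hh => hk ?_, ?_⟩
  · exact Finset.mem_image.mpr ⟨k + 1, Finset.mem_erase.mpr ⟨k.succ_ne_zero, hh⟩, rfl⟩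
  · rw [Finset.sum_image, hs]
    · have : ∑ i ∈ t, coeff d (f i) = ∑ i ∈ t.erase 0, coeff d (f i) := by
        refine (Finset.sum_subset (Finset.erase_subset 0 t) fun i hi hi' => ?_).symm
        have : i = 0 := by
          by_contra h0
          exact hi' (Finset.mem_erase.mpr ⟨h0, hi⟩)
        rw [this, h0, map_zero]
      rw [this]
      refine Finset.sum_congr rfl fun i hi => ?_
      obtain ⟨k, rfl⟩ := Nat.exists_eq_succ_of_ne_zero (Finset.ne_of_mem_erase hi)
      rfl
    · intro a ha b hb hab
      have ha' := Finset.ne_of_mem_erase (Finset.mem_coe.mp ha)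
      have hb' := Finset.ne_of_mem_erase (Finset.mem_coe.mp hb)
      simp only [Nat.pred_eq_sub_one] at hab
      omega

theorem of_equiv (e : κ ≃ ι) (h : FSum f s) : FSum (fun k => f (e k)) s := by
  classical
  intro d
  obtain ⟨t, ht, hs⟩ := h d
  refine ⟨t.map e.symm.toEmbedding, fun k hk => ht _ fun hh => hk ?_, ?_⟩
  · simpa using hh
  · rw [hs, Finset.sum_map]
    simp

theorem congr (h : FSum f s) (hfg : ∀ i, f i = g i) : FSum g s := by
  rwa [show g = f from funext fun i => (hfg i).symm]

theorem constantCoeff (h : FSum f s) (h0 : ∀ i, MvPowerSeries.constantCoeff (f i) = 0) :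
    MvPowerSeries.constantCoeff s = 0 := by
  obtain ⟨t, -, hs⟩ := h 0
  simp only [coeff_zero_eq_constantCoeff_apply] at hs
  rw [hs, Finset.sum_eq_zero fun i _ => h0 i]

end FSum

/-- The order of `aʳ` is at least `r`; this is the source of all convergence of formal sums below.
-/
theorem coeff_pow_mul_eq_zero {a : MvPowerSeries σ 𝕜} (ha : constantCoeff a = 0)
    (b : MvPowerSeries σ 𝕜) {d : σ →₀ ℕ} {r : ℕ} (h : d.degree < r) :
    coeff d (a ^ r * b) = 0 := by
  apply coeff_of_lt_order
  have h1 : (r : ℕ∞) ≤ (a ^ r).order := le_order_pow_of_constantCoeff_eq_zero r ha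
  have h2 : (a ^ r).order + b.order ≤ (a ^ r * b).order := le_order_mul
  exact lt_of_lt_of_le (by exact_mod_cast h) (h1.trans (le_self_add.trans h2))

/-- A series `∑ aʳ bᵣ` converges when `a` has no constant term. -/
theorem finite_coeff_pow_mul {a : MvPowerSeries σ 𝕜} (ha : constantCoeff a = 0)
    (e : ι → ℕ) (he : Function.Injective e) (b : ι → MvPowerSeries σ 𝕜) (d : σ →₀ ℕ) :
    {i | coeff d (a ^ e i * b i) ≠ 0}.Finite := by
  refine ((Set.finite_Iic d.degree).preimage he.injOn).subset fun i hi => ?_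
  by_contra h
  exact hi (coeff_pow_mul_eq_zero ha _ (not_le.mp h))

end FormalSums

/-! ### Exponentials of power series, characterized by linear differential equations -/

section Exponential

open MvPowerSeries

variable {σ 𝕜 ι : Type} [Field 𝕜] [CharZero 𝕜]

/-- The exponential of a power series without constant term. -/
def rexp (E : MvPowerSeries σ 𝕜) : MvPowerSeries σ 𝕜 := (PowerSeries.exp 𝕜).subst E

theorem rexp_fsum {E : MvPowerSeries σ 𝕜} (hE : constantCoeff E = 0) :
    FSum (fun k : ℕ => C ((k.factorial : 𝕜)⁻¹) * E ^ k) (rexp E) := by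
  have hs := PowerSeries.HasSubst.of_constantCoeff_zero hE
  have key : ∀ d (k : ℕ), PowerSeries.coeff k (PowerSeries.exp 𝕜) • coeff d (E ^ k) =
      coeff d (C ((k.factorial : 𝕜)⁻¹) * E ^ k) := by
    intro d k
    rw [coeff_C_mul, PowerSeries.coeff_exp, smul_eq_mul]
    simp
  have h := FSum.of_finite (f := fun k : ℕ => C ((k.factorial : 𝕜)⁻¹) * E ^ k) (fun d => by
    have := PowerSeries.coeff_subst_finite hs (PowerSeries.exp 𝕜) d
    simp only [key] at this
    exact this)
  have e : rexp E = fun d => ∑ᶠ k : ℕ, coeff d (C ((k.factorial : 𝕜)⁻¹) * E ^ k) := by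
    funext d
    have := PowerSeries.coeff_subst hs (PowerSeries.exp 𝕜) d
    simp only [key] at this
    exact this
  rw [e]
  exact h

theorem rexp_zero : rexp (0 : MvPowerSeries σ 𝕜) = 1 := by
  refine (rexp_fsum (map_zero _)).unique fun d => ⟨{0}, fun i hi => ?_, by simp⟩
  change coeff d (C _ * 0 ^ i) = 0
  rw [zero_pow (by simpa using hi), mul_zero, map_zero]

theorem constantCoeff_rexp {E : MvPowerSeries σ 𝕜} (hE : constantCoeff E = 0) :
    constantCoeff (rexp E) = 1 := by
  have := (rexp_fsum hE).sum_eq 0 {0} fun i hi => by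
    rw [coeff_zero_eq_constantCoeff_apply, map_mul, map_pow, hE, zero_pow (by simpa using hi),
      mul_zero]
  simpa using this

/-- `exp E - 1` is divisible by any divisor of `E`. -/
theorem rexp_mul_left {a b : MvPowerSeries σ 𝕜} (ha : constantCoeff a = 0) :
    ∃ y, rexp (a * b) = 1 + a * y := by
  have hab : constantCoeff (a * b) = 0 := by rw [map_mul, ha, zero_mul]
  set g : ℕ → MvPowerSeries σ 𝕜 := fun k =>
    C (((k + 1).factorial : 𝕜)⁻¹) * (a ^ k * b ^ (k + 1)) with hg
  have hfin : ∀ d, {k | coeff d (g k) ≠ 0}.Finite := by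
    intro d
    refine (finite_coeff_pow_mul ha id Function.injective_id (fun k => b ^ (k + 1)) d).subset
      fun k hk => ?_
    intro h0
    apply hk
    change coeff d (C _ * _) = 0
    rw [coeff_C_mul]
    exact mul_eq_zero_of_right _ h0
  refine ⟨fun d => ∑ᶠ k, coeff d (g k), FSum.unique (rexp_fsum hab) ?_⟩
  have h1 := (FSum.of_finite hfin).mul_left a
  intro d
  obtain ⟨t, ht, hs⟩ := h1 d
  classical
  have e : ∀ k, C (((k + 1).factorial : 𝕜)⁻¹) * (a * b) ^ (k + 1) = a * g k := fun k => by
    simp only [hg]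
    ring
  refine ⟨insert 0 (t.map ⟨Nat.succ, Nat.succ_injective⟩), fun i hi => ?_, ?_⟩
  · rw [Finset.mem_insert, not_or] at hi
    obtain ⟨k, rfl⟩ := Nat.exists_eq_succ_of_ne_zero hi.1
    change coeff d (C (((k + 1).factorial : 𝕜)⁻¹) * (a * b) ^ (k + 1)) = 0
    rw [e]
    exact ht k fun hh => hi.2 (Finset.mem_map.mpr ⟨k, hh, rfl⟩)
  · rw [Finset.sum_insert (by simp), Finset.sum_map, map_add, hs]
    simp [e]

theorem pderiv_rexp {E : MvPowerSeries σ 𝕜} (hE : constantCoeff E = 0) (i : σ) :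
    pderiv 𝕜 i (rexp E) = pderiv 𝕜 i E * rexp E := by
  have h := ((rexp_fsum hE).pderiv i).of_succ (by simp)
  refine h.unique (((rexp_fsum hE).mul_left (pderiv 𝕜 i E)).congr fun k => ?_)
  rw [Derivation.leibniz, pderiv_C, smul_zero, add_zero, pderiv_pow, smul_eq_mul,
    Nat.add_sub_cancel]
  have : (C (((k + 1).factorial : 𝕜)⁻¹) * ((k + 1 : ℕ) : MvPowerSeries σ 𝕜)) =
      C ((k.factorial : 𝕜)⁻¹) := by
    rw [← map_natCast (C (σ := σ) (R := 𝕜)), ← map_mul]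
    congr 1
    have h1 : ((k + 1 : ℕ) : 𝕜) ≠ 0 := Nat.cast_ne_zero.mpr k.succ_ne_zero
    have h2 : (k.factorial : 𝕜) ≠ 0 := Nat.cast_ne_zero.mpr k.factorial_ne_zero
    rw [Nat.factorial_succ, Nat.cast_mul]
    field_simp
  rw [← this]
  ring

/-- Uniqueness for first order linear differential equations. -/
theorem eq_of_pderiv_eq_mul {f g : MvPowerSeries σ 𝕜} (h : σ → MvPowerSeries σ 𝕜)
    (hf : ∀ i, pderiv 𝕜 i f = h i * f) (hg : ∀ i, pderiv 𝕜 i g = h i * g)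
    (hf1 : constantCoeff f = 1) (hg1 : constantCoeff g = 1) : f = g := by
  have hg0 : constantCoeff g ≠ 0 := by rw [hg1]; exact one_ne_zero
  have hgg : g⁻¹ * g = 1 := MvPowerSeries.inv_mul_cancel g hg0
  -- The quotient has vanishing partial derivatives and constant term `1`; characteristic zero makes
  -- it constant.
  have key : f * g⁻¹ = 1 := by
    apply pderiv.ext
    · intro i
      rw [Derivation.leibniz, pderiv_inv', hf, hg, pderiv_one, smul_eq_mul, smul_eq_mul]
      linear_combination (-(f * h i * g⁻¹)) * hgg
    · rw [map_mul, constantCoeff_inv, hf1, hg1, map_one]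
      simp
  calc f = f * (g⁻¹ * g) := by rw [hgg, mul_one]
    _ = f * g⁻¹ * g := by ring
    _ = g := by rw [key, one_mul]

/-- Both sides solve the equations `∂ᵢ y = ∂ᵢ(E + F) y` with constant term `1`. -/
theorem rexp_add {E F : MvPowerSeries σ 𝕜} (hE : constantCoeff E = 0) (hF : constantCoeff F = 0) :
    rexp (E + F) = rexp E * rexp F := by
  have hEF : constantCoeff (E + F) = 0 := by rw [map_add, hE, hF, add_zero]
  refine eq_of_pderiv_eq_mul (fun i => pderiv 𝕜 i (E + F)) (fun i => pderiv_rexp hEF i)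
    (fun i => ?_) (constantCoeff_rexp hEF) ?_
  · rw [Derivation.leibniz, pderiv_rexp hE, pderiv_rexp hF, map_add, smul_eq_mul, smul_eq_mul]
    ring
  · rw [map_mul, constantCoeff_rexp hE, constantCoeff_rexp hF, one_mul]

theorem rexp_sum {E : ι → MvPowerSeries σ 𝕜} (s : Finset ι)
    (hE : ∀ i ∈ s, constantCoeff (E i) = 0) : rexp (∑ i ∈ s, E i) = ∏ i ∈ s, rexp (E i) := by
  classical
  induction s using Finset.induction_on with
  | empty => simp [rexp_zero]
  | insert a s ha ih =>
    have h' : ∀ i ∈ s, constantCoeff (E i) = 0 := fun i hi => hE i (Finset.mem_insert_of_mem hi)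
    rw [Finset.sum_insert ha, Finset.prod_insert ha, rexp_add (hE a (Finset.mem_insert_self _ _))
      (by rw [map_sum]; exact Finset.sum_eq_zero h'), ih h']

/-- `∑ₙ ∏ₚ c_P^{n_P} / n_P! = exp (∑ₚ c_P)`, for infinitely many `c_P`. -/
theorem fsum_prod_pow_div_factorial {P : Type} {c : P → MvPowerSeries σ 𝕜}
    {s : MvPowerSeries σ 𝕜} (h : FSum c s) (h0 : ∀ i, constantCoeff (c i) = 0) :
    FSum (fun n : P →₀ ℕ => n.prod fun i k => C ((k.factorial : 𝕜)⁻¹) * c i ^ k) (rexp s) := by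
  classical
  have hc : HasSubst c := ⟨fun i => by rw [h0]; exact IsNilpotent.zero, h.finite⟩
  -- The universal case: `S` is the sum of infinitely many independent variables, one for each
  -- index. The identity is proved for them and then specialized by substituting the `c_P`.
  set S : MvPowerSeries P 𝕜 := fun d => if d.degree = 1 then 1 else 0 with hS
  have hcoeffS : ∀ d : P →₀ ℕ, coeff d S = if d.degree = 1 then 1 else 0 := fun n => rfl
  have hS0 : constantCoeff S = 0 := by
    rw [← coeff_zero_eq_constantCoeff_apply, hcoeffS, map_zero, if_neg zero_ne_one]
  set e : MvPowerSeries P 𝕜 := fun n => n.prod fun _ k => (k.factorial : 𝕜)⁻¹ with he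
  have hcoeffe : ∀ n, coeff n e = n.prod fun _ k => (k.factorial : 𝕜)⁻¹ := fun n => rfl
  have hpS : ∀ i, pderiv 𝕜 i S = 1 := by
    intro i
    ext d
    rw [coeff_pderiv, hcoeffS, coeff_one, map_add, Finsupp.degree_single]
    by_cases hd : d = 0
    · subst hd; simp
    · have : d.degree ≠ 0 := fun h => hd ((Finsupp.degree_eq_zero_iff d).mp h)
      rw [if_neg (by omega), if_neg hd, zero_mul]
  have hee : e = rexp S := by
    refine eq_of_pderiv_eq_mul (fun _ => 1) (fun i => ?_)
      (fun i => by rw [pderiv_rexp hS0, hpS]) ?_ (constantCoeff_rexp hS0)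
    · ext n
      rw [coeff_pderiv, one_mul, hcoeffe, hcoeffe]
      have h1 : (n + Finsupp.single i 1).prod (fun _ k => (k.factorial : 𝕜)⁻¹) =
          (((n i + 1).factorial : 𝕜)⁻¹) *
            (n.erase i).prod (fun _ k => (k.factorial : 𝕜)⁻¹) := by
        rw [← Finsupp.mul_prod_erase' _ i _ (by simp)]
        congr 2
        · simp
        · ext j
          by_cases hj : j = i
          · subst hj; simp
          · simp [Finsupp.erase_ne hj]
      have h2 : n.prod (fun _ k => (k.factorial : 𝕜)⁻¹) =
          (((n i).factorial : 𝕜)⁻¹) * (n.erase i).prod (fun _ k => (k.factorial : 𝕜)⁻¹) := by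
        rw [← Finsupp.mul_prod_erase' n i _ (by simp)]
      rw [h1, h2, Nat.factorial_succ]
      have h3 : ((n i + 1 : ℕ) : 𝕜) ≠ 0 := Nat.cast_ne_zero.mpr (n i).succ_ne_zero
      have h4 : ((n i).factorial : 𝕜) ≠ 0 := Nat.cast_ne_zero.mpr (n i).factorial_ne_zero
      push_cast at h3 ⊢
      field_simp
    · rw [← coeff_zero_eq_constantCoeff_apply, hcoeffe]
      simp
  have hsS : S.subst c = s := by
    refine FSum.unique (f := c) ?_ h
    intro d
    obtain ⟨t, ht, -⟩ := h d
    refine ⟨t, ht, ?_⟩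
    rw [coeff_subst hc]
    have hterm : ∀ i, coeff (Finsupp.single i 1) S •
        coeff d ((Finsupp.single i 1).prod fun s e => c s ^ e) = coeff d (c i) := fun i => by
      simp [hcoeffS]
    rw [finsum_eq_sum_of_support_subset (s := t.map ⟨fun i => Finsupp.single i 1,
      fun i j hij => (Finsupp.single_left_inj one_ne_zero).mp hij⟩), Finset.sum_map]
    · exact Finset.sum_congr rfl fun i _ => hterm i
    · intro n hn
      have hn1 : n.degree = 1 := by
        by_contra h1
        apply hn
        simp [hcoeffS, h1]
      obtain ⟨i, rfl⟩ : ∃ i, n = Finsupp.single i 1 := by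
        have : n ∈ Set.range fun i : P => Finsupp.single i 1 := by
          rw [Finsupp.range_single_one]
          exact hn1
        obtain ⟨i, hi⟩ := this
        exact ⟨i, hi.symm⟩
      rw [Function.mem_support, hterm] at hn
      simp only [Finset.coe_map, Set.mem_image]
      refine ⟨i, ?_, rfl⟩
      by_contra hit
      exact hn (ht i hit)
  have hes : e.subst c = rexp s := by
    have hS' := PowerSeries.HasSubst.of_constantCoeff_zero hS0
    rw [hee, ← hsS]
    exact subst_comp_subst_apply (R := 𝕜) hS'.const hc (PowerSeries.exp 𝕜)
  rw [← hes]
  have key : ∀ (d : σ →₀ ℕ) (n : P →₀ ℕ), coeff n e • coeff d (n.prod fun i k => c i ^ k) =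
      coeff d (n.prod fun i k => C ((k.factorial : 𝕜)⁻¹) * c i ^ k) := by
    intro d n
    rw [Finsupp.prod_mul, smul_eq_mul, ← coeff_C_mul, hcoeffe]
    simp only [Finsupp.prod, map_prod]
  have hfin := FSum.of_finite
    (f := fun n : P →₀ ℕ => n.prod fun i k => C ((k.factorial : 𝕜)⁻¹) * c i ^ k) (fun d => by
      have := coeff_subst_finite hc e d
      simp only [key] at this
      exact this)
  have e' : e.subst c = fun d => ∑ᶠ n : P →₀ ℕ,
      coeff d (n.prod fun i k => C ((k.factorial : 𝕜)⁻¹) * c i ^ k) := by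
    funext d
    have := coeff_subst hc e d
    simp only [key] at this
    exact this
  rw [e']
  exact hfin

end Exponential

/-! ## Elliptic logarithms -/

section EllipticLog

open MvPowerSeries

variable {σ 𝕜 : Type} [Field 𝕜]

/-- `∑ᵣ τ_r aʳ / (r (1 - pʳ))`. -/
def ellLog (p : MvPowerSeries σ 𝕜) (τ : ℕ+ → 𝕜) (a : MvPowerSeries σ 𝕜) : MvPowerSeries σ 𝕜 :=
  fun d => ∑ᶠ r : ℕ+, coeff d (a ^ (r : ℕ) * (C (τ r / (r : ℕ)) * (1 - p ^ (r : ℕ))⁻¹))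

variable {p : MvPowerSeries σ 𝕜} {a : MvPowerSeries σ 𝕜}

theorem ellLog_fsum (p : MvPowerSeries σ 𝕜) (τ : ℕ+ → 𝕜) (ha : constantCoeff a = 0) :
    FSum (fun r : ℕ+ => a ^ (r : ℕ) * (C (τ r / (r : ℕ)) * (1 - p ^ (r : ℕ))⁻¹))
      (ellLog p τ a) :=
  FSum.of_finite fun d => finite_coeff_pow_mul ha (fun r : ℕ+ => (r : ℕ)) PNat.coe_injective _ d

theorem constantCoeff_ellLog (p : MvPowerSeries σ 𝕜) (τ : ℕ+ → 𝕜) (ha : constantCoeff a = 0) :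
    constantCoeff (ellLog p τ a) = 0 :=
  (ellLog_fsum p τ ha).constantCoeff fun r => by
    rw [map_mul, map_pow, ha, zero_pow r.ne_zero, zero_mul]

theorem ellLog_add (p : MvPowerSeries σ 𝕜) (τ τ' : ℕ+ → 𝕜) (ha : constantCoeff a = 0) :
    ellLog p (τ + τ') a = ellLog p τ a + ellLog p τ' a := by
  refine (ellLog_fsum p _ ha).unique (((ellLog_fsum p τ ha).add (ellLog_fsum p τ' ha)).congr
    fun r => ?_)
  rw [Pi.add_apply, add_div, map_add]
  ring

theorem ellLog_smul (p : MvPowerSeries σ 𝕜) (c : 𝕜) (τ : ℕ+ → 𝕜) (ha : constantCoeff a = 0) :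
    ellLog p (c • τ) a = C c * ellLog p τ a := by
  refine (ellLog_fsum p _ ha).unique (((ellLog_fsum p τ ha).mul_left (C c)).congr fun r => ?_)
  rw [Pi.smul_apply, smul_eq_mul, mul_div_assoc, map_mul]
  ring

theorem ellLog_neg (p : MvPowerSeries σ 𝕜) (τ : ℕ+ → 𝕜) (ha : constantCoeff a = 0) :
    ellLog p (-τ) a = -ellLog p τ a := by
  have := ellLog_smul p (-1) τ ha
  rw [neg_one_smul, map_neg, map_one, neg_one_mul] at this
  exact this

theorem ellLog_zero (p : MvPowerSeries σ 𝕜) (ha : constantCoeff a = 0) :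
    ellLog p 0 a = 0 := by
  have := ellLog_smul p 0 0 ha
  rwa [zero_smul, map_zero, zero_mul] at this

theorem ellLog_sum {κ : Type} (p : MvPowerSeries σ 𝕜) (s : Finset κ) (τ : κ → ℕ+ → 𝕜)
    (ha : constantCoeff a = 0) : ellLog p (∑ k ∈ s, τ k) a = ∑ k ∈ s, ellLog p (τ k) a := by
  classical
  induction s using Finset.induction_on with
  | empty => simp [ellLog_zero p ha]
  | insert k s hk ih => rw [Finset.sum_insert hk, Finset.sum_insert hk, ellLog_add p _ _ ha, ih]

/-- `∑ᵣ zʳ aʳ / (r (1 - pʳ))` as a function of `z a`. -/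
theorem ellLog_pow (p : MvPowerSeries σ 𝕜) (z : 𝕜) (ha : constantCoeff a = 0) :
    ellLog p (fun r => z ^ (r : ℕ)) a = ellLog p 1 (C z * a) := by
  have ha' : constantCoeff (C z * a) = 0 := by rw [map_mul, ha, mul_zero]
  refine (ellLog_fsum p _ ha).unique ((ellLog_fsum p 1 ha').congr fun r => ?_)
  rw [mul_pow, ← map_pow, Pi.one_apply, div_eq_mul_one_div (z ^ (r : ℕ)), map_mul]
  ring

/-- Every term of the series at `b a` contains `b`. For `b = p^K` this makes the tail of the theta
product equal to `1` modulo `p^K`. -/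
theorem ellLog_mul (b : MvPowerSeries σ 𝕜) (ha : constantCoeff a = 0) :
    ∃ y, ellLog p 1 (b * a) = b * y := by
  have hba : constantCoeff (b * a) = 0 := by rw [map_mul, ha, mul_zero]
  have h := FSum.of_finite fun d => finite_coeff_pow_mul ha (fun r : ℕ+ => (r : ℕ))
    PNat.coe_injective
    (fun r : ℕ+ => (b : MvPowerSeries σ 𝕜) ^ ((r : ℕ) - 1) * (C (1 / (r : ℕ) : 𝕜) * (1 - p ^ (r : ℕ))⁻¹)) d
  refine ⟨_, (ellLog_fsum p 1 hba).unique ((h.mul_left b).congr fun r => ?_)⟩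
  obtain ⟨k, hk⟩ := Nat.exists_eq_succ_of_ne_zero r.ne_zero
  rw [hk, Nat.succ_eq_add_one, Nat.add_sub_cancel, Pi.one_apply, mul_pow]
  ring

variable [CharZero 𝕜]

/-- `exp (-∑ᵣ aʳ / r) = 1 - a`. -/
theorem rexp_neg_log {E : MvPowerSeries σ 𝕜} (ha : constantCoeff a = 0)
    (hE : FSum (fun r : ℕ => a ^ (r + 1) * C ((r + 1 : 𝕜)⁻¹)) E) : rexp (-E) = 1 - a := by
  have hE0 : constantCoeff E = 0 := hE.constantCoeff fun r => by
    rw [map_mul, map_pow, ha, zero_pow r.succ_ne_zero, zero_mul]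
  have hE0' : constantCoeff (-E) = 0 := by rw [map_neg, hE0, neg_zero]
  have h1 : constantCoeff (1 - a) = 1 := by rw [map_sub, map_one, ha, sub_zero]
  -- Differentiating the logarithm term by term leaves the geometric series, so `exp(-E)` satisfies
  -- the differential equation of `1 - a`.
  have hgeom : FSum (fun r : ℕ => a ^ r) (1 - a)⁻¹ := by
    have hf : FSum (fun r : ℕ => a ^ r) _ := FSum.of_finite fun d => by
      simpa using finite_coeff_pow_mul ha id Function.injective_id (fun _ => 1) d
    set s : MvPowerSeries σ 𝕜 := fun d => ∑ᶠ r : ℕ, coeff d (a ^ r) with hs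
    have h2 : a * s + 1 = s := by
      refine FSum.unique (f := fun r : ℕ => a ^ r) ?_ hf
      intro d
      classical
      obtain ⟨t, ht, hs⟩ := hf.mul_left a d
      refine ⟨insert 0 (t.map ⟨Nat.succ, Nat.succ_injective⟩), fun i hi => ?_, ?_⟩
      · rw [Finset.mem_insert, not_or] at hi
        obtain ⟨k, rfl⟩ := Nat.exists_eq_succ_of_ne_zero hi.1
        change coeff d (a ^ (k + 1)) = 0
        rw [pow_succ']
        exact ht k fun hh => hi.2 (Finset.mem_map.mpr ⟨k, hh, rfl⟩)
      · rw [Finset.sum_insert (by simp), Finset.sum_map, map_add, hs, add_comm]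
        simp [pow_succ']
    have h3 : s * (1 - a) = 1 := by linear_combination -h2
    have : s = (1 - a)⁻¹ := by
      rw [MvPowerSeries.eq_inv_iff_mul_eq_one (by rw [h1]; exact one_ne_zero)]
      exact h3
    rwa [← this]
  have hd : ∀ i, pderiv 𝕜 i E = pderiv 𝕜 i a * (1 - a)⁻¹ := by
    intro i
    refine (hE.pderiv i).unique ((hgeom.mul_left (pderiv 𝕜 i a)).congr fun r => ?_)
    rw [Derivation.leibniz, pderiv_C, smul_zero, zero_add, pderiv_pow, smul_eq_mul,
      Nat.add_sub_cancel]
    have : (C ((r + 1 : 𝕜)⁻¹) * ((r + 1 : ℕ) : MvPowerSeries σ 𝕜)) = 1 := by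
      rw [← map_natCast (C (σ := σ) (R := 𝕜)), ← map_mul, Nat.cast_add_one, inv_mul_cancel₀,
        map_one]
      exact_mod_cast r.succ_ne_zero
    linear_combination (-(a ^ r * pderiv 𝕜 i a)) * this
  refine eq_of_pderiv_eq_mul (fun i => -(pderiv 𝕜 i a * (1 - a)⁻¹)) (fun i => ?_) (fun i => ?_)
    (constantCoeff_rexp hE0') h1
  · rw [pderiv_rexp hE0', map_neg, hd]
  · rw [map_sub, pderiv_one, zero_sub, neg_mul, mul_assoc,
      MvPowerSeries.inv_mul_cancel _ (by rw [h1]; exact one_ne_zero), mul_one]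

/-- The functional equation `Φ(a) = (1 - a) Φ(p a)` of `Φ(a) = exp (-∑ᵣ aʳ / (r (1 - pʳ)))`. -/
theorem rexp_neg_ellLog_step (hp : constantCoeff p = 0) (ha : constantCoeff a = 0) :
    rexp (-ellLog p 1 a) = (1 - a) * rexp (-ellLog p 1 (p * a)) := by
  have hpa : constantCoeff (p * a) = 0 := by rw [map_mul, ha, mul_zero]
  set E : MvPowerSeries σ 𝕜 := ellLog p 1 a - ellLog p 1 (p * a) with hE
  -- Subtracting the series at `p a` multiplies the `r`-th term by `1 - pʳ`, which cancels the
  -- denominator and leaves the ordinary logarithm.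
  have hsum : FSum (fun r : ℕ => a ^ (r + 1) * C ((r + 1 : 𝕜)⁻¹)) E := by
    have h1 := (ellLog_fsum p 1 ha).add ((ellLog_fsum p 1 hpa).mul_left (-1))
    have h2 := h1.of_equiv Equiv.pnatEquivNat.symm
    rw [neg_one_mul, ← sub_eq_add_neg] at h2
    refine h2.congr fun r => ?_
    have hr : ((Equiv.pnatEquivNat.symm r : ℕ+) : ℕ) = r + 1 := rfl
    have hc : constantCoeff (1 - p ^ (r + 1)) ≠ 0 := by
      rw [map_sub, map_one, map_pow, hp, zero_pow r.succ_ne_zero, sub_zero]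
      exact one_ne_zero
    have := MvPowerSeries.inv_mul_cancel _ hc
    rw [hr, Pi.one_apply, one_div, mul_pow, Nat.cast_add_one]
    linear_combination (a ^ (r + 1) * C ((r + 1 : 𝕜)⁻¹)) * this
  have h0 := constantCoeff_ellLog p 1 ha
  have h0' := constantCoeff_ellLog p 1 hpa
  rw [← rexp_neg_log ha hsum, ← rexp_add (by rw [hE, map_neg, map_sub, h0, h0', sub_zero, neg_zero])
    (by rw [map_neg, h0', neg_zero])]
  congr 1
  rw [hE]
  ring

/-- Iterating the functional equation peels off the first `K` factors of `∏ (1 - p^k a)`. -/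
theorem rexp_neg_ellLog (hp : constantCoeff p = 0) (ha : constantCoeff a = 0) (K : ℕ) :
    rexp (-ellLog p 1 a) =
      (∏ k ∈ Finset.range K, (1 - p ^ k * a)) * rexp (-ellLog p 1 (p ^ K * a)) := by
  induction K with
  | zero => simp
  | succ K ih =>
    have : constantCoeff (p ^ K * a) = 0 := by rw [map_mul, ha, mul_zero]
    rw [ih, Finset.prod_range_succ, rexp_neg_ellLog_step hp this, ← mul_assoc p, ← pow_succ']
    ring

theorem rexp_neg_ellLog_pow_mul (hp : constantCoeff p = 0) (ha : constantCoeff a = 0) {K : ℕ}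
    (hK : K ≠ 0) : ∃ y, rexp (-ellLog p 1 (p ^ K * a)) = 1 + p ^ K * y := by
  obtain ⟨y, hy⟩ := ellLog_mul (p := p) (p ^ K) ha
  rw [hy, neg_mul_eq_mul_neg]
  exact rexp_mul_left (by rw [map_pow, hp, zero_pow hK])

end EllipticLog

/-! ## Power series in `p` and the ratios of the variables -/

section Iota

variable {m : ℕ}

/-- Power series in `s_k = z_{k+1} / z_k` (with `s_{m-1} = 1 / z_{m-1}`) and
`p̂ = p / ∏ s_k = p z₀`; the index `none` stands for `p̂`. -/
abbrev RatioSeries (m : ℕ) : Type := MvPowerSeries (Option (Fin m)) ℂ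

/-- The predecessor of the index `k`. -/
def prevIdx (k : Fin m) : Option (Fin m) :=
  if h : (k : ℕ) = 0 then none else some ⟨k - 1, by omega⟩

/-- The exponent of `z` in a monomial in the `s_k` and `p̂`. -/
def zExp (d : Option (Fin m) →₀ ℕ) : Lex (Fin m → ℤ) :=
  toLex fun k => (d (some k) : ℤ) - d (prevIdx k)

theorem zExp_add (d e : Option (Fin m) →₀ ℕ) : zExp (d + e) = zExp d + zExp e := by
  apply ofLex.injective
  funext k
  change ((d + e) (some k) : ℤ) - (d + e) (prevIdx k) =
    ((d (some k) : ℤ) - d (prevIdx k)) + ((e (some k) : ℤ) - e (prevIdx k))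
  simp only [Finsupp.add_apply, Nat.cast_add]
  ring

theorem zExp_zero : zExp (0 : Option (Fin m) →₀ ℕ) = 0 := by
  apply ofLex.injective
  funext k
  change ((0 : ℕ) : ℤ) - (0 : ℕ) = 0
  simp

/-- The exponent of `z` records the successive differences of the exponents of `p̂, s_0, s_1, …`;
starting from that of `p̂`, which is the power of `p`, all the others are recovered. -/
theorem zExp_injective {d e : Option (Fin m) →₀ ℕ} (h0 : d none = e none) (h : zExp d = zExp e) :
    d = e := by
  have h' : ∀ k : Fin m, (d (some k) : ℤ) - d (prevIdx k) = (e (some k) : ℤ) - e (prevIdx k) :=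
    fun k => congrFun (toLex.injective h) k
  have key : ∀ (a : ℕ) (ha : a < m), d (some ⟨a, ha⟩) = e (some ⟨a, ha⟩) := by
    intro a
    induction a with
    | zero =>
      intro ha
      have := h' ⟨0, ha⟩
      simp only [prevIdx, dite_true] at this
      omega
    | succ a ih =>
      intro ha
      have := h' ⟨a + 1, ha⟩
      have hp : prevIdx (⟨a + 1, ha⟩ : Fin m) = some ⟨a, by omega⟩ := by simp [prevIdx]
      rw [hp, ih] at this
      omega
  ext (_ | k)
  · exact h0
  · exact key k k.2

/-- Without `p̂`, the first nonzero entry of the exponent is that of the first `s_k` that occurs,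
and it is positive. This expresses `|z₁| > ⋯ > |zₘ|` in the lexicographic order. -/
theorem zExp_nonneg {d : Option (Fin m) →₀ ℕ} (h0 : d none = 0) : 0 ≤ zExp d := by
  classical
  by_cases hd : ∃ k : Fin m, d (some k) ≠ 0
  · have hne : (Finset.univ.filter fun k : Fin m => d (some k) ≠ 0).Nonempty := by
      obtain ⟨k, hk⟩ := hd
      exact ⟨k, by simpa using hk⟩
    set k := (Finset.univ.filter fun k : Fin m => d (some k) ≠ 0).min' hne with hk
    have hkd : d (some k) ≠ 0 := by
      have := Finset.min'_mem _ hne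
      exact (Finset.mem_filter.mp this).2
    have hlt : ∀ j : Fin m, j < k → d (some j) = 0 := by
      intro j hj
      by_contra hne'
      exact absurd (Finset.min'_le _ j (by simpa using hne')) (not_le.mpr hj)
    have hprev : ∀ j : Fin m, j ≤ k → d (prevIdx j) = 0 := by
      intro j hj
      unfold prevIdx
      split_ifs with h
      · exact h0
      · apply hlt
        rw [Fin.lt_def]
        have : (j : ℕ) ≤ k := hj
        simp only
        omega
    refine le_of_lt ⟨k, fun j hj => ?_, ?_⟩
    · change (0 : ℤ) = (d (some j) : ℤ) - d (prevIdx j)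
      rw [hlt j hj, hprev j (le_of_lt hj)]
      simp
    · change (0 : ℤ) < (d (some k) : ℤ) - d (prevIdx k)
      rw [hprev k le_rfl]
      have := Nat.pos_of_ne_zero hkd
      omega
  · have hd' : ∀ k : Fin m, d (some k) = 0 := by
      intro k
      by_contra h
      exact hd ⟨k, h⟩
    have : d = 0 := by
      ext (_ | k)
      · exact h0
      · exact hd' k
    rw [this, zExp_zero]

theorem zExp_mono {d e : Option (Fin m) →₀ ℕ} (h0 : d none = e none) (h : d ≤ e) :
    zExp d ≤ zExp e := by
  obtain ⟨δ, rfl⟩ := exists_add_of_le h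
  rw [zExp_add]
  apply le_add_of_nonneg_right
  apply zExp_nonneg
  rw [Finsupp.add_apply] at h0
  omega

/-- Exponents in finitely many variables are well-quasi-ordered (Dickson's lemma), and `zExp` is
monotone at a fixed power of `p`. Hence every power series in the ratios expands to a legitimate
Hahn series. -/
theorem isPWO_zExp (N : ℕ) : (zExp '' {d : Option (Fin m) →₀ ℕ | d none = N}).IsPWO :=
  Set.IsPWO.image_of_monotoneOn (Set.isPWO_of_wellQuasiOrderedLE _) fun _ hd _ he h =>
    zExp_mono (Eq.trans hd (Eq.symm he)) h

open Classical in
/-- The coefficient of `p^N` times the `z`-monomial with exponent `v`. -/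
def expandCoeff (f : RatioSeries m) (N : ℕ) (v : Lex (Fin m → ℤ)) : ℂ :=
  if h : ∃ d : Option (Fin m) →₀ ℕ, d none = N ∧ zExp d = v then
    MvPowerSeries.coeff h.choose f else 0

theorem expandCoeff_eq (f : RatioSeries m) (d : Option (Fin m) →₀ ℕ) :
    expandCoeff f (d none) (zExp d) = MvPowerSeries.coeff d f := by
  have h : ∃ e : Option (Fin m) →₀ ℕ, e none = d none ∧ zExp e = zExp d := ⟨d, rfl, rfl⟩
  rw [expandCoeff, dif_pos h, zExp_injective h.choose_spec.1 h.choose_spec.2]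

theorem expandCoeff_eq_zero (f : RatioSeries m) {N : ℕ} {v : Lex (Fin m → ℤ)}
    (h : ¬∃ d : Option (Fin m) →₀ ℕ, d none = N ∧ zExp d = v) : expandCoeff f N v = 0 :=
  dif_neg h

theorem exists_of_expandCoeff_ne_zero {f : RatioSeries m} {N : ℕ} {v : Lex (Fin m → ℤ)}
    (h : expandCoeff f N v ≠ 0) : ∃ d : Option (Fin m) →₀ ℕ, d none = N ∧ zExp d = v := by
  by_contra h'
  exact h (expandCoeff_eq_zero f h')

/-- The coefficient of `p^N`. -/
def expandRow (f : RatioSeries m) (N : ℕ) : ZSeries m where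
  coeff := expandCoeff f N
  isPWO_support' := (isPWO_zExp N).mono fun _ hv => by
    obtain ⟨d, h1, h2⟩ := exists_of_expandCoeff_ne_zero hv
    exact ⟨d, h1, h2⟩

theorem expandRow_mul (f g : RatioSeries m) (N : ℕ) :
    expandRow (f * g) N = ∑ x ∈ Finset.HasAntidiagonal.antidiagonal N,
      expandRow f x.1 * expandRow g x.2 := by
  classical
  ext v
  rw [HahnSeries.coeff_sum]
  simp only [HahnSeries.coeff_mul]
  by_cases h : ∃ d : Option (Fin m) →₀ ℕ, d none = N ∧ zExp d = v
  · obtain ⟨d, rfl, rfl⟩ := h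
    change expandCoeff (f * g) _ _ = _
    rw [expandCoeff_eq, MvPowerSeries.coeff_mul, Finset.sum_sigma']
    have hkey : ∀ a ∈ Finset.HasAntidiagonal.antidiagonal d,
        MvPowerSeries.coeff a.1 f * MvPowerSeries.coeff a.2 g ≠ 0 →
        expandCoeff f (a.1 none) (zExp a.1) ≠ 0 ∧ expandCoeff g (a.2 none) (zExp a.2) ≠ 0 := by
      intro a _ h0
      rw [expandCoeff_eq, expandCoeff_eq]
      exact ⟨left_ne_zero_of_mul h0, right_ne_zero_of_mul h0⟩
    -- A monomial is determined by its power of `p` and its exponent of `z`, so splittings of `d`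
    -- correspond to splittings of this pair, as far as the terms are nonzero.
    refine Finset.sum_bij_ne_zero
      (fun a _ _ => (⟨(a.1 none, a.2 none), (zExp a.1, zExp a.2)⟩ :
        (_ : ℕ × ℕ) × (Lex (Fin m → ℤ) × Lex (Fin m → ℤ)))) ?_ ?_ ?_ ?_
    · intro a ha h0
      obtain ⟨h1, h2⟩ := hkey a ha h0
      have had := Finset.HasAntidiagonal.mem_antidiagonal.mp ha
      rw [Finset.mem_sigma]
      refine ⟨?_, ?_⟩
      · rw [Finset.HasAntidiagonal.mem_antidiagonal, ← had]
        rfl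
      · rw [Finset.mem_antidiagonal]
        refine ⟨h1, h2, ?_⟩
        rw [← had, zExp_add]
    · rintro a ha h0 b hb h0' hab
      simp only [Sigma.mk.injEq, Prod.mk.injEq, heq_eq_eq] at hab
      exact Prod.ext (zExp_injective hab.1.1 hab.2.1) (zExp_injective hab.1.2 hab.2.2)
    · rintro ⟨⟨M, M'⟩, ⟨w, w'⟩⟩ hb h0
      obtain ⟨a, rfl, rfl⟩ := exists_of_expandCoeff_ne_zero (left_ne_zero_of_mul h0)
      obtain ⟨b, rfl, rfl⟩ := exists_of_expandCoeff_ne_zero (right_ne_zero_of_mul h0)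
      rw [Finset.mem_sigma, Finset.HasAntidiagonal.mem_antidiagonal,
        Finset.mem_antidiagonal] at hb
      have hab : a + b = d := zExp_injective hb.1 (by rw [zExp_add]; exact hb.2.2.2)
      refine ⟨(a, b), Finset.HasAntidiagonal.mem_antidiagonal.mpr hab, ?_, rfl⟩
      change expandCoeff f _ _ * expandCoeff g _ _ ≠ 0 at h0
      rwa [expandCoeff_eq, expandCoeff_eq] at h0
    · intro a _ _
      change _ = expandCoeff f _ _ * expandCoeff g _ _
      rw [expandCoeff_eq, expandCoeff_eq]
  · change expandCoeff (f * g) _ _ = _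
    rw [expandCoeff_eq_zero _ h]
    symm
    refine Finset.sum_eq_zero fun x hx => Finset.sum_eq_zero fun y hy => ?_
    by_contra h0
    obtain ⟨a, ha, ha'⟩ := exists_of_expandCoeff_ne_zero (left_ne_zero_of_mul h0)
    obtain ⟨b, hb, hb'⟩ := exists_of_expandCoeff_ne_zero (right_ne_zero_of_mul h0)
    refine h ⟨a + b, ?_, ?_⟩
    · rw [Finsupp.add_apply, ha, hb]
      exact Finset.HasAntidiagonal.mem_antidiagonal.mp hx
    · rw [zExp_add, ha', hb']
      exact (Finset.mem_antidiagonal.mp hy).2.2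

theorem expandRow_coeff (f : RatioSeries m) (N : ℕ) (v : Lex (Fin m → ℤ)) :
    (expandRow f N).coeff v = expandCoeff f N v := rfl

theorem expandRow_add (f g : RatioSeries m) (N : ℕ) :
    expandRow (f + g) N = expandRow f N + expandRow g N := by
  ext v
  rw [HahnSeries.coeff_add]
  simp only [expandRow_coeff]
  by_cases h : ∃ d : Option (Fin m) →₀ ℕ, d none = N ∧ zExp d = v
  · obtain ⟨d, rfl, rfl⟩ := h
    simp only [expandCoeff_eq, map_add]
  · simp only [expandCoeff_eq_zero _ h, add_zero]

theorem expandRow_monomial (d : Option (Fin m) →₀ ℕ) (c : ℂ) (N : ℕ) :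
    expandRow (MvPowerSeries.monomial d c) N =
      if N = d none then HahnSeries.single (zExp d) c else 0 := by
  classical
  ext v
  rw [expandRow_coeff]
  by_cases h : ∃ e : Option (Fin m) →₀ ℕ, e none = N ∧ zExp e = v
  · obtain ⟨e, rfl, rfl⟩ := h
    rw [expandCoeff_eq, MvPowerSeries.coeff_monomial]
    by_cases hed : e = d
    · subst hed
      simp
    · rw [if_neg hed]
      split_ifs with h0
      · rw [HahnSeries.coeff_single_of_ne]
        exact fun hv => hed (zExp_injective h0 hv)
      · rfl
  · rw [expandCoeff_eq_zero _ h]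
    split_ifs with h0
    · rw [HahnSeries.coeff_single_of_ne]
      exact fun hv => h ⟨d, h0.symm, hv.symm⟩
    · rfl

/-- The expansion of a series in the `s_k` and `p̂`, as a series in `p`. -/
def expandPow (m : ℕ) : RatioSeries m →+* PowerSeries (ZSeries m) where
  toFun f := PowerSeries.mk (expandRow f)
  map_one' := by
    ext1 N
    rw [PowerSeries.coeff_mk, ← MvPowerSeries.monomial_zero_one, expandRow_monomial,
      PowerSeries.coeff_one, zExp_zero]
    rfl
  map_mul' f g := by
    ext1 N
    simp only [PowerSeries.coeff_mk, PowerSeries.coeff_mul, expandRow_mul]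
  map_zero' := by
    ext1 N
    have := expandRow_monomial (0 : Option (Fin m) →₀ ℕ) 0 N
    rw [map_zero, map_zero, ite_self] at this
    rw [PowerSeries.coeff_mk, this, map_zero]
  map_add' f g := by
    ext1 N
    simp only [PowerSeries.coeff_mk, map_add, expandRow_add]

theorem coeff_expandPow (f : RatioSeries m) (N : ℕ) :
    PowerSeries.coeff N (expandPow m f) = expandRow f N := by
  change PowerSeries.coeff N (PowerSeries.mk (expandRow f)) = _
  exact PowerSeries.coeff_mk _ _

theorem expandPow_monomial (d : Option (Fin m) →₀ ℕ) (c : ℂ) :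
    expandPow m (MvPowerSeries.monomial d c) =
      PowerSeries.monomial (d none) (HahnSeries.single (zExp d) c) := by
  ext1 N
  rw [coeff_expandPow, expandRow_monomial, PowerSeries.coeff_monomial]

/-- The embedding of power series in `p`. -/
def ofPow (m : ℕ) : PowerSeries (ZSeries m) →+* Corr m :=
  show PowerSeries (ZSeries m) →+* HahnSeries ℤ (ZSeries m) from
    HahnSeries.ofPowerSeries ℤ (ZSeries m)

theorem ofPow_X : ofPow m PowerSeries.X = nome m := HahnSeries.ofPowerSeries_X

theorem ofPow_C (y : ZSeries m) : ofPow m (PowerSeries.C y) = ofZ m y :=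
  HahnSeries.ofPowerSeries_C y

/-- The expansion of a series in the `s_k` and `p̂` in the region `|z₁| > ⋯ > |zₘ|`. -/
def expand (m : ℕ) : RatioSeries m →+* Corr m := (ofPow m).comp (expandPow m)

/-- Expansion only relabels coefficients, none being combined with another. Coefficientwise sums
therefore carry over to the Hahn series without further convergence questions. -/
theorem coeff_expand (N : ℤ) (v : Lex (Fin m → ℤ)) :
    (∀ f, (expand m f).coeff N v = 0) ∨
      ∃ d, ∀ f, (expand m f).coeff N v = MvPowerSeries.coeff d f := by
  by_cases hN : 0 ≤ N
  · lift N to ℕ using hN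
    have key : ∀ f, (expand m f).coeff N v = expandCoeff f N v := by
      intro f
      change ((HahnSeries.ofPowerSeries ℤ (ZSeries m) (expandPow m f)).coeff (N : ℤ)).coeff v = _
      rw [HahnSeries.ofPowerSeries_apply_coeff, coeff_expandPow, expandRow_coeff]
    by_cases h : ∃ d : Option (Fin m) →₀ ℕ, d none = N ∧ zExp d = v
    · obtain ⟨d, rfl, rfl⟩ := h
      exact Or.inr ⟨d, fun f => by rw [key, expandCoeff_eq]⟩
    · exact Or.inl fun f => by rw [key, expandCoeff_eq_zero _ h]
  · refine Or.inl fun f => ?_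
    change ((HahnSeries.ofPowerSeries ℤ (ZSeries m) (expandPow m f)).coeff N).coeff v = 0
    rw [HahnSeries.ofPowerSeries_apply, HahnSeries.embDomain_of_notMem_range, HahnSeries.coeff_zero]
    rintro ⟨k, hk⟩
    apply hN
    rw [← hk]
    exact Int.natCast_nonneg k

theorem FSum.expand {ι : Type} {f : ι → RatioSeries m} {s : RatioSeries m} (h : FSum f s) :
    HasFormalSum (fun i => expand m (f i)) (expand m s) := by
  intro N v
  rcases coeff_expand N v with h0 | ⟨d, hd⟩
  · simp [h0]
  · simp only [hd]
    exact ⟨h.finite d, h.coeff_eq d⟩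

theorem expand_C (c : ℂ) : expand m (MvPowerSeries.C c) = cst m c := by
  change ofPow m (expandPow m (MvPowerSeries.monomial 0 c)) = _
  rw [expandPow_monomial, zExp_zero, Finsupp.zero_apply, PowerSeries.monomial_zero_eq_C_apply,
    ofPow_C]
  rfl

theorem isExp_expand_rexp {E : RatioSeries m} (hE : MvPowerSeries.constantCoeff E = 0) :
    IsExp (expand m E) (expand m (rexp E)) := by
  have h := (rexp_fsum hE).expand
  simp only [map_mul, map_pow, expand_C] at h
  exact h

theorem expand_inv {f : RatioSeries m} (hf : MvPowerSeries.constantCoeff f ≠ 0) :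
    expand m f⁻¹ = (expand m f)⁻¹ := by
  refine eq_inv_of_mul_eq_one_left ?_
  rw [← map_mul, MvPowerSeries.inv_mul_cancel f hf, map_one]

/-- The nome `p`. -/
def ratioNome (m : ℕ) : RatioSeries m :=
  MvPowerSeries.monomial (Finsupp.equivFunOnFinite.symm fun _ => 1) 1

/-- The ratio `z_l / z_i`, for `i < l`. -/
def ratio (i l : Fin m) : RatioSeries m :=
  MvPowerSeries.monomial (Finsupp.equivFunOnFinite.symm fun o =>
    o.elim 0 fun k => if i ≤ k ∧ k < l then 1 else 0) 1

/-- The monomial `p z_i / z_l`, for `i < l`. -/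
def ratioDual (i l : Fin m) : RatioSeries m :=
  MvPowerSeries.monomial (Finsupp.equivFunOnFinite.symm fun o =>
    o.elim 1 fun k => if i ≤ k ∧ k < l then 0 else 1) 1

theorem constantCoeff_ratioNome : MvPowerSeries.constantCoeff (ratioNome m) = 0 := by
  classical
  rw [ratioNome, ← MvPowerSeries.coeff_zero_eq_constantCoeff_apply, MvPowerSeries.coeff_monomial,
    if_neg]
  intro h
  exact absurd (DFunLike.congr_fun h none) (by simp)

theorem constantCoeff_ratio {i l : Fin m} (h : i < l) :
    MvPowerSeries.constantCoeff (ratio i l) = 0 := by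
  classical
  rw [ratio, ← MvPowerSeries.coeff_zero_eq_constantCoeff_apply, MvPowerSeries.coeff_monomial,
    if_neg]
  intro h'
  have := DFunLike.congr_fun h' (some i)
  simp [h] at this

theorem constantCoeff_ratioDual (i l : Fin m) :
    MvPowerSeries.constantCoeff (ratioDual i l) = 0 := by
  classical
  rw [ratioDual, ← MvPowerSeries.coeff_zero_eq_constantCoeff_apply, MvPowerSeries.coeff_monomial,
    if_neg]
  intro h'
  exact absurd (DFunLike.congr_fun h' none) (by simp)

theorem ratio_mul_ratioDual (i l : Fin m) : ratio i l * ratioDual i l = ratioNome m := by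
  rw [ratio, ratioDual, ratioNome, MvPowerSeries.monomial_mul_monomial, one_mul]
  refine congrArg (fun d => MvPowerSeries.monomial d (1 : ℂ)) (Finsupp.ext ?_)
  rintro (_ | k)
  · simp
  · simp only [Finsupp.add_apply, Finsupp.equivFunOnFinite_symm_apply_apply, Option.elim]
    split_ifs <;> rfl

theorem expandPow_ratioNome : expandPow m (ratioNome m) = PowerSeries.X := by
  rw [ratioNome, expandPow_monomial]
  have : zExp (Finsupp.equivFunOnFinite.symm fun _ : Option (Fin m) => 1) = 0 := by
    apply ofLex.injective
    funext k
    change ((1 : ℕ) : ℤ) - (1 : ℕ) = 0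
    simp
  rw [this]
  rfl

theorem zVar_inv (i : Fin m) :
    (zVar i : ZSeries m)⁻¹ = HahnSeries.single (toLex (Pi.single i 1)) 1 := by
  refine inv_eq_of_mul_eq_one_left ?_
  rw [zVar, HahnSeries.single_mul_single, ← toLex_add, ← Pi.single_add]
  simp

theorem zVar_ne_zero (i : Fin m) : (zVar i : ZSeries m) ≠ 0 :=
  HahnSeries.single_ne_zero one_ne_zero

theorem expandPow_ratio {i l : Fin m} (h : i < l) :
    expandPow m (ratio i l) = PowerSeries.C (zVar l / zVar i) := by
  rw [ratio, expandPow_monomial, div_eq_mul_inv, zVar_inv, zVar, HahnSeries.single_mul_single,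
    ← toLex_add, one_mul]
  rw [← PowerSeries.monomial_zero_eq_C_apply]
  have : zExp (Finsupp.equivFunOnFinite.symm fun o : Option (Fin m) =>
      o.elim 0 fun k => if i ≤ k ∧ k < l then 1 else 0) =
      toLex ((Pi.single l (-1) : Fin m → ℤ) + Pi.single i 1) := by
    apply ofLex.injective
    funext k
    change (((if i ≤ k ∧ k < l then 1 else 0 : ℕ) : ℤ)) -
      (((prevIdx k).elim 0 fun k => if i ≤ k ∧ k < l then 1 else 0 : ℕ) : ℤ) =
      (Pi.single l (-1) : Fin m → ℤ) k + (Pi.single i 1 : Fin m → ℤ) k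
    have hil : (i : ℕ) < l := h
    rcases k with ⟨_ | a, ha⟩
    · have hp : prevIdx (⟨0, ha⟩ : Fin m) = none := rfl
      have e1 : i ≤ (⟨0, ha⟩ : Fin m) ↔ (i : ℕ) ≤ 0 := Iff.rfl
      have e2 : (⟨0, ha⟩ : Fin m) < l ↔ 0 < (l : ℕ) := Iff.rfl
      simp only [hp, Option.elim, Pi.single_apply, Fin.ext_iff, e1, e2]
      split_ifs <;> omega
    · have hp : prevIdx (⟨a + 1, ha⟩ : Fin m) = some ⟨a, by omega⟩ := rfl
      have e1 : i ≤ (⟨a + 1, ha⟩ : Fin m) ↔ (i : ℕ) ≤ a + 1 := Iff.rfl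
      have e2 : (⟨a + 1, ha⟩ : Fin m) < l ↔ a + 1 < (l : ℕ) := Iff.rfl
      have e3 : i ≤ (⟨a, by omega⟩ : Fin m) ↔ (i : ℕ) ≤ a := Iff.rfl
      have e4 : (⟨a, by omega⟩ : Fin m) < l ↔ a < (l : ℕ) := Iff.rfl
      simp only [hp, Option.elim, Pi.single_apply, Fin.ext_iff, e1, e2, e3, e4]
      split_ifs <;> omega
  rw [this]
  rfl

theorem expandPow_ratioDual {i l : Fin m} (h : i < l) :
    expandPow m (ratioDual i l) = PowerSeries.X * PowerSeries.C (zVar l / zVar i)⁻¹ := by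
  have h0 : (zVar l / zVar i : ZSeries m) ≠ 0 := div_ne_zero (zVar_ne_zero l) (zVar_ne_zero i)
  have := congrArg (expandPow m) (ratio_mul_ratioDual i l)
  rw [map_mul, expandPow_ratio h, expandPow_ratioNome] at this
  rw [← this, mul_right_comm, ← map_mul, mul_inv_cancel₀ h0, map_one, one_mul]

/-- Theta functions as exponentials. -/
theorem expandPow_rexp_ellLog {a a' : RatioSeries m} {y : ZSeries m}
    (ha : MvPowerSeries.constantCoeff a = 0) (ha' : MvPowerSeries.constantCoeff a' = 0)
    (hy : expandPow m a = PowerSeries.C y) (hy' : expandPow m a' = PowerSeries.X * PowerSeries.C y⁻¹) :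
    expandPow m (rexp (-ellLog (ratioNome m) 1 a) * rexp (-ellLog (ratioNome m) 1 a')) =
      theta y := by
  ext1 N
  -- To read off the coefficient of `p^N` it is enough to peel off `N + 1` factors of each product;
  -- the two tails are `1` modulo `p^(N+1)`.
  obtain ⟨b, hb⟩ := rexp_neg_ellLog_pow_mul (p := ratioNome m) (K := N + 1) constantCoeff_ratioNome ha
    (Nat.succ_ne_zero N)
  obtain ⟨b', hb'⟩ := rexp_neg_ellLog_pow_mul (p := ratioNome m) (K := N + 1) constantCoeff_ratioNome ha'
    (Nat.succ_ne_zero N)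
  have hT : expandPow m (rexp (-ellLog (ratioNome m) 1 a) * rexp (-ellLog (ratioNome m) 1 a')) =
      thetaProd y y⁻¹ (N + 1) * (1 + PowerSeries.X ^ (N + 1) *
        (expandPow m b + expandPow m b' + PowerSeries.X ^ (N + 1) * (expandPow m b * expandPow m b'))) := by
    rw [rexp_neg_ellLog constantCoeff_ratioNome ha (N + 1),
      rexp_neg_ellLog constantCoeff_ratioNome ha' (N + 1), hb, hb']
    have : thetaProd y y⁻¹ (N + 1) =
        (∏ k ∈ Finset.range (N + 1), (1 - PowerSeries.X ^ k * PowerSeries.C y)) *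
        ∏ k ∈ Finset.range (N + 1),
          (1 - PowerSeries.X ^ k * (PowerSeries.X * PowerSeries.C y⁻¹)) := by
      rw [thetaProd, ← Finset.prod_mul_distrib]
      refine Finset.prod_congr rfl fun k _ => ?_
      rw [pow_succ]
      ring
    rw [this]
    simp only [map_mul, map_prod, map_sub, map_add, map_one, map_pow, hy, hy', expandPow_ratioNome]
    ring
  rw [hT, coeff_mul_one_add_X_pow _ _ (Nat.lt_succ_self N), coeff_thetaProd _ _ (Nat.lt_succ_self N), theta_eq_thetaSeries]

end Iota

/-! ## Sums over paths of occupation numbers -/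

section Paths

variable {F J : Type} [Field F]

theorem prod_eq_add_of_eq_off {ι : Type} {s : Finset ι} {a : ι} (ha : a ∈ s) {f g h : ι → F}
    (c c₁ c₂ : F) (hg : ∀ i ∈ s, i ≠ a → f i = g i) (hh : ∀ i ∈ s, i ≠ a → f i = h i)
    (hfa : c * f a = c₁ * g a + c₂ * h a) :
    c * ∏ i ∈ s, f i = c₁ * ∏ i ∈ s, g i + c₂ * ∏ i ∈ s, h i := by
  classical
  have eg : ∏ i ∈ s.erase a, f i = ∏ i ∈ s.erase a, g i :=
    Finset.prod_congr rfl fun i hi => hg i (Finset.mem_of_mem_erase hi) (Finset.ne_of_mem_erase hi)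
  have eh : ∏ i ∈ s.erase a, f i = ∏ i ∈ s.erase a, h i :=
    Finset.prod_congr rfl fun i hi => hh i (Finset.mem_of_mem_erase hi) (Finset.ne_of_mem_erase hi)
  rw [← Finset.mul_prod_erase s f ha, ← Finset.mul_prod_erase s g ha,
    ← Finset.mul_prod_erase s h ha, ← eg, ← eh]
  linear_combination (∏ i ∈ s.erase a, f i) * hfa

/-- Removing one quantum of the mode `j` in the positions `p` with `a < p ≤ l`. -/
def lower (ν : ℕ → J →₀ ℕ) (j : J) (a l : ℕ) (p : ℕ) : J →₀ ℕ :=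
  if a < p ∧ p ≤ l then ν p - Finsupp.single j 1 else ν p

theorem lower_of_mem {ν : ℕ → J →₀ ℕ} {j : J} {a l p : ℕ} (h : a < p) (h' : p ≤ l) :
    lower ν j a l p = ν p - Finsupp.single j 1 := if_pos ⟨h, h'⟩

theorem lower_of_le {ν : ℕ → J →₀ ℕ} {j : J} {a l p : ℕ} (h : p ≤ a) :
    lower ν j a l p = ν p := if_neg fun h' => absurd h'.1 (not_lt.mpr h)

theorem lower_of_lt {ν : ℕ → J →₀ ℕ} {j : J} {a l p : ℕ} (h : l < p) :
    lower ν j a l p = ν p := if_neg fun h' => absurd h'.2 (not_le.mpr h)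

/-- The product of matrix elements along a sequence of states. -/
def pathProd (M : ℕ → (J →₀ ℕ) → (J →₀ ℕ) → F) (m : ℕ) (ν : ℕ → J →₀ ℕ) : F :=
  ∏ i ∈ Finset.range m, M i (ν i) (ν (i + 1))

/-- Matrix elements in which the positions from `k` to `l` are lowered on the outgoing side of the
`k`-th operator, but not on the incoming side of its predecessor. -/
def mixedProd (M : ℕ → (J →₀ ℕ) → (J →₀ ℕ) → F) (m : ℕ) (ν : ℕ → J →₀ ℕ) (j : J) (k l : ℕ) : F :=
  ∏ i ∈ Finset.range m, if i < k then M i (ν i) (ν (i + 1)) else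
    M i (lower ν j 0 l i) (lower ν j 0 l (i + 1))

variable {M : ℕ → (J →₀ ℕ) → (J →₀ ℕ) → F} {A b : ℕ → J → F}

open Classical in
/-- An annihilation operator inserted at the `k`-th state moves to the right until it is absorbed
by the creation part of the `l`-th operator. -/
theorem pathProd_annih_right
    (hM₁ : ∀ i ν μ j, ν j ≠ 0 → (ν j : F) * M i ν μ = A i j * M i (ν - Finsupp.single j 1) μ +
      μ j * M i (ν - Finsupp.single j 1) (μ - Finsupp.single j 1))
    {m : ℕ} {ν : ℕ → J →₀ ℕ} (hνm : ν m = 0) (j : J) {k : ℕ} (hk0 : 0 < k) (hk : k ≤ m) :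
    (ν k j : F) * pathProd M m ν = ∑ l ∈ Finset.Ico k m, A l j *
      if ∀ p, k ≤ p → p ≤ l → ν p j ≠ 0 then mixedProd M m ν j k l else 0 := by
  -- The stage at which the annihilation operator has passed the operators `k, …, l - 1` and stands
  -- at the `l`-th state. By `hM₁` it is either absorbed by the `l`-th operator, giving a
  -- `mixedProd`, or moves on to `l + 1`.
  set R : ℕ → F := fun l => ∏ i ∈ Finset.range m, if i < k then M i (ν i) (ν (i + 1)) else
    if i < l then M i (ν i - Finsupp.single j 1) (ν (i + 1) - Finsupp.single j 1) else
      M i (ν i) (ν (i + 1)) with hR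
  have key : ∀ t, k ≤ t → t ≤ m → (ν k j : F) * pathProd M m ν =
      (∑ l ∈ Finset.Ico k t, A l j *
        if ∀ p, k ≤ p → p ≤ l → ν p j ≠ 0 then mixedProd M m ν j k l else 0) +
      if ∀ p, k ≤ p → p < t → ν p j ≠ 0 then (ν t j : F) * R t else 0 := by
    intro t ht
    induction t, ht using Nat.le_induction with
    | base =>
      intro _
      rw [Finset.Ico_self, Finset.sum_empty, zero_add, if_pos fun p h h' => by omega]
      congr 1
      refine Finset.prod_congr rfl fun i _ => ?_
      split_ifs <;> rfl
    | succ t hkt ih =>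
      intro htm
      rw [ih (by omega), Finset.sum_Ico_succ_top hkt, add_assoc]
      congr 1
      by_cases hc : ∀ p, k ≤ p → p < t → ν p j ≠ 0
      · rw [if_pos hc]
        by_cases ht0 : ν t j = 0
        · rw [ht0, Nat.cast_zero, zero_mul, if_neg fun h => h t hkt le_rfl ht0,
            if_neg fun h => h t hkt (Nat.lt_succ_self t) ht0, mul_zero, add_zero]
        · have hc' : ∀ p, k ≤ p → p ≤ t → ν p j ≠ 0 := fun p h h' => by
            rcases Nat.lt_or_eq_of_le h' with h'' | rfl
            · exact hc p h h''
            · exact ht0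
          rw [if_pos hc', if_pos fun p h h' => hc' p h (Nat.lt_succ_iff.mp h')]
          refine prod_eq_add_of_eq_off (Finset.mem_range.mpr (by omega : t < m)) _ _ _
            (fun i _ hi => ?_) (fun i _ hi => ?_) ?_
          · by_cases h1 : i < k
            · rw [if_pos h1, if_pos h1]
            · rw [if_neg h1, if_neg h1]
              by_cases h2 : i < t
              · rw [if_pos h2, lower_of_mem (by omega) (by omega),
                  lower_of_mem (by omega) (by omega)]
              · rw [if_neg h2, lower_of_lt (by omega), lower_of_lt (by omega)]
          · by_cases h1 : i < k
            · rw [if_pos h1, if_pos h1]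
            · rw [if_neg h1, if_neg h1]
              by_cases h2 : i < t
              · rw [if_pos h2, if_pos (by omega)]
              · rw [if_neg h2, if_neg (by omega)]
          · rw [if_neg (by omega), if_neg (by omega), if_neg (by omega), if_neg (by omega),
              if_pos (by omega), lower_of_mem (by omega) le_rfl, lower_of_lt (by omega)]
            exact hM₁ t _ _ j ht0
      · rw [if_neg hc, if_neg fun h => hc fun p h1 h2 => h p h1 (le_of_lt h2),
          if_neg fun h => hc fun p h1 h2 => h p h1 (by omega), mul_zero, add_zero]
  -- At the final state, the vacuum, there is no quantum left to annihilate.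
  rw [key m hk le_rfl, hνm]
  simp

open Classical in
/-- A creation operator inserted at the `k`-th state moves to the left until it is absorbed by the
annihilation part of the `a`-th operator. -/
theorem mixedProd_create_left
    (hM₂ : ∀ i ν μ j, μ j ≠ 0 → M i ν μ = b i j * M i ν (μ - Finsupp.single j 1) +
      if ν j = 0 then 0 else M i (ν - Finsupp.single j 1) (μ - Finsupp.single j 1))
    {m : ℕ} {ν : ℕ → J →₀ ℕ} (hν0 : ν 0 = 0) (j : J) {l : ℕ} (hl : l < m) {k : ℕ} (hk : k ≤ l) :
    (if ∀ p, k ≤ p → p ≤ l → ν p j ≠ 0 then mixedProd M m ν j k l else 0) =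
      ∑ a ∈ Finset.range k, b a j *
        if ∀ p, a < p → p ≤ l → ν p j ≠ 0 then pathProd M m (lower ν j a l) else 0 := by
  induction k with
  | zero =>
    rw [Finset.range_zero, Finset.sum_empty, if_neg]
    exact fun h => h 0 le_rfl (Nat.zero_le _) (by rw [hν0]; rfl)
  | succ k ih =>
    rw [Finset.sum_range_succ, ← ih (by omega)]
    by_cases hc : ∀ p, k < p → p ≤ l → ν p j ≠ 0
    · rw [if_pos (show ∀ p, k + 1 ≤ p → p ≤ l → ν p j ≠ 0 from hc), if_pos hc]
      -- This is `hM₂` for the `k`-th operator: the quantum is absorbed there, leaving a path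
      -- lowered consistently between the two operators, or it continues to the `k`-th state,
      -- provided that state contains one.
      have step : 1 * mixedProd M m ν j (k + 1) l = b k j * pathProd M m (lower ν j k l) +
          (if ν k j = 0 then 0 else 1) * mixedProd M m ν j k l := by
        refine prod_eq_add_of_eq_off (Finset.mem_range.mpr (by omega : k < m)) _ _ _
          (fun i _ hi => ?_) (fun i _ hi => ?_) ?_
        · by_cases h1 : i < k
          · rw [if_pos (by omega), lower_of_le (by omega), lower_of_le (by omega)]
          · rw [if_neg (by omega)]
            by_cases h2 : i ≤ l
            · rw [lower_of_mem (by omega) h2, lower_of_mem (by omega) h2]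
              by_cases h3 : i + 1 ≤ l
              · rw [lower_of_mem (by omega) h3, lower_of_mem (by omega) h3]
              · rw [lower_of_lt (by omega), lower_of_lt (by omega)]
            · rw [lower_of_lt (by omega), lower_of_lt (by omega), lower_of_lt (by omega),
                lower_of_lt (by omega)]
        · by_cases h1 : i < k
          · rw [if_pos (by omega), if_pos h1]
          · rw [if_neg (by omega), if_neg h1]
        · have e1 : lower ν j k l (k + 1) = ν (k + 1) - Finsupp.single j 1 :=
            lower_of_mem (Nat.lt_succ_self k) hk
          have e2 : lower ν j 0 l (k + 1) = ν (k + 1) - Finsupp.single j 1 :=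
            lower_of_mem (Nat.succ_pos k) hk
          rw [if_pos (Nat.lt_succ_self k), if_neg (lt_irrefl k), lower_of_le le_rfl, e1, e2,
            one_mul, hM₂ k _ _ j (hc (k + 1) (Nat.lt_succ_self k) hk)]
          congr 1
          by_cases h0 : ν k j = 0
          · rw [if_pos h0, if_pos h0, zero_mul]
          · have hk0 : 0 < k := Nat.pos_of_ne_zero fun h => h0 (by rw [h, hν0]; rfl)
            rw [if_neg h0, if_neg h0, one_mul, lower_of_mem hk0 (by omega)]
      rw [one_mul] at step
      rw [step, add_comm]
      congr 1
      by_cases h0 : ν k j = 0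
      · rw [if_pos h0, zero_mul, if_neg fun h => h k le_rfl (by omega) h0]
      · rw [if_neg h0, one_mul, if_pos]
        intro p h1 h2
        rcases Nat.eq_or_lt_of_le h1 with rfl | h3
        · exact h0
        · exact hc p h3 h2
    · rw [if_neg (show ¬∀ p, k + 1 ≤ p → p ≤ l → ν p j ≠ 0 from hc), if_neg hc,
        if_neg fun h => hc fun p h1 h2 => h p (le_of_lt h1) h2, mul_zero, add_zero]

/-- Pairs of operators. -/
abbrev OpPair (m : ℕ) : Type := {x : Fin m × Fin m // x.1 < x.2}

/-- The `k`-th state lies between the two operators. -/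
abbrev OpPair.Spans {m : ℕ} (x : OpPair m) (k : ℕ) : Prop := (x.1.1 : ℕ) < k ∧ k ≤ x.1.2

theorem sum_opPair_spans {m : ℕ} (k : ℕ) (f : ℕ → ℕ → F) :
    (∑ x : OpPair m, if x.Spans k then f x.1.1 x.1.2 else 0) =
      ∑ l ∈ Finset.Ico k m, ∑ a ∈ Finset.range k, f a l := by
  classical
  rw [← Finset.sum_filter, Finset.sum_sigma']
  refine Finset.sum_bij' (fun x _ => ⟨(x.1.2 : ℕ), (x.1.1 : ℕ)⟩)
    (fun y hy => ⟨(⟨y.2, ?_⟩, ⟨y.1, ?_⟩), ?_⟩) ?_ ?_ ?_ ?_ ?_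
  · have := Finset.mem_sigma.mp hy
    rw [Finset.mem_Ico, Finset.mem_range] at this
    omega
  · have := Finset.mem_sigma.mp hy
    rw [Finset.mem_Ico, Finset.mem_range] at this
    omega
  · have := Finset.mem_sigma.mp hy
    rw [Finset.mem_Ico, Finset.mem_range] at this
    rw [Fin.lt_def]
    simp only
    omega
  · intro x hx
    have hs : x.Spans k := (Finset.mem_filter.mp hx).2
    exact Finset.mem_sigma.mpr ⟨Finset.mem_Ico.mpr ⟨hs.2, x.1.2.2⟩, Finset.mem_range.mpr hs.1⟩
  · intro y hy
    have := Finset.mem_sigma.mp hy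
    rw [Finset.mem_Ico, Finset.mem_range] at this
    exact Finset.mem_filter.mpr ⟨Finset.mem_univ _, this.2, this.1.1⟩
  · intro x _
    rfl
  · intro y _
    rfl
  · intro x _
    rfl

-- The number operator of the mode `j` at the `k`-th state, evaluated by Wick's rule. Every quantum
-- found there was created by some operator `l ≥ k` and is annihilated by some operator `a < k`.
-- Removing it along its whole life leaves the contraction factor times the amplitude of a lower
-- path.
open Classical in
theorem mul_pathProd
    (hM₁ : ∀ i ν μ j, ν j ≠ 0 → (ν j : F) * M i ν μ = A i j * M i (ν - Finsupp.single j 1) μ +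
      μ j * M i (ν - Finsupp.single j 1) (μ - Finsupp.single j 1))
    (hM₂ : ∀ i ν μ j, μ j ≠ 0 → M i ν μ = b i j * M i ν (μ - Finsupp.single j 1) +
      if ν j = 0 then 0 else M i (ν - Finsupp.single j 1) (μ - Finsupp.single j 1))
    {m : ℕ} {ν : ℕ → J →₀ ℕ} (hν0 : ν 0 = 0) (hνm : ∀ k, m ≤ k → ν k = 0) (j : J) (k : ℕ) :
    (ν k j : F) * pathProd M m ν = ∑ x : OpPair m, if x.Spans k then
      b x.1.1 j * A x.1.2 j * if ∀ p, x.Spans p → ν p j ≠ 0 then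
        pathProd M m (lower ν j x.1.1 x.1.2) else 0 else 0 := by
  rw [sum_opPair_spans k fun a l => b a j * A l j * if ∀ p, a < p ∧ p ≤ l → ν p j ≠ 0 then
        pathProd M m (lower ν j a l) else 0]
  rcases Nat.eq_zero_or_pos k with rfl | hk0
  · simp [hν0]
  rcases le_or_gt m k with hk | hk
  · rw [hνm k hk, Finset.Ico_eq_empty_of_le hk]
    simp
  rw [pathProd_annih_right hM₁ (hνm m le_rfl) j hk0 hk.le]
  refine Finset.sum_congr rfl fun l hl => ?_
  rw [Finset.mem_Ico] at hl
  rw [mixedProd_create_left hM₂ hν0 j hl.2 hl.1, Finset.mul_sum]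
  refine Finset.sum_congr rfl fun a _ => ?_
  simp only [and_imp]
  ring

/-- The occupation numbers of the `k`-th state for a given number of contractions of every kind. -/
def profile {m : ℕ} (n : OpPair m × J →₀ ℕ) (k : ℕ) : J →₀ ℕ :=
  ∑ x : OpPair m, if x.Spans k then
    n.comapDomain (fun j => (x, j)) (fun _ _ _ _ h => (Prod.ext_iff.mp h).2) else 0

theorem profile_apply {m : ℕ} (n : OpPair m × J →₀ ℕ) (k : ℕ) (j : J) :
    profile n k j = ∑ x : OpPair m, if x.Spans k then n (x, j) else 0 := by
  rw [profile, Finsupp.finsetSum_apply]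
  refine Finset.sum_congr rfl fun x _ => ?_
  split_ifs <;> rfl

theorem profile_zero {m : ℕ} (k : ℕ) : profile (0 : OpPair m × J →₀ ℕ) k = 0 := by
  ext j
  rw [profile_apply]
  simp

theorem profile_eq_zero {m : ℕ} (n : OpPair m × J →₀ ℕ) {k : ℕ} (hk : k = 0 ∨ m ≤ k) :
    profile n k = 0 := by
  refine Finset.sum_eq_zero fun x _ => if_neg fun h => ?_
  have := x.1.2.2
  have := h.1
  have := h.2
  omega

theorem profile_add_single {m : ℕ} (n : OpPair m × J →₀ ℕ) (x : OpPair m) (j : J) (k : ℕ) :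
    profile (n + Finsupp.single (x, j) 1) k =
      profile n k + if x.Spans k then Finsupp.single j 1 else 0 := by
  classical
  ext i
  rw [Finsupp.add_apply, profile_apply, profile_apply]
  have : ∀ y : OpPair m, (if y.Spans k then (n + Finsupp.single (x, j) 1 : OpPair m × J →₀ ℕ) (y, i) else 0) =
      (if y.Spans k then n (y, i) else 0) +
        if y = x then (if x.Spans k then Finsupp.single j 1 else 0 : J →₀ ℕ) i else 0 := by
    intro y
    rw [Finsupp.add_apply]
    by_cases hy : y = x
    · subst hy
      rw [if_pos rfl]
      split_ifs
      · simp [Finsupp.single_apply]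
      · rfl
    · rw [if_neg hy, Finsupp.single_apply, if_neg fun h => hy (Prod.ext_iff.mp h).1.symm, add_zero,
        add_zero]
  simp only [this, Finset.sum_add_distrib]
  simp

theorem le_profile {m : ℕ} (n : OpPair m × J →₀ ℕ) (x : OpPair m) (j : J) {k : ℕ}
    (hk : x.Spans k) : n (x, j) ≤ profile n k j := by
  rw [profile_apply]
  have := Finset.single_le_sum (f := fun y : OpPair m => if y.Spans k then n (y, j) else 0)
    (fun _ _ => Nat.zero_le _) (Finset.mem_univ x)
  simpa only [if_pos hk] using this

theorem OpPair.spans_snd {m : ℕ} (x : OpPair m) : x.Spans x.1.2 := ⟨x.2, le_rfl⟩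

/-- The number of contractions of a given kind is bounded by the occupation number at the state next
to its creating operator. -/
theorem finite_fiber_profile {m : ℕ} (ν : ℕ → J →₀ ℕ) :
    {n : OpPair m × J →₀ ℕ | profile n = ν}.Finite := by
  classical
  have hfin : (Function.support fun P : OpPair m × J => ν P.1.1.2 P.2).Finite := by
    refine (Set.Finite.subset (Finset.finite_toSet (Finset.univ ×ˢ
      (Finset.univ : Finset (OpPair m)).biUnion fun x => (ν x.1.2).support)) ?_)
    intro P hP
    refine Finset.mem_coe.mpr (Finset.mem_product.mpr ⟨Finset.mem_univ _, ?_⟩)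
    exact Finset.mem_biUnion.mpr ⟨P.1, Finset.mem_univ _, Finsupp.mem_support_iff.mpr hP⟩
  refine (Set.finite_Iic (Finsupp.ofSupportFinite _ hfin)).subset fun n hn => ?_
  rintro ⟨x, j⟩
  have := le_profile n x j x.spans_snd
  rw [show profile n = ν from hn] at this
  exact this

/-- The contribution of given numbers of contractions. -/
def contractionWeight {P : Type} (c : P → F) (n : P →₀ ℕ) : F :=
  n.prod fun i k => (k.factorial : F)⁻¹ * c i ^ k

theorem contractionWeight_add_single [CharZero F] {P : Type} (c : P → F) (n : P →₀ ℕ) (i : P) :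
    ((n i + 1 : ℕ) : F) * contractionWeight c (n + Finsupp.single i 1) =
      c i * contractionWeight c n := by
  classical
  have h1 : contractionWeight c (n + Finsupp.single i 1) =
      (((n i + 1).factorial : F)⁻¹ * c i ^ (n i + 1)) *
        (n.erase i).prod fun i k => (k.factorial : F)⁻¹ * c i ^ k := by
    rw [contractionWeight, ← Finsupp.mul_prod_erase' _ i _ (by simp)]
    have e1 : (n + Finsupp.single i 1 : P →₀ ℕ) i = n i + 1 := by simp
    have e2 : (n + Finsupp.single i 1).erase i = n.erase i := by
      ext j
      by_cases hj : j = i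
      · subst hj; simp
      · simp [Finsupp.erase_ne hj]
    rw [e1, e2]
  have h2 : contractionWeight c n = (((n i).factorial : F)⁻¹ * c i ^ (n i)) *
      (n.erase i).prod fun i k => (k.factorial : F)⁻¹ * c i ^ k := by
    rw [contractionWeight, ← Finsupp.mul_prod_erase' n i _ (by simp)]
  have h3 : ((n i + 1 : ℕ) : F) ≠ 0 := Nat.cast_ne_zero.mpr (n i).succ_ne_zero
  have h4 : ((n i).factorial : F) ≠ 0 := Nat.cast_ne_zero.mpr (n i).factorial_ne_zero
  rw [h1, h2, Nat.factorial_succ, Nat.cast_mul]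
  generalize ((n.erase i).prod fun i k => (k.factorial : F)⁻¹ * c i ^ k) = y
  field_simp
  ring

-- The recursion of `mul_pathProd` for the sum over contractions: `ν k j` counts the contractions of
-- the mode `j` across the `k`-th state, and taking one of them away multiplies the weight by `(its
-- multiplicity) / c` while lowering the profile.
open Classical in
theorem mul_sum_fiber [CharZero F] {m : ℕ} (c : OpPair m × J → F) (ν : ℕ → J →₀ ℕ) (j : J)
    (k : ℕ) :
    (ν k j : F) * ∑ n ∈ (finite_fiber_profile (m := m) ν).toFinset, contractionWeight c n =
      ∑ x : OpPair m, if x.Spans k then c (x, j) * if ∀ p, x.Spans p → ν p j ≠ 0 then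
        ∑ n ∈ (finite_fiber_profile (m := m) (lower ν j x.1.1 x.1.2)).toFinset,
          contractionWeight c n else 0 else 0 := by
  have h1 : (ν k j : F) * ∑ n ∈ (finite_fiber_profile (m := m) ν).toFinset,
      contractionWeight c n = ∑ x : OpPair m, if x.Spans k then
        ∑ n ∈ (finite_fiber_profile (m := m) ν).toFinset, (n (x, j) : F) * contractionWeight c n
        else 0 := by
    rw [Finset.mul_sum]
    simp only [← Finset.sum_filter]
    rw [Finset.sum_comm]
    refine Finset.sum_congr rfl fun n hn => ?_
    have hn' : profile n = ν := by simpa using hn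
    rw [← hn', profile_apply, ← Finset.sum_mul, ← Finset.sum_filter, Nat.cast_sum]
  rw [h1]
  refine Finset.sum_congr rfl fun x _ => ?_
  split_ifs with hx hc
  · rw [Finset.mul_sum]
    symm
    have hlow : ∀ p, lower ν j x.1.1 x.1.2 p + (if x.Spans p then Finsupp.single j 1 else 0) =
        ν p := by
      intro p
      by_cases hp : x.Spans p
      · rw [lower_of_mem hp.1 hp.2, if_pos hp, tsub_add_cancel_of_le]
        exact Finsupp.single_le_iff.mpr (Nat.one_le_iff_ne_zero.mpr (hc p hp))
      · rw [lower, if_neg hp, if_neg hp, add_zero]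
    refine Finset.sum_bij_ne_zero (fun n _ _ => n + Finsupp.single (x, j) 1) ?_ ?_ ?_ ?_
    · intro n hn _
      have hn' : profile n = lower ν j x.1.1 x.1.2 := by simpa using hn
      simp only [Set.Finite.mem_toFinset, Set.mem_ofPred_eq]
      funext p
      rw [profile_add_single, hn', hlow]
    · intro n _ _ n' _ _ h
      exact add_right_cancel h
    · intro n hn h0
      have hn' : profile n = ν := by simpa using hn
      have hnx : n (x, j) ≠ 0 := by
        intro h
        apply h0
        rw [h, Nat.cast_zero, zero_mul]
      have hle : Finsupp.single (x, j) 1 ≤ n :=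
        Finsupp.single_le_iff.mpr (Nat.one_le_iff_ne_zero.mpr hnx)
      have heq : n - Finsupp.single (x, j) 1 + Finsupp.single (x, j) 1 = n :=
        tsub_add_cancel_of_le hle
      refine ⟨n - Finsupp.single (x, j) 1, ?_, ?_, heq⟩
      · simp only [Set.Finite.mem_toFinset, Set.mem_ofPred_eq]
        funext p
        have := profile_add_single (n - Finsupp.single (x, j) 1) x j p
        rw [heq, hn', ← hlow p] at this
        exact (add_right_cancel this).symm
      · rw [← contractionWeight_add_single, heq]
        convert h0 using 3
        have := DFunLike.congr_fun heq (x, j)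
        simpa using this
    · intro n _ _
      rw [← contractionWeight_add_single]
      congr 2
      simp
  · rw [mul_zero]
    refine Finset.sum_eq_zero fun n hn => ?_
    have hn' : profile n = ν := by simpa using hn
    push Not at hc
    obtain ⟨p, hp, hp0⟩ := hc
    have := le_profile n x j hp
    rw [hn', hp0, Nat.le_zero] at this
    rw [this, Nat.cast_zero, zero_mul]
  · rfl

/-- The amplitude of a path is the sum over all ways of contracting its quanta. -/
theorem pathProd_eq_sum_fiber [CharZero F]
    (hM₀ : ∀ i, M i 0 0 = 1)
    (hM₁ : ∀ i ν μ j, ν j ≠ 0 → (ν j : F) * M i ν μ = A i j * M i (ν - Finsupp.single j 1) μ +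
      μ j * M i (ν - Finsupp.single j 1) (μ - Finsupp.single j 1))
    (hM₂ : ∀ i ν μ j, μ j ≠ 0 → M i ν μ = b i j * M i ν (μ - Finsupp.single j 1) +
      if ν j = 0 then 0 else M i (ν - Finsupp.single j 1) (μ - Finsupp.single j 1))
    {m : ℕ} (c : OpPair m × J → F) (hc : ∀ x j, c (x, j) = b x.1.1 j * A x.1.2 j)
    (ν : ℕ → J →₀ ℕ) (hν0 : ν 0 = 0) (hνm : ∀ k, m ≤ k → ν k = 0) :
    pathProd M m ν = ∑ n ∈ (finite_fiber_profile (m := m) ν).toFinset, contractionWeight c n := by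
  classical
  -- Induction on the total number of quanta along the path. Both sides obey one recursion, which
  -- expresses `ν k j` times the quantity by strictly lower paths; the factor is divided out in
  -- characteristic zero.
  induction hN : ∑ k ∈ Finset.range m, (ν k).degree using Nat.strong_induction_on generalizing ν with
  | _ N ih =>
  by_cases hν : ∃ k j, ν k j ≠ 0
  · obtain ⟨k, j, hkj⟩ := hν
    have hkj' : (ν k j : F) ≠ 0 := Nat.cast_ne_zero.mpr hkj
    apply mul_left_cancel₀ hkj'
    rw [mul_pathProd hM₁ hM₂ hν0 hνm, mul_sum_fiber]
    refine Finset.sum_congr rfl fun x _ => ?_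
    by_cases hx : x.Spans k
    swap
    · rw [if_neg hx, if_neg hx]
    rw [if_pos hx, if_pos hx, hc]
    by_cases hs : ∀ p, x.Spans p → ν p j ≠ 0
    swap
    · rw [if_neg hs, if_neg hs]
    rw [if_pos hs, if_pos hs]
    congr 1
    refine ih _ ?_ _ ?_ ?_ rfl
    · rw [← hN]
      refine Finset.sum_lt_sum (fun p _ => ?_) ⟨x.1.2, Finset.mem_range.mpr x.1.2.2, ?_⟩
      · apply Finsupp.degree_mono
        rw [lower]
        split_ifs
        · exact tsub_le_self
        · exact le_rfl
      · have h1 := hs _ x.spans_snd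
        rw [lower_of_mem x.2 le_rfl]
        have h2 : ν x.1.2 - Finsupp.single j 1 + Finsupp.single j 1 = ν x.1.2 :=
          tsub_add_cancel_of_le (Finsupp.single_le_iff.mpr (Nat.one_le_iff_ne_zero.mpr h1))
        have h3 := congrArg Finsupp.degree h2
        rw [map_add, Finsupp.degree_single] at h3
        omega
    · rw [lower_of_le (Nat.zero_le _), hν0]
    · intro p hp
      rw [lower_of_lt (lt_of_lt_of_le x.1.2.2 hp), hνm p hp]
  · push Not at hν
    have h0 : ν = 0 := by
      funext k
      ext j
      exact hν k j
    subst h0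
    have hfib : (finite_fiber_profile (m := m) (0 : ℕ → J →₀ ℕ)).toFinset = {0} := by
      ext n
      simp only [Set.Finite.mem_toFinset, Set.mem_ofPred_eq, Finset.mem_singleton]
      constructor
      · intro hn
        ext ⟨x, j⟩
        have := le_profile n x j x.spans_snd
        rw [hn] at this
        simpa using this
      · rintro rfl
        funext k
        exact profile_zero k
    rw [hfib, Finset.sum_singleton, contractionWeight, Finsupp.prod_zero_index]
    exact Finset.prod_eq_one fun i _ => hM₀ i

end Paths

/-! ## Matrix elements of normal ordered exponentials -/

section MatrixElements

variable {n m : ℕ} (ρ : Fin 3 → ℂ)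

instance : CharZero (Corr m) := charZero_of_injective_ringHom (cst m).injective

theorem annihSum_X (B : Mode n → Corr m) (j : Mode n) :
    annihSum ρ B (MvPolynomial.X j) = MvPolynomial.C (B j * bracket ρ n m j) := by
  rw [annihSum, MvPolynomial.mkDerivation_X]

/-- Leibniz' rule for iterates stops after two terms because the derivative of a variable is a
constant. -/
theorem annihSum_iterate_X_mul (B : Mode n → Corr m) (j : Mode n) (P : Fock n m) (k : ℕ) :
    (annihSum ρ B)^[k + 1] (MvPolynomial.X j * P) =
      MvPolynomial.X j * (annihSum ρ B)^[k + 1] P +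
        ((k + 1 : ℕ) : Fock n m) * (MvPolynomial.C (B j * bracket ρ n m j) *
          (annihSum ρ B)^[k] P) := by
  induction k with
  | zero =>
    simp only [Function.iterate_succ, Function.iterate_zero, Function.comp_apply, id_eq,
      Derivation.leibniz, annihSum_X, smul_eq_mul]
    ring
  | succ k ih =>
    rw [Function.iterate_succ_apply', ih, map_add, Derivation.leibniz, Derivation.leibniz,
      Derivation.leibniz, Derivation.map_natCast, annihSum_X, ← MvPolynomial.algebraMap_eq,
      Derivation.map_algebraMap, Function.iterate_succ_apply' _ (k + 1)]
    simp only [smul_eq_mul, ← Function.iterate_succ_apply' (annihSum ρ B)]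
    push_cast
    ring

theorem monomial_add_single_one (μ : State n) (j : Mode n) :
    (MvPolynomial.monomial (μ + Finsupp.single j 1) 1 : Fock n m) =
      MvPolynomial.X j * MvPolynomial.monomial μ 1 := by
  rw [add_comm, MvPolynomial.X, MvPolynomial.monomial_mul, one_mul]

theorem annihSum_iterate_monomial (B : Mode n → Corr m) (μ : State n) :
    ∀ k, μ.degree < k → (annihSum ρ B)^[k] (MvPolynomial.monomial μ 1 : Fock n m) = 0 := by
  induction hN : μ.degree generalizing μ with
  | zero =>
    intro k hk
    have : μ = 0 := (Finsupp.degree_eq_zero_iff μ).mp hN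
    obtain ⟨k, rfl⟩ := Nat.exists_eq_succ_of_ne_zero hk.ne'
    rw [this, Function.iterate_succ_apply, ← MvPolynomial.C_apply, ← MvPolynomial.algebraMap_eq,
      Derivation.map_algebraMap]
    clear hk
    induction k with
    | zero => rfl
    | succ k ih => rw [Function.iterate_succ_apply, map_zero, ih]
  | succ N ih =>
    intro k hk
    obtain ⟨j, hj⟩ : ∃ j, μ j ≠ 0 := by
      by_contra h
      push Not at h
      have : μ = 0 := Finsupp.ext h
      rw [this, map_zero] at hN
      exact absurd hN.symm N.succ_ne_zero
    have hle : Finsupp.single j 1 ≤ μ := Finsupp.single_le_iff.mpr (Nat.one_le_iff_ne_zero.mpr hj)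
    obtain ⟨μ', rfl⟩ := exists_add_of_le hle
    rw [add_comm] at hN ⊢
    rw [map_add, Finsupp.degree_single] at hN
    obtain ⟨k, rfl⟩ := Nat.exists_eq_succ_of_ne_zero (by omega : k ≠ 0)
    rw [monomial_add_single_one, Nat.succ_eq_add_one, annihSum_iterate_X_mul,
      ih μ' (by omega) _ (by omega), ih μ' (by omega) _ (by omega)]
    simp

/-- The exponential series may be cut off anywhere above the degree; this freedom aligns the cutoffs
for monomials of different degrees. -/
theorem expAnnih_monomial (B : Mode n → Corr m) (μ : State n) (K : ℕ) (hK : μ.degree < K) :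
    expAnnih ρ B (MvPolynomial.monomial μ 1 : Fock n m) = ∑ k ∈ Finset.range K,
      cst m ((k.factorial : ℂ)⁻¹) • (annihSum ρ B)^[k] (MvPolynomial.monomial μ 1) := by
  have hdeg : (MvPolynomial.monomial μ 1 : Fock n m).totalDegree = μ.degree := by
    rw [MvPolynomial.totalDegree_monomial _ one_ne_zero]
    rfl
  rw [expAnnih, hdeg]
  refine Finset.sum_subset (fun k hk => ?_) fun k _ hk => ?_
  · rw [Finset.mem_range] at hk ⊢
    omega
  · rw [Finset.mem_range] at hk
    rw [annihSum_iterate_monomial ρ B μ k (by omega), smul_zero]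

theorem expAnnih_one (B : Mode n → Corr m) :
    expAnnih ρ B (MvPolynomial.monomial 0 1 : Fock n m) = 1 := by
  rw [expAnnih_monomial ρ B 0 1 (by simp)]
  simp

/-- The exponential of the annihilation part shifts the creation operators. -/
theorem expAnnih_add_single (B : Mode n → Corr m) (μ : State n) (j : Mode n) :
    expAnnih ρ B (MvPolynomial.monomial (μ + Finsupp.single j 1) 1 : Fock n m) =
      (MvPolynomial.X j + MvPolynomial.C (B j * bracket ρ n m j)) *
        expAnnih ρ B (MvPolynomial.monomial μ 1) := by
  have h1 := expAnnih_monomial ρ B μ (μ.degree + 2) (by omega)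
  have h2 := expAnnih_monomial ρ B μ (μ.degree + 1) (by omega)
  rw [Finset.sum_range_succ'] at h1
  rw [expAnnih_monomial ρ B (μ + Finsupp.single j 1) (μ.degree + 2)
    (by rw [map_add, Finsupp.degree_single]; omega), Finset.sum_range_succ', add_mul,
    monomial_add_single_one]
  nth_rewrite 1 [h1]
  rw [h2, mul_add]
  have key : ∀ k : ℕ, cst m (((k + 1).factorial : ℂ)⁻¹) • (annihSum ρ B)^[k + 1]
      (MvPolynomial.X j * MvPolynomial.monomial μ 1 : Fock n m) =
      MvPolynomial.X j * (cst m (((k + 1).factorial : ℂ)⁻¹) • (annihSum ρ B)^[k + 1]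
        (MvPolynomial.monomial μ 1)) +
      MvPolynomial.C (B j * bracket ρ n m j) * (cst m ((k.factorial : ℂ)⁻¹) •
        (annihSum ρ B)^[k] (MvPolynomial.monomial μ 1)) := by
    intro k
    have hf : cst m (((k + 1).factorial : ℂ)⁻¹) * ((k + 1 : ℕ) : Corr m) =
        cst m ((k.factorial : ℂ)⁻¹) := by
      rw [← map_natCast (cst m), ← map_mul]
      congr 1
      have h1 : ((k + 1 : ℕ) : ℂ) ≠ 0 := Nat.cast_ne_zero.mpr k.succ_ne_zero
      have h2 : (k.factorial : ℂ) ≠ 0 := Nat.cast_ne_zero.mpr k.factorial_ne_zero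
      rw [Nat.factorial_succ, Nat.cast_mul]
      field_simp
    rw [annihSum_iterate_X_mul, ← hf]
    simp only [MvPolynomial.smul_eq_C_mul, map_mul, map_natCast]
    ring
  simp only [key, Finset.sum_add_distrib, ← Finset.mul_sum]
  simp only [Function.iterate_zero, id_eq, Nat.factorial_zero, Nat.cast_one, inv_one, map_one,
    one_smul]
  ring

/-- The exponential of the annihilation part is a translation of the variables and so commutes with
partial derivatives. -/
theorem pderiv_expAnnih (B : Mode n → Corr m) (μ : State n) (j : Mode n) :
    MvPolynomial.pderiv j (expAnnih ρ B (MvPolynomial.monomial μ 1 : Fock n m)) =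
      (μ j : Fock n m) * expAnnih ρ B (MvPolynomial.monomial (μ - Finsupp.single j 1) 1) := by
  classical
  induction hN : μ.degree generalizing μ with
  | zero =>
    have : μ = 0 := (Finsupp.degree_eq_zero_iff μ).mp hN
    rw [this, expAnnih_one]
    simp
  | succ N ih =>
    obtain ⟨i, hi⟩ : ∃ i, μ i ≠ 0 := by
      by_contra h
      push Not at h
      have : μ = 0 := Finsupp.ext h
      rw [this, map_zero] at hN
      exact absurd hN.symm N.succ_ne_zero
    have hle : Finsupp.single i 1 ≤ μ := Finsupp.single_le_iff.mpr (Nat.one_le_iff_ne_zero.mpr hi)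
    obtain ⟨μ', rfl⟩ := exists_add_of_le hle
    rw [add_comm] at hN ⊢
    rw [map_add, Finsupp.degree_single] at hN
    rw [expAnnih_add_single, Derivation.leibniz, ih μ' (by omega), map_add,
      MvPolynomial.pderiv_C, add_zero, smul_eq_mul, smul_eq_mul]
    by_cases hij : i = j
    · subst hij
      rw [MvPolynomial.pderiv_X_self, add_tsub_cancel_right, Finsupp.add_apply,
        Finsupp.single_eq_same, mul_one]
      by_cases h0 : μ' i = 0
      · rw [h0]
        simp
      · obtain ⟨κ, rfl⟩ := exists_add_of_le (Finsupp.single_le_iff.mpr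
          (Nat.one_le_iff_ne_zero.mpr h0) : Finsupp.single i 1 ≤ μ')
        rw [add_tsub_cancel_left, add_comm (Finsupp.single i 1) κ, expAnnih_add_single]
        push_cast
        ring
    · have h1 : μ' + Finsupp.single i 1 - Finsupp.single j 1 =
          μ' - Finsupp.single j 1 + Finsupp.single i 1 := by
        ext k
        simp only [Finsupp.coe_add, Finsupp.coe_tsub, Pi.add_apply, Pi.sub_apply,
          Finsupp.single_apply]
        split_ifs with h2 h3 <;> first | omega | exact absurd (h2.trans h3.symm) hij
      rw [MvPolynomial.pderiv_X_of_ne hij, mul_zero, add_zero, h1, expAnnih_add_single,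
        Finsupp.add_apply, Finsupp.single_eq_of_ne (Ne.symm hij), add_zero]
      ring

theorem expCreate_apply (A : Mode n → Corr m) (ν : State n) :
    MvPowerSeries.coeff ν (expCreate A) = contractionWeight A ν := by
  change (ν.prod fun j k => cst m ((k.factorial : ℂ)⁻¹) * A j ^ k) = _
  rw [contractionWeight]
  refine Finsupp.prod_congr fun j _ => ?_
  rw [map_inv₀, map_natCast]

theorem pderiv_expCreate (A : Mode n → Corr m) (j : Mode n) :
    MvPowerSeries.pderiv (Corr m) j (expCreate A) = MvPowerSeries.C (A j) * expCreate A := by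
  ext ν
  rw [MvPowerSeries.coeff_pderiv, MvPowerSeries.coeff_C_mul, expCreate_apply, expCreate_apply,
    ← contractionWeight_add_single]
  push_cast
  ring

theorem matrixElement_zero (A B : Mode n → Corr m) : matrixElement ρ A B 0 0 = 1 := by
  rw [matrixElement, normalOrderedExp, expAnnih_one, MvPolynomial.coe_one, mul_one,
    expCreate_apply, contractionWeight, Finsupp.prod_zero_index]

/-- An incoming quantum is either contracted with the annihilation part or passes through to the
outgoing state. In generating functions, translation sends the variable `X_j` to `X_j` plus a
constant. -/
theorem matrixElement_annih (A B : Mode n → Corr m) (ν μ : State n) (j : Mode n) (hμ : μ j ≠ 0) :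
    matrixElement ρ A B ν μ =
      B j * bracket ρ n m j * matrixElement ρ A B ν (μ - Finsupp.single j 1) +
        if ν j = 0 then 0 else
          matrixElement ρ A B (ν - Finsupp.single j 1) (μ - Finsupp.single j 1) := by
  classical
  obtain ⟨μ', rfl⟩ := exists_add_of_le (Finsupp.single_le_iff.mpr
    (Nat.one_le_iff_ne_zero.mpr hμ) : Finsupp.single j 1 ≤ μ)
  rw [add_tsub_cancel_left, add_comm (Finsupp.single j 1) μ']
  simp only [matrixElement, normalOrderedExp]
  rw [expAnnih_add_single, MvPolynomial.coe_mul, MvPolynomial.coe_add, MvPolynomial.coe_X,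
    MvPolynomial.coe_C]
  set E : FockHat n m := expCreate A * (expAnnih ρ B (MvPolynomial.monomial μ' 1) : FockHat n m)
    with hE
  have : expCreate A * ((MvPowerSeries.X j + MvPowerSeries.C (B j * bracket ρ n m j)) *
      (expAnnih ρ B (MvPolynomial.monomial μ' 1) : FockHat n m)) =
      MvPowerSeries.C (B j * bracket ρ n m j) * E + MvPowerSeries.X j * E := by
    rw [hE]
    ring
  rw [this, map_add, MvPowerSeries.coeff_C_mul, MvPowerSeries.X, MvPowerSeries.coeff_monomial_mul,
    one_mul]
  congr 1
  by_cases h0 : ν j = 0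
  · rw [if_pos h0, if_neg]
    intro h
    have := Finsupp.single_le_iff.mp h
    omega
  · rw [if_neg h0, if_pos (Finsupp.single_le_iff.mpr (Nat.one_le_iff_ne_zero.mpr h0))]

/-- The derivative in the outgoing variable falls either on the creation exponential, which gives `A
j`, or on the translated incoming monomial, which removes an incoming quantum. -/
theorem matrixElement_create (A B : Mode n → Corr m) (ν μ : State n) (j : Mode n) (hν : ν j ≠ 0) :
    (ν j : Corr m) * matrixElement ρ A B ν μ =
      A j * matrixElement ρ A B (ν - Finsupp.single j 1) μ +
        μ j * matrixElement ρ A B (ν - Finsupp.single j 1) (μ - Finsupp.single j 1) := by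
  obtain ⟨ν', rfl⟩ := exists_add_of_le (Finsupp.single_le_iff.mpr
    (Nat.one_le_iff_ne_zero.mpr hν) : Finsupp.single j 1 ≤ ν)
  rw [add_tsub_cancel_left, add_comm (Finsupp.single j 1) ν']
  have h := congrArg (MvPowerSeries.coeff ν') (Derivation.leibniz
    (MvPowerSeries.pderiv (Corr m) j) (expCreate A)
      (expAnnih ρ B (MvPolynomial.monomial μ 1) : FockHat n m))
  rw [MvPowerSeries.coeff_pderiv, pderiv_expCreate, MvPowerSeries.pderiv_coe, pderiv_expAnnih,
    smul_eq_mul, smul_eq_mul, MvPolynomial.coe_mul] at h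
  have h1 : ((μ j : Fock n m) : FockHat n m) = MvPowerSeries.C (μ j : Corr m) := by
    rw [← map_natCast (MvPolynomial.C (R := Corr m) (σ := Mode n)), MvPolynomial.coe_C]
  rw [h1] at h
  simp only [matrixElement, normalOrderedExp]
  set E : FockHat n m := (expAnnih ρ B (MvPolynomial.monomial μ 1) : FockHat n m)
  set E' : FockHat n m :=
    (expAnnih ρ B (MvPolynomial.monomial (μ - Finsupp.single j 1) 1) : FockHat n m)
  have h2 : expCreate A * (MvPowerSeries.C (μ j : Corr m) * E') +
      E * (MvPowerSeries.C (A j) * expCreate A) =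
      MvPowerSeries.C (A j) * (expCreate A * E) +
        MvPowerSeries.C (μ j : Corr m) * (expCreate A * E') := by ring
  rw [h2, map_add, MvPowerSeries.coeff_C_mul, MvPowerSeries.coeff_C_mul] at h
  rw [← h, Finsupp.add_apply, Finsupp.single_eq_same]
  push_cast
  ring

end MatrixElements

/-! ## Formal sums over paths -/

section PathSums

variable {n m : ℕ}

theorem Corr.coeff_add (f g : Corr m) (N : ℤ) (v : Lex (Fin m → ℤ)) :
    (f + g).coeff N v = f.coeff N v + g.coeff N v := rfl

theorem Corr.coeff_zero (N : ℤ) (v : Lex (Fin m → ℤ)) : (0 : Corr m).coeff N v = 0 := rfl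

theorem Corr.coeff_sum {ι : Type} (s : Finset ι) (f : ι → Corr m) (N : ℤ) (v : Lex (Fin m → ℤ)) :
    (∑ i ∈ s, f i).coeff N v = ∑ i ∈ s, (f i).coeff N v := by
  classical
  induction s using Finset.induction_on with
  | empty => rfl
  | insert a s ha ih => rw [Finset.sum_insert ha, Finset.sum_insert ha, Corr.coeff_add, ih]

theorem Corr.coeff_cst_mul (c : ℂ) (f : Corr m) (N : ℤ) (v : Lex (Fin m → ℤ)) :
    (cst m c * f).coeff N v = c * f.coeff N v := by
  change (HahnSeries.coeff (HahnSeries.C (HahnSeries.C c) *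
    (show HahnSeries ℤ (ZSeries m) from f)) N).coeff v = _
  rw [HahnSeries.C_mul_eq_smul, HahnSeries.coeff_smul, smul_eq_mul, HahnSeries.C_mul_eq_smul,
    HahnSeries.coeff_smul, smul_eq_mul]
  rfl

theorem HasFormalSum.cst_mul {ι : Type} {f : ι → Corr m} {s : Corr m} (h : HasFormalSum f s)
    (c : ℂ) : HasFormalSum (fun i => cst m c * f i) (cst m c * s) := by
  intro N v
  obtain ⟨h1, h2⟩ := h N v
  simp only [Corr.coeff_cst_mul]
  refine ⟨h1.subset fun i hi => right_ne_zero_of_mul hi, ?_⟩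
  rw [h2, ← smul_eq_mul, smul_finsum]
  simp

theorem HasFormalSum.add {ι : Type} {f g : ι → Corr m} {s t : Corr m} (h : HasFormalSum f s)
    (h' : HasFormalSum g t) : HasFormalSum (fun i => f i + g i) (s + t) := by
  intro N v
  obtain ⟨h1, h2⟩ := h N v
  obtain ⟨h1', h2'⟩ := h' N v
  simp only [Corr.coeff_add]
  refine ⟨(h1.union h1').subset fun i hi => ?_, ?_⟩
  · by_contra hn
    rw [Set.mem_union, not_or] at hn
    apply hi
    rw [not_not.mp hn.1, not_not.mp hn.2, add_zero]
  · rw [finsum_add_distrib h1 h1', h2, h2']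

theorem HasFormalSum.zero {ι : Type} : HasFormalSum (fun _ : ι => (0 : Corr m)) 0 := by
  intro N v
  simp [Corr.coeff_zero]

theorem HasFormalSum.sum {ι κ : Type} (t : Finset κ) {f : κ → ι → Corr m} {s : κ → Corr m}
    (h : ∀ k, HasFormalSum (f k) (s k)) :
    HasFormalSum (fun i => ∑ k ∈ t, f k i) (∑ k ∈ t, s k) := by
  classical
  induction t using Finset.induction_on with
  | empty => simpa using HasFormalSum.zero
  | insert a t ha ih =>
    simp only [Finset.sum_insert ha]
    exact (h a).add ih

/-- Grouping the terms of a formal sum. -/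
theorem HasFormalSum.fiberwise {ι κ : Type} {f : ι → Corr m} {s : Corr m} (h : HasFormalSum f s)
    (φ : ι → κ) (fib : κ → Finset ι) (hfib : ∀ k i, i ∈ fib k ↔ φ i = k) :
    HasFormalSum (fun k => ∑ i ∈ fib k, f i) s := by
  classical
  intro N v
  obtain ⟨h1, h2⟩ := h N v
  simp only [Corr.coeff_sum]
  set T := h1.toFinset with hT
  have hsupp : ∀ k, k ∉ T.image φ → ∑ i ∈ fib k, (f i).coeff N v = 0 := by
    intro k hk
    refine Finset.sum_eq_zero fun i hi => ?_
    by_contra h0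
    exact hk (Finset.mem_image.mpr ⟨i, by simpa [hT] using h0, (hfib k i).mp hi⟩)
  refine ⟨(T.image φ).finite_toSet.subset fun k hk => ?_, ?_⟩
  · by_contra hk'
    exact hk (hsupp k hk')
  · rw [h2, finsum_eq_sum_of_support_subset (s := T) _ (fun i hi => by simpa [hT] using hi),
      finsum_eq_sum_of_support_subset (s := T.image φ) _ (fun k hk => by
        by_contra hk'
        exact hk (hsupp k hk')),
      ← Finset.sum_fiberwise_of_maps_to (fun i hi => Finset.mem_image_of_mem φ hi)]
    refine Finset.sum_congr rfl fun k _ => ?_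
    refine Finset.sum_subset (fun i hi => ?_) fun i hi hi' => ?_
    · exact (hfib k i).mpr (Finset.mem_filter.mp hi).2
    · by_contra h0
      exact hi' (Finset.mem_filter.mpr ⟨by simpa [hT] using h0, (hfib k i).mp hi⟩)

/-- A path as a sequence of states. -/
def Path.toSeq (ν : Path n m) (k : ℕ) : State n :=
  if h : k < m + 1 then ν.1 ⟨k, h⟩ else 0

/-- The vacuum expectation value of a product of normal ordered exponentials (Wick's theorem). -/
theorem hasFormalSum_pathProd (ρ : Fin 3 → ℂ) (A B : Fin m → Mode n → Corr m)
    {c : OpPair m × Mode n → RatioSeries m} {S : RatioSeries m} (hS : FSum c S)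
    (hc0 : ∀ P, MvPowerSeries.constantCoeff (c P) = 0)
    (hc : ∀ x j, expand m (c (x, j)) = B x.1.1 j * bracket ρ n m j * A x.1.2 j) :
    HasFormalSum (fun ν : Path n m =>
      ∏ i : Fin m, matrixElement ρ (A i) (B i) (ν.1 i.castSucc) (ν.1 i.succ))
      (expand m (rexp S)) := by
  classical
  -- The combinatorics of paths uses positions in `ℕ`; the values beyond `m` are never met.
  set A' : ℕ → Mode n → Corr m := fun i => if h : i < m then A ⟨i, h⟩ else 0 with hA'
  set B' : ℕ → Mode n → Corr m := fun i => if h : i < m then B ⟨i, h⟩ else 0 with hB'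
  have eA : ∀ i : Fin m, A' i = A i := fun i => dif_pos i.2
  have eB : ∀ i : Fin m, B' i = B i := fun i => dif_pos i.2
  -- The exponential as a sum over independent contraction numbers. Grouped by the path of
  -- occupation numbers they produce, its terms become the path amplitudes.
  have h := (fsum_prod_pow_div_factorial hS hc0).expand
  have hw : ∀ N : OpPair m × Mode n →₀ ℕ,
      expand m (N.prod fun i k => MvPowerSeries.C ((k.factorial : ℂ)⁻¹) * c i ^ k) =
        contractionWeight (fun P => expand m (c P)) N := by
    intro N
    rw [map_finsuppProd, contractionWeight]
    refine Finsupp.prod_congr fun j _ => ?_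
    rw [map_mul, map_pow, expand_C, map_inv₀, map_natCast]
  simp only [hw] at h
  have hseq0 : ∀ ν : Path n m, ν.toSeq 0 = 0 := fun ν => by
    rw [Path.toSeq, dif_pos (Nat.succ_pos m)]
    exact ν.2.1
  have hseqm : ∀ ν : Path n m, ∀ k, m ≤ k → ν.toSeq k = 0 := fun ν k hk => by
    rw [Path.toSeq]
    split_ifs with h
    · have : k = m := by omega
      subst this
      exact ν.2.2
    · rfl
  set φ : (OpPair m × Mode n →₀ ℕ) → Path n m := fun N =>
    ⟨fun k => profile N k, profile_eq_zero N (Or.inl rfl),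
      profile_eq_zero N (Or.inr (by simp))⟩ with hφ
  have hfib : ∀ (ν : Path n m) N, N ∈ (finite_fiber_profile (m := m) ν.toSeq).toFinset ↔
      φ N = ν := by
    intro ν N
    simp only [Set.Finite.mem_toFinset, Set.mem_ofPred_eq]
    constructor
    · intro hN
      apply Subtype.ext
      funext k
      change profile N k = _
      rw [hN, Path.toSeq, dif_pos k.2]
    · rintro rfl
      funext k
      rw [Path.toSeq]
      split_ifs with hk
      · rfl
      · exact profile_eq_zero N (Or.inr (by omega))
  have key := h.fiberwise φ _ hfib
  have hprod : ∀ ν : Path n m,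
      ∏ i : Fin m, matrixElement ρ (A i) (B i) (ν.1 i.castSucc) (ν.1 i.succ) =
      pathProd (fun i => matrixElement ρ (A' i) (B' i)) m ν.toSeq := by
    intro ν
    rw [pathProd, Finset.prod_range]
    refine Finset.prod_congr rfl fun i _ => ?_
    have h1 : ν.toSeq i = ν.1 i.castSucc := dif_pos (by omega)
    have h2 : ν.toSeq (i + 1) = ν.1 i.succ := dif_pos (by omega)
    rw [eA, eB, h1, h2]
  simp only [hprod]
  convert key using 2 with ν
  exact pathProd_eq_sum_fiber (A := A') (b := fun i j => B' i j * bracket ρ n m j)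
    (fun i => matrixElement_zero ρ _ _)
    (fun i ν μ j hν => matrixElement_create ρ _ _ ν μ j hν)
    (fun i ν μ j hμ => matrixElement_annih ρ _ _ ν μ j hμ) _
    (fun x j => by rw [hc, eA, eB]) ν.toSeq (hseq0 ν) (hseqm ν)

end PathSums

/-! ## Contractions of the decoupled vertex operators -/

section Contractions

variable {n m : ℕ}

/-- The annihilation part of the decoupled vertex operator, for `H = q₃^{r/2}`. -/
def annihCoef (H : ℂ) (j k : Fin n) : ℂ :=
  -(if k = j then (H ^ (j : ℕ))⁻¹ / (H ^ 2 - 1) else 0) +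
    (H ^ n)⁻¹ * H ^ (k : ℕ) / (H ^ n - (H ^ n)⁻¹)

/-- The creation part of the decoupled vertex operator, for `H = q₃^{r/2}`. -/
def createCoef (H : ℂ) (j k : Fin n) : ℂ :=
  -((H ^ n)⁻¹ * H ^ ((k : ℕ) + 1) / (H ^ n - (H ^ n)⁻¹)) -
    (if k < j then H ^ ((k : ℕ) + 1) else 0) + if k = j then H ^ (j : ℕ) / (H - H⁻¹) else 0

theorem sum_fin_lt_pow (z : ℂ) (j : Fin n) :
    ∑ k : Fin n, (if k < j then z ^ (k : ℕ) else 0) = ∑ k ∈ Finset.range j, z ^ k := by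
  rw [← Finset.sum_filter]
  refine Finset.sum_bij' (fun k _ => (k : ℕ)) (fun k hk => ⟨k, ?_⟩) ?_ ?_ ?_ ?_ ?_
  · have := Finset.mem_range.mp hk
    omega
  · intro k hk
    exact Finset.mem_range.mpr (Finset.mem_filter.mp hk).2
  · intro k hk
    exact Finset.mem_filter.mpr ⟨Finset.mem_univ _, Finset.mem_range.mp hk⟩
  all_goals intros; rfl

/-- The creation coefficients are orthogonal to the vector `(H^k)_k` which is the contribution of
`β`; this is the decoupling effected by `α`. Only the annihilation coefficient of the `j`-th tensor
factor survives, and it picks out `createCoef H j' j`, whose three parts give the three terms. -/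
theorem sum_annihCoef_mul_createCoef {H : ℂ} (h0 : H ≠ 0) (h2 : H ^ 2 ≠ 1)
    (hn : (H ^ n) ^ 2 ≠ 1) (j j' : Fin n) :
    (H - H⁻¹) * ∑ k, annihCoef H j k * createCoef H j' k =
      (H ^ n)⁻¹ / (H ^ n - (H ^ n)⁻¹) + (if j < j' then 1 else 0) -
        if j = j' then 1 / (H ^ 2 - 1) else 0 := by
  set c := H ^ n with hc
  have hc0 : c ≠ 0 := pow_ne_zero n h0
  have hΔ : c - c⁻¹ ≠ 0 := by
    intro h
    apply hn
    have : c * (c - c⁻¹) = 0 := by rw [h, mul_zero]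
    rw [mul_sub, mul_inv_cancel₀ hc0] at this
    linear_combination this
  have hs : H ^ 2 - 1 ≠ 0 := sub_ne_zero.mpr h2
  have hD : H - H⁻¹ = (H ^ 2 - 1) / H := by field_simp
  have hD0 : H - H⁻¹ ≠ 0 := by rw [hD]; exact div_ne_zero hs h0
  have hsq : c * c⁻¹ = 1 := mul_inv_cancel₀ hc0
  -- the part of the annihilation operators coming from `β` contracts to zero
  have hgeom : ∀ K : ℕ, (∑ k ∈ Finset.range K, (H ^ 2) ^ k) = ((H ^ 2) ^ K - 1) / (H ^ 2 - 1) :=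
    fun K => geom_sum_eq h2 K
  have hzero : ∑ k : Fin n, H ^ (k : ℕ) * createCoef H j' k = 0 := by
    have e1 : ∀ k : Fin n, H ^ (k : ℕ) * createCoef H j' k =
        -(c⁻¹ * H / (c - c⁻¹)) * (H ^ 2) ^ (k : ℕ) -
          H * (if k < j' then (H ^ 2) ^ (k : ℕ) else 0) +
          if k = j' then (H ^ 2) ^ (j' : ℕ) / (H - H⁻¹) else 0 := by
      intro k
      have e2 : (H ^ 2) ^ (k : ℕ) = H ^ (k : ℕ) * H ^ (k : ℕ) := by rw [← pow_mul]; ring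
      rw [createCoef, ← hc]
      by_cases hk : k = j'
      · subst hk
        rw [if_pos rfl, if_pos rfl, if_neg (lt_irrefl k), if_neg (lt_irrefl k), e2, pow_succ]
        ring
      · rw [if_neg hk, if_neg hk, e2, pow_succ]
        split_ifs <;> ring
    simp only [e1]
    rw [Finset.sum_add_distrib, Finset.sum_sub_distrib, ← Finset.mul_sum, ← Finset.mul_sum,
      sum_fin_lt_pow, hgeom, Fin.sum_univ_eq_sum_range (fun k => (H ^ 2) ^ k), hgeom,
      Finset.sum_ite_eq' Finset.univ j', if_pos (Finset.mem_univ _), hD]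
    have hcc : (H ^ 2) ^ n = c ^ 2 := by rw [hc, ← pow_mul, ← pow_mul, mul_comm]
    have hΔ' : c - c⁻¹ = (c ^ 2 - 1) / c := by field_simp
    rw [hcc, hΔ']
    have h3 : c ^ 2 - 1 ≠ 0 := sub_ne_zero.mpr hn
    field_simp
    ring
  have hsplit : ∀ k : Fin n, annihCoef H j k * createCoef H j' k =
      -((if k = j then (H ^ (j : ℕ))⁻¹ / (H ^ 2 - 1) * createCoef H j' k else 0)) +
        c⁻¹ / (c - c⁻¹) * (H ^ (k : ℕ) * createCoef H j' k) := by
    intro k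
    rw [annihCoef, ← hc]
    split_ifs <;> ring
  simp only [hsplit]
  rw [Finset.sum_add_distrib, ← Finset.mul_sum, hzero, mul_zero, add_zero, Finset.sum_neg_distrib,
    Finset.sum_ite_eq' Finset.univ j, if_pos (Finset.mem_univ _), createCoef, ← hc]
  have hj : H ^ (j : ℕ) ≠ 0 := pow_ne_zero _ h0
  have hpow : (H ^ (j : ℕ))⁻¹ * H ^ ((j : ℕ) + 1) = H := by
    rw [pow_succ, ← mul_assoc, inv_mul_cancel₀ hj, one_mul]
  have hA : (H - H⁻¹) * ((H ^ (j : ℕ))⁻¹ / (H ^ 2 - 1)) * H ^ ((j : ℕ) + 1) = 1 := by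
    calc _ = (H - H⁻¹) / (H ^ 2 - 1) * ((H ^ (j : ℕ))⁻¹ * H ^ ((j : ℕ) + 1)) := by ring
      _ = 1 := by
        rw [hpow, hD]
        field_simp
  by_cases hjj : j = j'
  · subst hjj
    rw [if_pos rfl, if_pos rfl, if_neg (lt_irrefl j), if_neg (lt_irrefl j)]
    have hB : (H - H⁻¹) * ((H ^ (j : ℕ))⁻¹ / (H ^ 2 - 1)) * (H ^ (j : ℕ) / (H - H⁻¹)) =
        1 / (H ^ 2 - 1) := by
      field_simp
    linear_combination (c⁻¹ / (c - c⁻¹)) * hA - hB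
  · rw [if_neg hjj, if_neg hjj]
    by_cases hlt : j < j'
    · rw [if_pos hlt, if_pos hlt]
      linear_combination (c⁻¹ / (c - c⁻¹) + 1) * hA
    · rw [if_neg hlt, if_neg hlt]
      linear_combination (c⁻¹ / (c - c⁻¹)) * hA

end Contractions

/-! ### The coefficients of the decoupled vertex operators, mode by mode -/

section Exponents

variable {n m : ℕ} {ρ : Fin 3 → ℂ}

/-- The roles of shift and mode are exchanged, so that all coefficients become rational functions of
the single number `H = q₃^{r/2}`. -/
theorem qHalf_pow (a : ℤ) (r : ℕ) :
    qHalf ρ 2 a ^ r = qHalf ρ 2 (r : ℕ) ^ a := by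
  rw [qHalf, qHalf, ← zpow_natCast, ← zpow_mul, ← zpow_mul]
  congr 1
  ring

theorem qHalf_ne_zero (h : ρ 2 ≠ 0) (a : ℤ) : qHalf ρ 2 a ≠ 0 := zpow_ne_zero _ h

theorem centralPow_eq (r : ℕ) : centralPow ρ n r = qHalf ρ 2 r ^ n := by
  rw [centralPow, qHalf, qHalf, ← zpow_natCast, ← zpow_mul]
  congr 1
  ring

theorem centralPow_neg_eq (r : ℕ) : centralPow ρ n (-(r : ℤ)) = (qHalf ρ 2 r ^ n)⁻¹ := by
  rw [← centralPow_eq, centralPow, centralPow, qHalf, qHalf, ← zpow_neg]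
  congr 1
  ring

theorem qInt_eq (i : Fin 3) (r : ℕ) : qInt ρ i r = qHalf ρ i r ^ 2 := by
  rw [qInt, qHalf, ← zpow_natCast, ← zpow_mul]
  congr 1
  push_cast
  ring

theorem qInt_neg_eq (r : ℕ) : qInt ρ 2 (-(r : ℤ)) = (qHalf ρ 2 r ^ 2)⁻¹ := by
  rw [← qInt_eq, qInt, qInt, ← zpow_neg]
  congr 1
  ring

theorem qDiff_eq (i : Fin 3) (r : ℕ) : qDiff ρ i r = qHalf ρ i r - (qHalf ρ i r)⁻¹ := by
  rw [qDiff, qHalf, qHalf, ← zpow_neg]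
  congr 2
  ring

theorem qQuarter_neg_eq (r : ℕ) : qQuarter ρ 2 (-(r : ℤ)) = (qQuarter ρ 2 r)⁻¹ := zpow_neg _ _

theorem cst_mul_pow (a : ℂ) (x : Corr m) (r : ℕ) : (cst m a * x) ^ r = cst m (a ^ r) * x ^ r := by
  rw [mul_pow, map_pow]

theorem cst_mul_inv_pow (a : ℂ) (x : Corr m) (r : ℕ) :
    (cst m a * x)⁻¹ ^ r = cst m (a ^ r)⁻¹ * x⁻¹ ^ r := by
  rw [mul_inv, mul_pow, map_inv₀, map_pow, inv_pow]

theorem decoupledAnnih_inl (j k : Fin n) (r : ℕ+) (x : Corr m) :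
    decoupledAnnih ρ j x (.inl (k, r)) = cst m (qQuarter ρ 2 (r : ℕ) *
      annihCoef (qHalf ρ 2 (r : ℕ)) j k) * (aFac ρ m r * x⁻¹ ^ (r : ℕ)) := by
  have hβ : (betaExp ρ x k).aPos r = cst m (qQuarter ρ 2 (r : ℕ) *
      ((qHalf ρ 2 (r : ℕ) ^ n)⁻¹ * qHalf ρ 2 (r : ℕ) ^ (k : ℕ) /
        (qHalf ρ 2 (r : ℕ) ^ n - (qHalf ρ 2 (r : ℕ) ^ n)⁻¹))) * (aFac ρ m r * x⁻¹ ^ (r : ℕ)) := by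
    change cDiffInv ρ n m r * (cst m (centralPow ρ n (-(r : ℕ))) *
      (aFac ρ m r * cst m (qQuarter ρ 2 (r : ℕ)) * (cst m (qHalf ρ 2 (-(k : ℕ))) * x)⁻¹ ^ (r : ℕ))) = _
    rw [cst_mul_inv_pow, qHalf_pow, zpow_neg, inv_inv, zpow_natCast, cDiffInv, centralPow_eq,
      centralPow_neg_eq, div_eq_mul_inv]
    simp only [map_mul]
    ring
  have hV : (vertexExp ρ j x k).aPos r = cst m (qQuarter ρ 2 (r : ℕ) *
      -(if k = j then (qHalf ρ 2 (r : ℕ) ^ (j : ℕ))⁻¹ / (qHalf ρ 2 (r : ℕ) ^ 2 - 1) else 0)) *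
        (aFac ρ m r * x⁻¹ ^ (r : ℕ)) := by
    rw [vertexExp]
    by_cases hk : k = j
    · subst hk
      rw [if_neg (lt_irrefl k), if_pos rfl, if_pos rfl]
      change -(aFac ρ m r * cst m (qQuarter ρ 2 (r : ℕ) / (qInt ρ 2 (r : ℕ) - 1)) *
        (cst m (qHalf ρ 2 (k : ℕ)) * x)⁻¹ ^ (r : ℕ)) = _
      rw [cst_mul_inv_pow, qHalf_pow, zpow_natCast, qInt_eq, div_eq_mul_inv, div_eq_mul_inv]
      simp only [map_mul, map_neg]
      ring
    · rw [if_neg hk, if_neg hk, neg_zero, mul_zero, map_zero, zero_mul]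
      split_ifs <;> rfl
  change (vertexExp ρ j x k).aPos r + (betaExp ρ x k).aPos r = _
  rw [hβ, hV, annihCoef, ← add_mul, ← map_add, ← mul_add]

theorem decoupledCreate_inl (h : ρ 2 ≠ 0) (j k : Fin n) (r : ℕ+) (x : Corr m) :
    decoupledCreate ρ j x (.inl (k, r)) = cst m ((qQuarter ρ 2 (r : ℕ))⁻¹ *
      createCoef (qHalf ρ 2 (r : ℕ)) j k) * (aFac ρ m r * x ^ (r : ℕ)) := by
  have hH := qHalf_ne_zero h (r : ℕ)
  have hα : (alphaExp ρ x k).aNeg r = cst m ((qQuarter ρ 2 (r : ℕ))⁻¹ *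
      -((qHalf ρ 2 (r : ℕ) ^ n)⁻¹ * qHalf ρ 2 (r : ℕ) ^ ((k : ℕ) + 1) /
        (qHalf ρ 2 (r : ℕ) ^ n - (qHalf ρ 2 (r : ℕ) ^ n)⁻¹))) * (aFac ρ m r * x ^ (r : ℕ)) := by
    change cDiffInv ρ n m r * -(aFac ρ m r * cst m (qQuarter ρ 2 (-(r : ℕ))) *
      (cst m (qHalf ρ 2 (-((n : ℤ) - 1 - (k : ℕ)))) * x) ^ (r : ℕ)) = _
    have e : qHalf ρ 2 (-((n : ℤ) - 1 - (k : ℕ))) ^ (r : ℕ) =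
        (qHalf ρ 2 (r : ℕ) ^ n)⁻¹ * qHalf ρ 2 (r : ℕ) ^ ((k : ℕ) + 1) := by
      rw [qHalf_pow, ← zpow_natCast, ← zpow_natCast, ← zpow_neg, ← zpow_add₀ hH]
      congr 1
      push_cast
      ring
    rw [cst_mul_pow, e, cDiffInv, centralPow_eq, centralPow_neg_eq, qQuarter_neg_eq, div_eq_mul_inv]
    simp only [map_mul, map_neg]
    ring
  have hV : (vertexExp ρ j x k).aNeg r = cst m ((qQuarter ρ 2 (r : ℕ))⁻¹ *
      (-(if k < j then qHalf ρ 2 (r : ℕ) ^ ((k : ℕ) + 1) else 0) + if k = j then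
        qHalf ρ 2 (r : ℕ) ^ (j : ℕ) / (qHalf ρ 2 (r : ℕ) - (qHalf ρ 2 (r : ℕ))⁻¹) else 0)) *
        (aFac ρ m r * x ^ (r : ℕ)) := by
    rw [vertexExp]
    by_cases hk : k = j
    · subst hk
      rw [if_neg (lt_irrefl k), if_pos rfl, if_pos rfl, if_neg (lt_irrefl k), neg_zero, zero_add]
      change aFac ρ m r * cst m (qQuarter ρ 2 (-(r : ℕ)) / qDiff ρ 2 (r : ℕ)) *
        (cst m (qHalf ρ 2 (k : ℕ)) * x) ^ (r : ℕ) = _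
      rw [cst_mul_pow, qHalf_pow, zpow_natCast, qDiff_eq, qQuarter_neg_eq, div_eq_mul_inv,
        div_eq_mul_inv]
      simp only [map_mul]
      ring
    · rw [if_neg hk, if_neg hk, add_zero]
      by_cases hlt : k < j
      · rw [if_pos hlt, if_pos hlt]
        change -(aFac ρ m r * cst m (qQuarter ρ 2 (-(r : ℕ))) *
          (cst m (qHalf ρ 2 ((k : ℕ) + 1)) * x) ^ (r : ℕ)) = _
        have e : qHalf ρ 2 (((k : ℕ) : ℤ) + 1) ^ (r : ℕ) =
            qHalf ρ 2 (r : ℕ) ^ ((k : ℕ) + 1) := by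
          rw [qHalf_pow, ← zpow_natCast]
          congr 1
        rw [cst_mul_pow, e, qQuarter_neg_eq]
        simp only [map_mul, map_neg]
        ring
      · rw [if_neg hlt, if_neg hlt, neg_zero, mul_zero, map_zero, zero_mul]
        rfl
  change (alphaExp ρ x k).aNeg r + (vertexExp ρ j x k).aNeg r = _
  have e₁ : ∀ a b c : ℂ, a - b + c = a + (-b + c) := fun _ _ _ => by ring
  rw [hα, hV, createCoef, e₁, ← add_mul, ← map_add, ← mul_add]

/-- The `b`-modes have the coefficients of the `a`-modes with `H` replaced by `H⁻¹`. The sign and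
the quarter power cancel against those of the creation part. -/
theorem decoupledAnnih_inr (j k : Fin n) (r : ℕ+) (x : Corr m) :
    decoupledAnnih ρ j x (.inr (k, r)) = cst m (-(qQuarter ρ 2 (r : ℕ))⁻¹ *
      annihCoef (qHalf ρ 2 (r : ℕ))⁻¹ j k) * (bFac ρ m r * x ^ (r : ℕ)) := by
  have hβ : (betaExp ρ x k).bPos r = cst m (-(qQuarter ρ 2 (r : ℕ))⁻¹ *
      (((qHalf ρ 2 (r : ℕ))⁻¹ ^ n)⁻¹ * (qHalf ρ 2 (r : ℕ))⁻¹ ^ (k : ℕ) /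
        ((qHalf ρ 2 (r : ℕ))⁻¹ ^ n - ((qHalf ρ 2 (r : ℕ))⁻¹ ^ n)⁻¹))) *
          (bFac ρ m r * x ^ (r : ℕ)) := by
    change cDiffInv ρ n m r * -(cst m (centralPow ρ n (r : ℕ)) *
      -(bFac ρ m r * cst m (qQuarter ρ 2 (-(r : ℕ))) *
        (cst m (qHalf ρ 2 (-(k : ℕ))) * x) ^ (r : ℕ))) = _
    have e : ∀ c : ℂ, c⁻¹ - c = -(c - c⁻¹) := fun c => by ring
    rw [cst_mul_pow, qHalf_pow, zpow_neg, zpow_natCast, cDiffInv, centralPow_eq,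
      centralPow_neg_eq, inv_pow, inv_inv, inv_pow, e, qQuarter_neg_eq, div_eq_mul_inv, inv_neg]
    simp only [map_mul, map_neg]
    ring
  have hV : (vertexExp ρ j x k).bPos r = cst m (-(qQuarter ρ 2 (r : ℕ))⁻¹ *
      -(if k = j then ((qHalf ρ 2 (r : ℕ))⁻¹ ^ (j : ℕ))⁻¹ / ((qHalf ρ 2 (r : ℕ))⁻¹ ^ 2 - 1)
        else 0)) * (bFac ρ m r * x ^ (r : ℕ)) := by
    rw [vertexExp]
    by_cases hk : k = j
    · subst hk
      rw [if_neg (lt_irrefl k), if_pos rfl, if_pos rfl]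
      change bFac ρ m r * cst m (qQuarter ρ 2 (-(r : ℕ)) / (qInt ρ 2 (-(r : ℕ)) - 1)) *
        (cst m (qHalf ρ 2 (k : ℕ)) * x) ^ (r : ℕ) = _
      rw [cst_mul_pow, qHalf_pow, zpow_natCast, qInt_neg_eq, qQuarter_neg_eq, inv_pow, inv_inv,
        inv_pow, div_eq_mul_inv, div_eq_mul_inv]
      simp only [map_mul, map_neg]
      ring
    · rw [if_neg hk, if_neg hk, neg_zero, mul_zero, map_zero, zero_mul]
      split_ifs <;> rfl
  change (vertexExp ρ j x k).bPos r + (betaExp ρ x k).bPos r = _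
  rw [hβ, hV, annihCoef, ← add_mul, ← map_add, ← mul_add]

theorem decoupledCreate_inr (h : ρ 2 ≠ 0) (j k : Fin n) (r : ℕ+) (x : Corr m) :
    decoupledCreate ρ j x (.inr (k, r)) = cst m (-qQuarter ρ 2 (r : ℕ) *
      createCoef (qHalf ρ 2 (r : ℕ))⁻¹ j k) * (bFac ρ m r * x⁻¹ ^ (r : ℕ)) := by
  have hH := qHalf_ne_zero h (r : ℕ)
  have e0 : ∀ c : ℂ, c⁻¹ - c = -(c - c⁻¹) := fun c => by ring
  have hα : (alphaExp ρ x k).bNeg r = cst m (-qQuarter ρ 2 (r : ℕ) *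
      -(((qHalf ρ 2 (r : ℕ))⁻¹ ^ n)⁻¹ * (qHalf ρ 2 (r : ℕ))⁻¹ ^ ((k : ℕ) + 1) /
        ((qHalf ρ 2 (r : ℕ))⁻¹ ^ n - ((qHalf ρ 2 (r : ℕ))⁻¹ ^ n)⁻¹))) *
          (bFac ρ m r * x⁻¹ ^ (r : ℕ)) := by
    change -(cDiffInv ρ n m r * (bFac ρ m r * cst m (qQuarter ρ 2 (r : ℕ)) *
      (cst m (qHalf ρ 2 (-((n : ℤ) - 1 - (k : ℕ)))) * x)⁻¹ ^ (r : ℕ))) = _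
    have e : (qHalf ρ 2 (-((n : ℤ) - 1 - (k : ℕ))) ^ (r : ℕ))⁻¹ =
        qHalf ρ 2 (r : ℕ) ^ n * (qHalf ρ 2 (r : ℕ) ^ ((k : ℕ) + 1))⁻¹ := by
      rw [qHalf_pow, ← zpow_natCast, ← zpow_natCast, ← zpow_neg, ← zpow_neg, ← zpow_add₀ hH]
      congr 1
      push_cast
      ring
    rw [cst_mul_inv_pow, e, cDiffInv, centralPow_eq, centralPow_neg_eq, inv_pow (qHalf ρ 2 (r : ℕ)), inv_inv,
      inv_pow (qHalf ρ 2 (r : ℕ)),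
      e0, div_eq_mul_inv, inv_neg]
    simp only [map_mul, map_neg]
    ring
  have hV : (vertexExp ρ j x k).bNeg r = cst m (-qQuarter ρ 2 (r : ℕ) *
      (-(if k < j then (qHalf ρ 2 (r : ℕ))⁻¹ ^ ((k : ℕ) + 1) else 0) + if k = j then
        (qHalf ρ 2 (r : ℕ))⁻¹ ^ (j : ℕ) / ((qHalf ρ 2 (r : ℕ))⁻¹ - (qHalf ρ 2 (r : ℕ))⁻¹⁻¹)
          else 0)) * (bFac ρ m r * x⁻¹ ^ (r : ℕ)) := by
    rw [vertexExp]
    by_cases hk : k = j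
    · subst hk
      rw [if_neg (lt_irrefl k), if_pos rfl, if_pos rfl, if_neg (lt_irrefl k), neg_zero, zero_add]
      change bFac ρ m r * cst m (qQuarter ρ 2 (r : ℕ) / qDiff ρ 2 (r : ℕ)) *
        (cst m (qHalf ρ 2 (k : ℕ)) * x)⁻¹ ^ (r : ℕ) = _
      rw [cst_mul_inv_pow, qHalf_pow, zpow_natCast, qDiff_eq, inv_inv, e0, inv_pow (qHalf ρ 2 (r : ℕ)),
        div_eq_mul_inv, div_eq_mul_inv, inv_neg]
      simp only [map_mul, map_neg]
      ring
    · rw [if_neg hk, if_neg hk, add_zero]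
      by_cases hlt : k < j
      · rw [if_pos hlt, if_pos hlt]
        change bFac ρ m r * cst m (qQuarter ρ 2 (r : ℕ)) *
          (cst m (qHalf ρ 2 ((k : ℕ) + 1)) * x)⁻¹ ^ (r : ℕ) = _
        have e : qHalf ρ 2 (((k : ℕ) : ℤ) + 1) ^ (r : ℕ) =
            qHalf ρ 2 (r : ℕ) ^ ((k : ℕ) + 1) := by
          rw [qHalf_pow, ← zpow_natCast]
          congr 1
        rw [cst_mul_inv_pow, e, inv_pow (qHalf ρ 2 (r : ℕ))]
        simp only [map_mul, map_neg]
        ring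
      · rw [if_neg hlt, if_neg hlt, neg_zero, mul_zero, map_zero, zero_mul]
        rfl
  change (alphaExp ρ x k).bNeg r + (vertexExp ρ j x k).bNeg r = _
  have e₁ : ∀ a b c : ℂ, a - b + c = a + (-b + c) := fun _ _ _ => by ring
  rw [hα, hV, createCoef, e₁, ← add_mul, ← map_add, ← mul_add]

end Exponents

/-! ## The contraction of two vertex operators -/

section PairContraction

variable {n m : ℕ} {ρ : Fin 3 → ℂ}

/-- The contraction of the `a`-modes of two vertex operators. -/
def aContraction (ρ : Fin 3 → ℂ) (j j' k : Fin n) (r : ℕ+) : ℂ :=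
  kappa ρ (r : ℕ) * ((qHalf ρ 2 (r : ℕ) - (qHalf ρ 2 (r : ℕ))⁻¹) *
    (annihCoef (qHalf ρ 2 (r : ℕ)) j k * createCoef (qHalf ρ 2 (r : ℕ)) j' k))

/-- The contraction of the `b`-modes of two vertex operators. -/
def bContraction (ρ : Fin 3 → ℂ) (j j' k : Fin n) (r : ℕ+) : ℂ :=
  kappa ρ (r : ℕ) * ((qHalf ρ 2 (r : ℕ) - (qHalf ρ 2 (r : ℕ))⁻¹) *
    (annihCoef (qHalf ρ 2 (r : ℕ))⁻¹ j k * createCoef (qHalf ρ 2 (r : ℕ))⁻¹ j' k))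

/-- The contraction of a single mode of two vertex operators. -/
def contraction (ρ : Fin 3 → ℂ) (j : Fin m → Fin n) : OpPair m × Mode n → RatioSeries m
  | (x, .inl (k, r)) => ratio x.1.1 x.1.2 ^ (r : ℕ) *
      (MvPowerSeries.C (aContraction ρ (j x.1.1) (j x.1.2) k r / (r : ℕ)) *
        (1 - ratioNome m ^ (r : ℕ))⁻¹)
  | (x, .inr (k, r)) => ratioDual x.1.1 x.1.2 ^ (r : ℕ) *
      (MvPowerSeries.C (bContraction ρ (j x.1.1) (j x.1.2) k r / (r : ℕ)) *
        (1 - ratioNome m ^ (r : ℕ))⁻¹)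

theorem constantCoeff_contraction (j : Fin m → Fin n) (P : OpPair m × Mode n) :
    MvPowerSeries.constantCoeff (contraction ρ j P) = 0 := by
  rcases P with ⟨x, ⟨k, r⟩ | ⟨k, r⟩⟩
  · rw [contraction, map_mul, map_pow, constantCoeff_ratio x.2, zero_pow r.ne_zero, zero_mul]
  · rw [contraction, map_mul, map_pow, constantCoeff_ratioDual, zero_pow r.ne_zero, zero_mul]

theorem contraction_fsum (j : Fin m → Fin n) :
    FSum (contraction ρ j) (∑ x : OpPair m,
      (ellLog (ratioNome m) (∑ k, aContraction ρ (j x.1.1) (j x.1.2) k) (ratio x.1.1 x.1.2) +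
        ellLog (ratioNome m) (∑ k, bContraction ρ (j x.1.1) (j x.1.2) k)
          (ratioDual x.1.1 x.1.2))) := by
  have h : ∀ x : OpPair m, FSum (fun μ => contraction ρ j (x, μ))
      (ellLog (ratioNome m) (∑ k, aContraction ρ (j x.1.1) (j x.1.2) k) (ratio x.1.1 x.1.2) +
        ellLog (ratioNome m) (∑ k, bContraction ρ (j x.1.1) (j x.1.2) k)
          (ratioDual x.1.1 x.1.2)) := by
    intro x
    rw [ellLog_sum _ _ _ (constantCoeff_ratio x.2), ellLog_sum _ _ _ (constantCoeff_ratioDual _ _)]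
    have h1 := FSum.prod fun k => ellLog_fsum (ratioNome m) (aContraction ρ (j x.1.1) (j x.1.2) k)
      (constantCoeff_ratio x.2)
    have h2 := FSum.prod fun k => ellLog_fsum (ratioNome m) (bContraction ρ (j x.1.1) (j x.1.2) k)
      (constantCoeff_ratioDual x.1.1 x.1.2)
    refine (h1.sumElim h2).congr ?_
    rintro (⟨k, r⟩ | ⟨k, r⟩) <;> rfl
  exact FSum.prod h

theorem expand_ratioNome : expand m (ratioNome m) = nome m := by
  rw [expand, RingHom.comp_apply, expandPow_ratioNome, ofPow_X]

theorem expand_ratio {i l : Fin m} (h : i < l) : expand m (ratio i l) = zc l / zc i := by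
  rw [expand, RingHom.comp_apply, expandPow_ratio h, ofPow_C, map_div₀]
  rfl

theorem zc_ne_zero (i : Fin m) : (zc i : Corr m) ≠ 0 :=
  (map_ne_zero (ofZ m)).mpr (zVar_ne_zero i)

theorem expand_ratioDual {i l : Fin m} (h : i < l) :
    expand m (ratioDual i l) = nome m * (zc l / zc i)⁻¹ := by
  have h0 : (zc l / zc i : Corr m) ≠ 0 := div_ne_zero (zc_ne_zero l) (zc_ne_zero i)
  have := congrArg (expand m) (ratio_mul_ratioDual i l)
  rw [map_mul, expand_ratio h, expand_ratioNome] at this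
  rw [← this, mul_comm, ← mul_assoc, inv_mul_cancel₀ h0, one_mul]

theorem constantCoeff_one_sub_nome (r : ℕ+) :
    MvPowerSeries.constantCoeff (1 - ratioNome m ^ (r : ℕ)) ≠ 0 := by
  rw [map_sub, map_one, map_pow, constantCoeff_ratioNome, zero_pow r.ne_zero, sub_zero]
  exact one_ne_zero

theorem expand_inv_one_sub_nome (r : ℕ+) :
    expand m (1 - ratioNome m ^ (r : ℕ))⁻¹ = (1 - nome m ^ (r : ℕ))⁻¹ := by
  rw [expand_inv (constantCoeff_one_sub_nome r), map_sub, map_one, map_pow, expand_ratioNome]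

theorem one_sub_nome_ne_zero (r : ℕ+) : 1 - nome m ^ (r : ℕ) ≠ 0 := by
  have h := congrArg (expand m) (MvPowerSeries.inv_mul_cancel _ (constantCoeff_one_sub_nome (m := m) r))
  rw [map_mul, map_one, map_sub, map_one, map_pow, expand_ratioNome] at h
  exact right_ne_zero_of_mul (h.trans_ne one_ne_zero)

theorem nome_ne_zero : nome m ≠ 0 := by
  have : (HahnSeries.single (1 : ℤ) (1 : ZSeries m)) ≠ 0 := HahnSeries.single_ne_zero one_ne_zero
  exact this

/-- The `p`-dependence collapses: `(1 - pʳ) / (1 - pʳ)²` for the `a`-modes and `((1 - pʳ) / pʳ) (pʳ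
/ (1 - pʳ))²` for the `b`-modes. The factor `pʳ` left over in the second case turns `(z_i / z_l)ʳ`
into a power of `p z_i / z_l`. -/
theorem expand_contraction (h : ρ 2 ≠ 0) (hκ : ∀ r : ℕ+, kappa ρ (r : ℕ) ≠ 0) (j : Fin m → Fin n)
    (x : OpPair m) (μ : Mode n) :
    expand m (contraction ρ j (x, μ)) =
      decoupledAnnih ρ (j x.1.1) (zc x.1.1) μ * bracket ρ n m μ *
        decoupledCreate ρ (j x.1.2) (zc x.1.2) μ := by
  have hp : ∀ r : ℕ+, 1 - nome m ^ (r : ℕ) ≠ 0 := one_sub_nome_ne_zero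
  have hQ : ∀ r : ℕ+, qQuarter ρ 2 (r : ℕ) ≠ 0 := fun r => zpow_ne_zero _ h
  rcases μ with ⟨k, r⟩ | ⟨k, r⟩
  · rw [decoupledAnnih_inl, decoupledCreate_inl h, contraction, map_mul, map_mul, map_pow,
      expand_ratio x.2, expand_C, expand_inv_one_sub_nome, aContraction, bracket, qDiff_eq, aFac,
      div_pow, inv_pow]
    have hr : ((r : ℕ) : ℂ) ≠ 0 := Nat.cast_ne_zero.mpr r.ne_zero
    generalize annihCoef (qHalf ρ 2 (r : ℕ)) (j x.1.1) k = a₁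
    generalize createCoef (qHalf ρ 2 (r : ℕ)) (j x.1.2) k = a₂
    have e1 : cst m (qQuarter ρ 2 (r : ℕ) * a₁) * cst m ((qQuarter ρ 2 (r : ℕ))⁻¹ * a₂) *
        cst m ((r : ℕ) / kappa ρ (r : ℕ) * (qHalf ρ 2 (r : ℕ) - (qHalf ρ 2 (r : ℕ))⁻¹)) *
        (cst m (kappa ρ (r : ℕ) / (r : ℕ)) * cst m (kappa ρ (r : ℕ) / (r : ℕ))) =
        cst m (kappa ρ (r : ℕ) * ((qHalf ρ 2 (r : ℕ) - (qHalf ρ 2 (r : ℕ))⁻¹) * (a₁ * a₂)) /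
          (r : ℕ)) := by
      simp only [← map_mul]
      congr 1
      have := hκ r
      have := hQ r
      generalize qHalf ρ 2 (r : ℕ) - (qHalf ρ 2 (r : ℕ))⁻¹ = D
      field_simp
    rw [← e1]
    generalize cst m (qQuarter ρ 2 (r : ℕ) * a₁) = u₁
    generalize cst m ((qQuarter ρ 2 (r : ℕ))⁻¹ * a₂) = u₂
    generalize cst m ((r : ℕ) / kappa ρ (r : ℕ) *
      (qHalf ρ 2 (r : ℕ) - (qHalf ρ 2 (r : ℕ))⁻¹)) = u₃
    generalize cst m (kappa ρ (r : ℕ) / (r : ℕ)) = u₄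
    have hp' := hp r
    have hz := pow_ne_zero (r : ℕ) (zc_ne_zero x.1.1)
    generalize 1 - nome m ^ (r : ℕ) = P at hp' ⊢
    field_simp
  · rw [decoupledAnnih_inr, decoupledCreate_inr h, contraction, map_mul, map_mul, map_pow,
      expand_ratioDual x.2, expand_C, expand_inv_one_sub_nome, bContraction, bracket, qDiff_eq,
      bFac, inv_div, mul_pow, div_pow, inv_pow (zc x.1.2)]
    have hr : ((r : ℕ) : ℂ) ≠ 0 := Nat.cast_ne_zero.mpr r.ne_zero
    generalize annihCoef (qHalf ρ 2 (r : ℕ))⁻¹ (j x.1.1) k = a₁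
    generalize createCoef (qHalf ρ 2 (r : ℕ))⁻¹ (j x.1.2) k = a₂
    have e1 : cst m (-(qQuarter ρ 2 (r : ℕ))⁻¹ * a₁) * cst m (-qQuarter ρ 2 (r : ℕ) * a₂) *
        cst m ((r : ℕ) / kappa ρ (r : ℕ) * (qHalf ρ 2 (r : ℕ) - (qHalf ρ 2 (r : ℕ))⁻¹)) *
        (cst m (kappa ρ (r : ℕ) / (r : ℕ)) * cst m (kappa ρ (r : ℕ) / (r : ℕ))) =
        cst m (kappa ρ (r : ℕ) * ((qHalf ρ 2 (r : ℕ) - (qHalf ρ 2 (r : ℕ))⁻¹) * (a₁ * a₂)) /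
          (r : ℕ)) := by
      simp only [← map_mul]
      congr 1
      have := hκ r
      have := hQ r
      generalize qHalf ρ 2 (r : ℕ) - (qHalf ρ 2 (r : ℕ))⁻¹ = D
      field_simp
    rw [← e1]
    generalize cst m (-(qQuarter ρ 2 (r : ℕ))⁻¹ * a₁) = u₁
    generalize cst m (-qQuarter ρ 2 (r : ℕ) * a₂) = u₂
    generalize cst m ((r : ℕ) / kappa ρ (r : ℕ) *
      (qHalf ρ 2 (r : ℕ) - (qHalf ρ 2 (r : ℕ))⁻¹)) = u₃
    generalize cst m (kappa ρ (r : ℕ) / (r : ℕ)) = u₄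
    have hp' := hp r
    have hz := pow_ne_zero (r : ℕ) (zc_ne_zero x.1.2)
    have hN := pow_ne_zero (r : ℕ) (nome_ne_zero (m := m))
    generalize 1 - nome m ^ (r : ℕ) = P at hp' ⊢
    field_simp

/-- The exponents of the product of a contraction with the structure function. -/
theorem structCoeff_add_sum_contraction {a b : ℂ} (r : ℕ+) (ha : a ≠ 0) (hb : b ≠ 0)
    (hqa : qInt ρ 0 (r : ℕ) = a) (hqb : qInt ρ 1 (r : ℕ) = b)
    (h1 : qHalf ρ 0 (r : ℕ) * qHalf ρ 1 (r : ℕ) * qHalf ρ 2 (r : ℕ) = 1)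
    (h2 : qHalf ρ 2 (r : ℕ) ^ 2 ≠ 1) (hn : (qHalf ρ 2 (r : ℕ) ^ n) ^ 2 ≠ 1) (j j' : Fin n) :
    structCoeff ρ n (r : ℕ) + ∑ k, aContraction ρ j j' k r =
      (if j = j' then 0 else if j < j' then 1 - a⁻¹ - b⁻¹ + (a * b)⁻¹ else 1 - a - b + a * b) ∧
    structCoeff ρ n (r : ℕ) + ∑ k, bContraction ρ j j' k r =
      if j = j' then 0 else if j < j' then 1 - a - b + a * b else 1 - a⁻¹ - b⁻¹ + (a * b)⁻¹ := by
  set H := qHalf ρ 2 (r : ℕ) with hH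
  set c := H ^ n with hc
  have hH0 : H ≠ 0 := right_ne_zero_of_mul (h1.trans_ne one_ne_zero)
  have h01 := left_ne_zero_of_mul (h1.trans_ne one_ne_zero)
  have hx : qHalf ρ 0 (r : ℕ) ≠ 0 := left_ne_zero_of_mul h01
  have hy : qHalf ρ 1 (r : ℕ) ≠ 0 := right_ne_zero_of_mul h01
  have hc0 : c ≠ 0 := pow_ne_zero n hH0
  have hΔ : c - c⁻¹ ≠ 0 := by
    intro h
    apply hn
    have : c * (c - c⁻¹) = 0 := by rw [h, mul_zero]
    rw [mul_sub, mul_inv_cancel₀ hc0] at this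
    linear_combination this
  have hs : H ^ 2 - 1 ≠ 0 := sub_ne_zero.mpr h2
  have hD : H - H⁻¹ ≠ 0 := by
    have : H - H⁻¹ = (H ^ 2 - 1) / H := by field_simp
    rw [this]
    exact div_ne_zero hs hH0
  have hab : H ^ 2 = (a * b)⁻¹ := by
    refine eq_inv_of_mul_eq_one_left ?_
    rw [← hqa, ← hqb, qInt_eq, qInt_eq]
    linear_combination (qHalf ρ 0 (r : ℕ) * qHalf ρ 1 (r : ℕ) * H + 1) * h1
  have hκ : kappa ρ (r : ℕ) = (a - 1) * (b - 1) * (H ^ 2 - 1) := by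
    rw [kappa, hqa, hqb, qInt_eq]
  have hdiff : qDiff ρ 0 (r : ℕ) * qDiff ρ 1 (r : ℕ) = (a - 1) * (b - 1) * H := by
    have e : H = (qHalf ρ 0 (r : ℕ) * qHalf ρ 1 (r : ℕ))⁻¹ := eq_inv_of_mul_eq_one_right h1
    rw [qDiff_eq, qDiff_eq, ← hqa, ← hqb, qInt_eq, qInt_eq, e]
    field_simp
  have hneg : qHalf ρ 2 (-((r : ℕ) : ℤ)) = H⁻¹ := by
    rw [hH, qHalf, qHalf, ← zpow_neg]
    congr 1
    ring
  have hg : structCoeff ρ n (r : ℕ) = (a - 1) * (b - 1) * (c - c⁻¹ * H ^ 2) / (c - c⁻¹) := by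
    rw [structCoeff, hdiff, centralPow_eq, centralPow_neg_eq, qDiff_eq, hneg, ← hH, ← hc]
    generalize c - c⁻¹ = Δ at hΔ ⊢
    have e : c * H⁻¹ - c⁻¹ * H = (c - c⁻¹ * H ^ 2) * H⁻¹ := by field_simp
    rw [e]
    generalize c - c⁻¹ * H ^ 2 = G
    generalize H - H⁻¹ = D at hD ⊢
    field_simp
  have hA := sum_annihCoef_mul_createCoef hH0 h2 hn j j'
  -- The `b`-modes are the same computation at `H⁻¹`; the prefactor `H - H⁻¹` then changes sign.
  have hB := sum_annihCoef_mul_createCoef (n := n) (inv_ne_zero hH0)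
    (by rw [inv_pow]; exact inv_ne_one.mpr h2)
    (by rw [inv_pow, inv_pow]; exact inv_ne_one.mpr hn) j j'
  rw [← hc] at hA
  have hci : H⁻¹ ^ n = c⁻¹ := by rw [inv_pow]
  rw [hci, inv_inv, inv_inv] at hB
  have hA' : ∑ k, aContraction ρ j j' k r = (a - 1) * (b - 1) * (H ^ 2 - 1) *
      (c⁻¹ / (c - c⁻¹) + (if j < j' then 1 else 0) - if j = j' then 1 / (H ^ 2 - 1) else 0) := by
    rw [← hA, ← hκ, Finset.mul_sum, Finset.mul_sum]
    rfl
  have hB' : ∑ k, bContraction ρ j j' k r = -((a - 1) * (b - 1) * (H ^ 2 - 1) *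
      (c / (c⁻¹ - c) + (if j < j' then 1 else 0) -
        if j = j' then 1 / (H⁻¹ ^ 2 - 1) else 0)) := by
    rw [← hB, ← hκ, Finset.mul_sum, Finset.mul_sum, ← Finset.sum_neg_distrib]
    refine Finset.sum_congr rfl fun k _ => ?_
    rw [bContraction, ← hH]
    ring
  -- Here the structure function does its work: it cancels the part of the contraction that depends
  -- on the central element `C^r`, leaving `(a - 1)(b - 1)` for the `a`-modes and, in `e₂`, the same
  -- times `H²` for the `b`-modes.
  have e₁ : (a - 1) * (b - 1) * (c - c⁻¹ * H ^ 2) / (c - c⁻¹) +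
      (a - 1) * (b - 1) * (H ^ 2 - 1) * (c⁻¹ / (c - c⁻¹)) = (a - 1) * (b - 1) := by
    rw [mul_div_assoc', ← add_div, div_eq_iff hΔ]
    ring
  have e₂ : (a - 1) * (b - 1) * (c - c⁻¹ * H ^ 2) / (c - c⁻¹) -
      (a - 1) * (b - 1) * (H ^ 2 - 1) * (c / (c⁻¹ - c)) = (a - 1) * (b - 1) * H ^ 2 := by
    rw [show c⁻¹ - c = -(c - c⁻¹) by ring, div_neg, mul_neg, sub_neg_eq_add, mul_div_assoc',
      ← add_div, div_eq_iff hΔ]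
    ring
  have e₃ : (a - 1) * (b - 1) * H ^ 2 = 1 - a⁻¹ - b⁻¹ + (a * b)⁻¹ := by
    rw [hab]
    field_simp
    ring
  have e₄ : (H ^ 2 - 1) * (1 / (H ^ 2 - 1)) = 1 := mul_one_div_cancel hs
  have e₅ : (H ^ 2 - 1) * (1 / (H⁻¹ ^ 2 - 1)) = -H ^ 2 := by
    have : H⁻¹ ^ 2 - 1 = -(H ^ 2 - 1) / H ^ 2 := by field_simp; ring
    rw [this]
    field_simp
  rw [hA', hB', hg]
  by_cases hjj : j = j'
  · subst hjj
    simp only [if_pos, lt_irrefl, if_false]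
    constructor
    · linear_combination e₁ - (a - 1) * (b - 1) * e₄
    · linear_combination e₂ + (a - 1) * (b - 1) * e₅
  · simp only [if_neg hjj]
    by_cases hlt : j < j'
    · simp only [if_pos hlt]
      constructor
      · linear_combination e₁ + e₃
      · linear_combination e₂
    · simp only [if_neg hlt]
      constructor
      · linear_combination e₁
      · linear_combination e₂ + e₃

end PairContraction

/-! ## The regularized contraction as a ratio of theta functions -/

section PairKernel

/-- A sum of `r`-th powers in the exponent becomes a quotient of infinite products, written here
with the denominators multiplied out. -/
theorem rexp_ellLog_mul {σ 𝕜 : Type} [Field 𝕜] [CharZero 𝕜] (p : MvPowerSeries σ 𝕜) (z : Fin 3 → 𝕜)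
    {a : MvPowerSeries σ 𝕜} (ha : MvPowerSeries.constantCoeff a = 0) :
    rexp (ellLog p (fun r => 1 - z 0 ^ (r : ℕ) - z 1 ^ (r : ℕ) + z 2 ^ (r : ℕ)) a) *
        (rexp (-ellLog p 1 a) * rexp (-ellLog p 1 (MvPowerSeries.C (z 2) * a))) =
      rexp (-ellLog p 1 (MvPowerSeries.C (z 0) * a)) *
        rexp (-ellLog p 1 (MvPowerSeries.C (z 1) * a)) := by
  have hz : ∀ i, MvPowerSeries.constantCoeff (MvPowerSeries.C (z i) * a) = 0 := fun i => by
    rw [map_mul, ha, mul_zero]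
  have h0 : ∀ {b : MvPowerSeries σ 𝕜}, MvPowerSeries.constantCoeff b = 0 →
      MvPowerSeries.constantCoeff (-ellLog p 1 b) = 0 := fun hb => by
    rw [map_neg, constantCoeff_ellLog p 1 hb, neg_zero]
  rw [← rexp_add (h0 ha) (h0 (hz 2)), ← rexp_add (h0 (hz 0)) (h0 (hz 1)),
    ← rexp_add (constantCoeff_ellLog p _ ha) (by rw [map_add, h0 ha, h0 (hz 2), add_zero])]
  congr 1
  have : (fun r : ℕ+ => 1 - z 0 ^ (r : ℕ) - z 1 ^ (r : ℕ) + z 2 ^ (r : ℕ)) =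
      1 + -(fun r : ℕ+ => z 0 ^ (r : ℕ)) + -(fun r : ℕ+ => z 1 ^ (r : ℕ)) +
        fun r : ℕ+ => z 2 ^ (r : ℕ) := by
    funext r
    simp only [Pi.add_apply, Pi.neg_apply, Pi.one_apply]
    ring
  rw [this, ellLog_add p _ _ ha, ellLog_add p _ _ ha, ellLog_add p _ _ ha, ellLog_neg p _ ha,
    ellLog_neg p _ ha, ellLog_pow p _ ha, ellLog_pow p _ ha, ellLog_pow p _ ha]
  ring

variable {m : ℕ}

theorem expandPow_C (c : ℂ) :
    expandPow m (MvPowerSeries.C c) = PowerSeries.C (HahnSeries.C c) := by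
  change expandPow m (MvPowerSeries.monomial 0 c) = _
  rw [expandPow_monomial, zExp_zero, Finsupp.zero_apply, PowerSeries.monomial_zero_eq_C_apply]
  rfl

/-- A theta function joins an infinite product in `x = z_l / z_i` with one in `p x⁻¹`. The
parameters of the second exponent must be inverse to those of the first for the two halves to fit.
-/
theorem expandPow_rexp_ellLog_mul {i l : Fin m} (h : i < l) (z z' : Fin 3 → ℂ)
    (hz : ∀ k, z' k = (z k)⁻¹) {τ τ' : ℕ+ → ℂ}
    (hτ : ∀ r : ℕ+, τ r = 1 - z 0 ^ (r : ℕ) - z 1 ^ (r : ℕ) + z 2 ^ (r : ℕ))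
    (hτ' : ∀ r : ℕ+, τ' r = 1 - z' 0 ^ (r : ℕ) - z' 1 ^ (r : ℕ) + z' 2 ^ (r : ℕ)) :
    expandPow m (rexp (ellLog (ratioNome m) τ (ratio i l)) *
        rexp (ellLog (ratioNome m) τ' (ratioDual i l))) *
        (theta (zVar l / zVar i : ZSeries m) * theta (HahnSeries.C (z 2) * (zVar l / zVar i))) =
      theta (HahnSeries.C (z 0) * (zVar l / zVar i)) *
        theta (HahnSeries.C (z 1) * (zVar l / zVar i)) := by
  have ha := constantCoeff_ratio h
  have ha' := constantCoeff_ratioDual i l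
  have key : ∀ k, expandPow m
      (rexp (-ellLog (ratioNome m) 1 (MvPowerSeries.C (z k) * ratio i l)) *
        rexp (-ellLog (ratioNome m) 1 (MvPowerSeries.C (z' k) * ratioDual i l))) =
      theta (HahnSeries.C (z k) * (zVar l / zVar i)) := by
    intro k
    apply expandPow_rexp_ellLog
    · rw [map_mul, ha, mul_zero]
    · rw [map_mul, ha', mul_zero]
    · rw [map_mul, expandPow_C, expandPow_ratio h, map_mul]
    · rw [map_mul, expandPow_C, expandPow_ratioDual h, hz, map_inv₀, mul_inv, map_mul]
      ring
  have e := congrArg₂ (· * ·) (rexp_ellLog_mul (ratioNome m) z ha)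
    (rexp_ellLog_mul (ratioNome m) z' ha')
  have e' := congrArg (expandPow m) e
  rw [← key 0, ← key 1, ← key 2,
    ← expandPow_rexp_ellLog ha ha' (expandPow_ratio h) (expandPow_ratioDual h), funext hτ,
    funext hτ']
  simp only [map_mul] at e' ⊢
  linear_combination e'

/-- Complex constants as units of the field of series in `z`. -/
def constUnit (m : ℕ) (Q : Fin 3 → ℂˣ) (k : Fin 3) : (ZSeries m)ˣ :=
  Units.map (HahnSeries.C : ℂ →+* ZSeries m) (Q k)

/-- The variable `z_i` as a unit. -/
def zUnit (i : Fin m) : (ZSeries m)ˣ := Units.mk0 (zVar i) (zVar_ne_zero i)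

theorem C_mul_zVar_ne (c : ℂ) {i l : Fin m} (h : i ≠ l) :
    (zVar i : ZSeries m) ≠ HahnSeries.C c * zVar l := by
  intro h'
  have h1 := congrArg (fun f : ZSeries m => f.coeff (toLex (Pi.single i (-1)))) h'
  simp only [zVar, HahnSeries.C_apply, HahnSeries.single_mul_single, zero_add,
    HahnSeries.coeff_single_same] at h1
  rw [HahnSeries.coeff_single_of_ne] at h1
  · exact one_ne_zero h1
  · intro h2
    have := congrFun (toLex.injective h2) i
    simp [h] at this

/-- Distinct variables are not constant multiples of each other, so Ruijsenaars' identity applies to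
the formal variables themselves. -/
theorem inGeneralPosition_zUnit (Q : Fin 3 → ℂˣ) :
    InGeneralPosition (constUnit m Q) Finset.univ (zUnit (m := m)) := by
  intro i _ l _ h
  refine ⟨fun h' => ?_, fun h' => ?_, fun h' => ?_⟩
  · refine C_mul_zVar_ne 1 h ?_
    rw [map_one, one_mul]
    exact congrArg Units.val h'
  · exact C_mul_zVar_ne (Q 2) h (congrArg Units.val h')
  · refine C_mul_zVar_ne ((Q 2 : ℂ) ^ 2) h ?_
    rw [map_pow]
    exact congrArg Units.val h'

theorem kernel_mul {E : Type} [Field E] {q : Fin 3 → Eˣ} {w : Eˣ} (h1 : w ≠ 1) (h2 : q 2 * w ≠ 1) :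
    kernel q w * (thetaU w * thetaU (q 2 * w)) = thetaU ((q 0)⁻¹ * w) * thetaU ((q 1)⁻¹ * w) := by
  have e1 := inv_mul_thetaU h1
  have e2 := inv_mul_thetaU h2
  calc _ = thetaU ((q 0)⁻¹ * w) * thetaU ((q 1)⁻¹ * w) * ((thetaU w)⁻¹ * thetaU w) *
        ((thetaU (q 2 * w))⁻¹ * thetaU (q 2 * w)) := by
        unfold kernel; ring
    _ = _ := by rw [e1, e2, mul_one, mul_one]

theorem kernel_inv_mul {E : Type} [Field E] {q : Fin 3 → Eˣ} (hq : q 0 * q 1 * q 2 = 1) {w : Eˣ}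
    (h1 : w ≠ 1) (h2 : w ≠ q 2) :
    kernel q w⁻¹ * (thetaU w * thetaU ((q 2)⁻¹ * w)) = thetaU (q 0 * w) * thetaU (q 1 * w) := by
  have key := kernel_mul (q := q) (w := w⁻¹) (by simpa using h1)
    (by rw [Ne, mul_inv_eq_one]; exact h2.symm)
  have e0 : (q 2) * w⁻¹ = ((q 2)⁻¹ * w)⁻¹ := by rw [mul_inv, inv_inv]
  rw [e0, ← mul_inv, ← mul_inv, thetaU_inv, thetaU_inv, thetaU_inv, thetaU_inv] at key
  have hq' : (q 0 : E) * q 1 * q 2 = 1 := by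
    rw [← Units.val_mul, ← Units.val_mul, hq, Units.val_one]
  have hC : PowerSeries.C (((q 0 * w : Eˣ) : E)⁻¹) * PowerSeries.C (((q 1 * w : Eˣ) : E)⁻¹) =
      PowerSeries.C ((w : E)⁻¹) * PowerSeries.C ((((q 2)⁻¹ * w : Eˣ) : E)⁻¹) := by
    rw [← map_mul, ← map_mul]
    congr 1
    have h0 := (q 0).ne_zero
    have h1 := (q 1).ne_zero
    have h2 := (q 2).ne_zero
    have hw := w.ne_zero
    push_cast
    field_simp
    linear_combination -hq'
  have hne : PowerSeries.C ((w : E)⁻¹) * PowerSeries.C ((((q 2)⁻¹ * w : Eˣ) : E)⁻¹) ≠ 0 := by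
    simp
  apply mul_left_cancel₀ hne
  linear_combination key + thetaU (q 0 * w) * thetaU (q 1 * w) * hC

end PairKernel

/-! ## The vacuum correlation functions -/

section Correlation

variable {n m : ℕ} {ρ : Fin 3 → ℂ}

/-- The structure function `f₁₁(z_l / z_i; p)`. -/
def structFn (ρ : Fin 3 → ℂ) (n : ℕ) {m : ℕ} (i l : Fin m) : RatioSeries m :=
  rexp (ellLog (ratioNome m) (fun r => structCoeff ρ n (r : ℕ)) (ratio i l)) *
    rexp (ellLog (ratioNome m) (fun r => structCoeff ρ n (r : ℕ)) (ratioDual i l))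

theorem isStructureFunction_structFn {i l : Fin m} (h : i < l) :
    IsStructureFunction ρ n (zc l / zc i : Corr m) (expand m (structFn ρ n i l)) := by
  have ha := constantCoeff_ratio h
  have ha' := constantCoeff_ratioDual i l
  refine ⟨_, _, _, _, ?_, ?_, isExp_expand_rexp (constantCoeff_ellLog _ _ ha),
    isExp_expand_rexp (constantCoeff_ellLog _ _ ha'), map_mul _ _ _⟩
  · convert (ellLog_fsum (ratioNome m) (fun r : ℕ+ => structCoeff ρ n (r : ℕ)) ha).expand
      using 2 with r
    rw [map_mul, map_mul, map_pow, expand_ratio h, expand_C, expand_inv_one_sub_nome, one_div]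
    ring
  · convert (ellLog_fsum (ratioNome m) (fun r : ℕ+ => structCoeff ρ n (r : ℕ)) ha').expand
      using 2 with r
    rw [map_mul, map_mul, map_pow, expand_ratioDual h, expand_C, expand_inv_one_sub_nome, mul_pow,
      div_eq_mul_inv (nome m ^ (r : ℕ))]
    ring

/-- Adding the exponents of the structure function and of the contraction gives zero for `j = j'`,
and otherwise the exponents of `F(z_l / z_i)` or `F(z_i / z_l)`. That `q₃` is not a root of unity
keeps the denominators `C^r - C^{-r}` and `q₃^r - 1` away from zero. -/
theorem expandPow_structFn_mul {Q : Fin 3 → ℂˣ} (hQ : ∀ i, ρ i ^ 4 = Q i)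
    (h1 : ρ 0 ^ 2 * ρ 1 ^ 2 * ρ 2 ^ 2 = 1) (h2 : ∀ r : ℕ, r ≠ 0 → (Q 2) ^ r ≠ 1) (hn : n ≠ 0)
    {i l : Fin m} (h : i < l) (j j' : Fin n) :
    expandPow m (structFn ρ n i l *
      rexp (ellLog (ratioNome m) (∑ k, aContraction ρ j j' k) (ratio i l) +
        ellLog (ratioNome m) (∑ k, bContraction ρ j j' k) (ratioDual i l))) =
      if j = j' then 1 else
        if j < j' then kernel (constUnit m Q) (zUnit l / zUnit i)
        else kernel (constUnit m Q) (zUnit i / zUnit l) := by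
  have ha := constantCoeff_ratio h
  have ha' := constantCoeff_ratioDual i l
  have hq : Q 0 * Q 1 * Q 2 = 1 := by
    ext
    push_cast
    rw [← hQ, ← hQ, ← hQ]
    linear_combination (ρ 0 ^ 2 * ρ 1 ^ 2 * ρ 2 ^ 2 + 1) * h1
  have hq' : (Q 0 : ℂ) * Q 1 * Q 2 = 1 := by
    rw [← Units.val_mul, ← Units.val_mul, hq, Units.val_one]
  have hint : ∀ (i : Fin 3) (r : ℕ), qInt ρ i r = (Q i : ℂ) ^ r := by
    intro i r
    rw [qInt, zpow_mul, ← hQ]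
    norm_cast
  have hhalf : ∀ (i : Fin 3) (r : ℕ), qHalf ρ i r = (ρ i ^ 2) ^ r := by
    intro i r
    rw [qHalf, zpow_mul]
    norm_cast
  have hsum := fun r : ℕ+ => structCoeff_add_sum_contraction (ρ := ρ) (n := n) r
    (a := (Q 0 : ℂ) ^ (r : ℕ)) (b := (Q 1 : ℂ) ^ (r : ℕ)) (by simp) (by simp)
    (hint 0 r) (hint 1 r) (by rw [hhalf, hhalf, hhalf, ← mul_pow, ← mul_pow, h1, one_pow])
    (by
      rw [← qInt_eq, hint]
      exact fun h' => h2 r r.ne_zero (Units.ext (by simpa using h')))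
    (by
      rw [← pow_mul, mul_comm n 2, pow_mul, ← qInt_eq, hint, ← pow_mul]
      exact fun h' => h2 (r * n) (mul_ne_zero r.ne_zero hn) (Units.ext (by simpa using h'))) j j'
  have hE := constantCoeff_ellLog (ratioNome m) (fun r => structCoeff ρ n (r : ℕ)) ha
  have hE' := constantCoeff_ellLog (ratioNome m) (fun r => structCoeff ρ n (r : ℕ)) ha'
  have hF := constantCoeff_ellLog (ratioNome m) (∑ k, aContraction ρ j j' k) ha
  have hF' := constantCoeff_ellLog (ratioNome m) (∑ k, bContraction ρ j j' k) ha'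
  rw [rexp_add hF hF', structFn, mul_mul_mul_comm, ← rexp_add hE hF, ← rexp_add hE' hF',
    ← ellLog_add _ _ _ ha, ← ellLog_add _ _ _ ha']
  set τ : ℕ+ → ℂ := (fun r : ℕ+ => structCoeff ρ n (r : ℕ)) + ∑ k, aContraction ρ j j' k with hτ
  set τ' : ℕ+ → ℂ := (fun r : ℕ+ => structCoeff ρ n (r : ℕ)) + ∑ k, bContraction ρ j j' k with hτ'
  have e1 : ∀ r, τ r = structCoeff ρ n (r : ℕ) + ∑ k, aContraction ρ j j' k r := fun r => by
    rw [hτ, Pi.add_apply, Finset.sum_apply]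
  have e2 : ∀ r, τ' r = structCoeff ρ n (r : ℕ) + ∑ k, bContraction ρ j j' k r := fun r => by
    rw [hτ', Pi.add_apply, Finset.sum_apply]
  have hne : ∀ {i l : Fin m}, i ≠ l → zUnit l / zUnit i ≠ 1 ∧
      zUnit l / zUnit i ≠ constUnit m Q 2 ∧ constUnit m Q 2 * (zUnit l / zUnit i) ≠ 1 :=
    fun h => (inGeneralPosition_zUnit Q).div_ne (Finset.mem_univ _) (Finset.mem_univ _) h.symm
  have hy := hne h.ne
  have hQr : ∀ r : ℕ, (Q 2 : ℂ) ^ r = ((Q 0 : ℂ) ^ r * (Q 1 : ℂ) ^ r)⁻¹ := fun r => by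
    rw [← mul_pow, ← inv_pow]
    congr 1
    exact eq_inv_of_mul_eq_one_right hq'
  have hQr' : ∀ r : ℕ, ((Q 2 : ℂ)⁻¹) ^ r = (Q 0 : ℂ) ^ r * (Q 1 : ℂ) ^ r := fun r => by
    rw [inv_pow, hQr, inv_inv]
  have hqU : constUnit m Q 0 * constUnit m Q 1 * constUnit m Q 2 = 1 := by
    simp only [constUnit, ← map_mul, hq, map_one]
  split_ifs with hj hj'
  · have h0 : τ = 0 := funext fun r => by rw [e1, (hsum r).1, if_pos hj, Pi.zero_apply]
    have h0' : τ' = 0 := funext fun r => by rw [e2, (hsum r).2, if_pos hj, Pi.zero_apply]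
    rw [h0, h0', ellLog_zero _ ha, ellLog_zero _ ha', rexp_zero, one_mul, map_one]
  -- The exponent is `1 - q₁⁻ʳ - q₂⁻ʳ + q₃ʳ`, since `q₃ = (q₁q₂)⁻¹`. In the last case all parameters
  -- are inverted, and `kernel_inv_mul` recognizes the kernel at the inverse ratio.
  · have key := expandPow_rexp_ellLog_mul h ![(Q 0 : ℂ)⁻¹, (Q 1 : ℂ)⁻¹, Q 2]
      ![(Q 0 : ℂ), Q 1, (Q 2 : ℂ)⁻¹] (by intro k; fin_cases k <;> simp) (τ := τ) (τ' := τ')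
      (fun r => by
        rw [e1, (hsum r).1, if_neg hj, if_pos hj', ← hQr]
        simp [inv_pow])
      (fun r => by
        rw [e2, (hsum r).2, if_neg hj, if_pos hj', ← hQr']
        simp)
    refine mul_right_cancel₀ (mul_ne_zero (thetaU_ne_zero hy.1) (thetaU_ne_zero hy.2.2)) ?_
    rw [kernel_mul hy.1 hy.2.2]
    convert key using 2
    · simp [thetaU, constUnit, zUnit]
    · simp [thetaU, constUnit, zUnit]
    · simp [thetaU, constUnit, zUnit]
  · have key := expandPow_rexp_ellLog_mul h ![(Q 0 : ℂ), Q 1, (Q 2 : ℂ)⁻¹]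
      ![(Q 0 : ℂ)⁻¹, (Q 1 : ℂ)⁻¹, Q 2] (by intro k; fin_cases k <;> simp) (τ := τ) (τ' := τ')
      (fun r => by
        rw [e1, (hsum r).1, if_neg hj, if_neg hj', ← hQr']
        simp)
      (fun r => by
        rw [e2, (hsum r).2, if_neg hj, if_neg hj', ← hQr]
        simp [inv_pow])
    have hd : thetaU ((constUnit m Q 2)⁻¹ * (zUnit l / zUnit i)) ≠ 0 :=
      thetaU_ne_zero (by rw [Ne, inv_mul_eq_one]; exact hy.2.1.symm)
    have hi : zUnit i / zUnit l = (zUnit l / zUnit i)⁻¹ := (inv_div _ _).symm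
    refine mul_right_cancel₀ (mul_ne_zero (thetaU_ne_zero hy.1) hd) ?_
    rw [hi, kernel_inv_mul hqU hy.1 hy.2.1]
    convert key using 2
    · simp [thetaU, constUnit, zUnit]
    · simp [thetaU, constUnit, zUnit]
    · simp [thetaU, constUnit, zUnit]

theorem prod_prod_Ioi_eq_prod_opPair {M : Type*} [CommMonoid M] (F : Fin m → Fin m → M) :
    ∏ i, ∏ l ∈ Finset.Ioi i, F i l = ∏ x : OpPair m, F x.1.1 x.1.2 := by
  rw [← Finset.prod_subtype (Finset.univ.filter fun x : Fin m × Fin m => x.1 < x.2)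
    (by simp) fun x => F x.1 x.2, Finset.prod_filter, Fintype.prod_prod_type]
  refine Finset.prod_congr rfl fun i _ => ?_
  rw [← Finset.prod_filter]
  congr 1
  ext l
  simp

/-- An ordered product over `j_i < j_l` is rearranged by unordered pairs of positions; each pair
contributes at most one kernel, oriented by the order of its `j`-values. -/
theorem pairProd_eq_prod_opPair {E : Type} [Field E] (q : Fin 3 → Eˣ) (x : Fin m → Eˣ)
    (j : Fin m → Fin n) :
    pairProd q x j = ∏ y : OpPair m, if j y.1.1 = j y.1.2 then 1 else
        if j y.1.1 < j y.1.2 then kernel q (x y.1.2 / x y.1.1)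
        else kernel q (x y.1.1 / x y.1.2) := by
  rw [← prod_prod_Ioi_eq_prod_opPair fun i l => if j i = j l then 1 else
        if j i < j l then kernel q (x l / x i) else kernel q (x i / x l)]
  set K : Fin m → Fin m → PowerSeries E := fun i l =>
    if j i < j l then kernel q (x l / x i) else 1 with hK
  have hsplit : ∀ i l, K i l = (if i < l then K i l else 1) * if l < i then K i l else 1 := by
    intro i l
    rcases lt_trichotomy i l with h | rfl | h
    · rw [if_pos h, if_neg h.not_gt, mul_one]
    · simp [hK]
    · rw [if_neg h.not_gt, if_pos h, one_mul]
  calc pairProd q x j = ∏ i, ∏ l, K i l := rfl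
    _ = ∏ i, ∏ l, (if i < l then K i l else 1) * if i < l then K l i else 1 := by
      simp only [Finset.prod_mul_distrib]
      rw [Finset.prod_comm (f := fun i l => if i < l then K l i else 1)]
      simp only [← Finset.prod_mul_distrib, ← hsplit]
    _ = _ := by
      refine Finset.prod_congr rfl fun i _ => ?_
      have : Finset.Ioi i = Finset.univ.filter (i < ·) := by ext; simp
      rw [this, Finset.prod_filter]
      refine Finset.prod_congr rfl fun l _ => ?_
      split_ifs with h h1 h2
      · simp [hK, h1]
      · simp [hK, h2, h2.not_gt]
      · have : j l < j i := lt_of_le_of_ne (not_lt.mp h2) (Ne.symm h1)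
        simp [hK, h2, this]
      · rw [one_mul]

/-- The exponent of the vacuum expectation value of `Λ̃_{j_1}(z₁) ⋯ Λ̃_{j_m}(zₘ)`. -/
def contractionSum (ρ : Fin 3 → ℂ) (j : Fin m → Fin n) : RatioSeries m :=
  ∑ x : OpPair m,
    (ellLog (ratioNome m) (∑ k, aContraction ρ (j x.1.1) (j x.1.2) k) (ratio x.1.1 x.1.2) +
      ellLog (ratioNome m) (∑ k, bContraction ρ (j x.1.1) (j x.1.2) k) (ratioDual x.1.1 x.1.2))

/-- The correlation function `⟨0| T̃₁(z₁; p) ⋯ T̃₁(zₘ; p) |0⟩`. -/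
def correlation (ρ : Fin 3 → ℂ) (m : ℕ) (u : Fin n → ℂ) : Corr m :=
  ∑ j : Fin m → Fin n, cst m (∏ i, u (j i)) * expand m (rexp (contractionSum ρ j))

/-- By multilinearity the product of currents is a finite sum over the choices `j`, and Wick's
theorem evaluates each of them. -/
theorem isVacuumCorrelation_correlation (h : ρ 2 ≠ 0) (hκ : ∀ r : ℕ+, kappa ρ (r : ℕ) ≠ 0)
    (u : Fin n → ℂ) : IsVacuumCorrelation ρ u (correlation ρ m u) := by
  have key := HasFormalSum.sum Finset.univ fun j : Fin m → Fin n =>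
    (hasFormalSum_pathProd ρ (fun i => decoupledCreate ρ (j i) (zc i))
      (fun i => decoupledAnnih ρ (j i) (zc i)) (contraction_fsum j) (constantCoeff_contraction j)
      (expand_contraction h hκ j)).cst_mul (∏ i, u (j i))
  unfold IsVacuumCorrelation
  convert key using 2 with ν
  · simp only [currentElement]
    rw [Finset.prod_univ_sum, Fintype.piFinset_univ]
    refine Finset.sum_congr rfl fun j _ => ?_
    rw [Finset.prod_mul_distrib, map_prod]
  · rfl

/-- Each choice `j` contributes one exponential per pair of positions, and each pair takes up
exactly one structure function. The result is a finite sum of products of theta quotients. -/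
theorem ofPow_currentSum {Q : Fin 3 → ℂˣ} (hQ : ∀ i, ρ i ^ 4 = Q i)
    (h1 : ρ 0 ^ 2 * ρ 1 ^ 2 * ρ 2 ^ 2 = 1) (h2 : ∀ r : ℕ, r ≠ 0 → (Q 2) ^ r ≠ 1) (hn : n ≠ 0)
    (u : Fin n → ℂ) :
    (∏ i : Fin m, ∏ l ∈ Finset.Ioi i, expand m (structFn ρ n i l)) * correlation ρ m u =
      ofPow m (currentSum (constUnit m Q) zUnit fun k => PowerSeries.C (HahnSeries.C (u k))) := by
  rw [correlation, currentSum, Finset.mul_sum, map_sum]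
  refine Finset.sum_congr rfl fun j _ => ?_
  rw [mul_left_comm, map_mul (ofPow m), map_prod (ofPow m), map_prod]
  congr 1
  · exact Finset.prod_congr rfl fun i _ => (ofPow_C _).symm
  rw [prod_prod_Ioi_eq_prod_opPair fun i l => expand m (structFn ρ n i l), contractionSum,
    rexp_sum _ fun x _ => ?_, map_prod, ← Finset.prod_mul_distrib, pairProd_eq_prod_opPair, map_prod]
  · refine Finset.prod_congr rfl fun x _ => ?_
    rw [← map_mul, ← expandPow_structFn_mul hQ h1 h2 hn x.2]
    rfl
  · rw [map_add, constantCoeff_ellLog _ _ (constantCoeff_ratio x.2),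
      constantCoeff_ellLog _ _ (constantCoeff_ratioDual _ _), add_zero]

end Correlation

/-! ## The correlation function as an element of the star algebra -/

section Functoriality

variable {E K : Type} [Field E] [Field K]

theorem map_inv_powerSeries (g : E →+* K) (f : PowerSeries E) :
    PowerSeries.map g f⁻¹ = (PowerSeries.map g f)⁻¹ := by
  have hc : PowerSeries.constantCoeff (PowerSeries.map g f) = g (PowerSeries.constantCoeff f) := by
    rw [← PowerSeries.coeff_zero_eq_constantCoeff_apply, PowerSeries.coeff_map,
      PowerSeries.coeff_zero_eq_constantCoeff_apply]
  -- The inverse of a power series with zero constant term is `0` by convention, and a field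
  -- homomorphism respects this case too.
  by_cases h : PowerSeries.constantCoeff f = 0
  · rw [PowerSeries.inv_eq_zero.mpr h, map_zero,
      PowerSeries.inv_eq_zero.mpr (by rw [hc, h, map_zero])]
  · rw [PowerSeries.eq_inv_iff_mul_eq_one (by rw [hc]; simpa using h), ← map_mul,
      PowerSeries.inv_mul_cancel f h, map_one]

theorem map_thetaU (g : E →+* K) (w : Eˣ) :
    PowerSeries.map g (thetaU w) = thetaU (Units.map (g : E →* K) w) :=
  map_theta g _

theorem map_kernel (g : E →+* K) (q : Fin 3 → Eˣ) (w : Eˣ) :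
    PowerSeries.map g (kernel q w) =
      kernel (fun k => Units.map (g : E →* K) (q k)) (Units.map (g : E →* K) w) := by
  rw [kernel, kernel, map_mul, map_mul, map_mul, map_inv_powerSeries, map_inv_powerSeries,
    map_thetaU, map_thetaU, map_thetaU, map_thetaU, map_mul (Units.map _), map_mul (Units.map _),
    map_mul (Units.map _), map_inv, map_inv]

theorem map_pairProd {ι : Type} [Fintype ι] {n : ℕ} (g : E →+* K) (q : Fin 3 → Eˣ) (x : ι → Eˣ)
    (j : ι → Fin n) :
    PowerSeries.map g (pairProd q x j) =
      pairProd (fun k => Units.map (g : E →* K) (q k)) (fun i => Units.map (g : E →* K) (x i)) j := by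
  simp only [pairProd, map_prod]
  refine Finset.prod_congr rfl fun i _ => Finset.prod_congr rfl fun l _ => ?_
  split_ifs with h
  · rw [map_kernel, map_div]
  · exact map_one _

end Functoriality

/-! ### The element of `Λ ⊗ S` and its specialization at complex `u` -/

section Target

set_option synthInstance.maxHeartbeats 200000

instance (m : ℕ) : CharZero (ZSeries m) :=
  charZero_of_injective_ringHom (HahnSeries.C : ℂ →+* ZSeries m).injective

variable {n m : ℕ} {Q : Fin 3 → ℂˣ}

/-- With `q = q₁` and `t = q₃⁻¹`, the remaining parameter is `q₂ = q⁻¹ t`. -/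
theorem mem_coefField (hq : Q 0 * Q 1 * Q 2 = 1) (k : Fin 3) :
    (Q k : ℂ) ∈ coefField (Q 0) (Q 2 : ℂ)⁻¹ := by
  have h0 : (Q 0 : ℂ) ∈ coefField (Q 0) (Q 2 : ℂ)⁻¹ := (qElt (Q 0) (Q 2 : ℂ)⁻¹).2
  have h2 : (Q 2 : ℂ)⁻¹ ∈ coefField (Q 0) (Q 2 : ℂ)⁻¹ := (tElt (Q 0) (Q 2 : ℂ)⁻¹).2
  have h1 : (Q 1 : ℂ) = (Q 0 : ℂ)⁻¹ * (Q 2 : ℂ)⁻¹ := by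
    have hq' : (Q 0 : ℂ) * Q 1 * Q 2 = 1 := by
      rw [← Units.val_mul, ← Units.val_mul, hq, Units.val_one]
    have := (Q 0).ne_zero
    have := (Q 2).ne_zero
    field_simp
    linear_combination hq'
  fin_cases k
  · exact h0
  · change (Q 1 : ℂ) ∈ _
    rw [h1]
    exact mul_mem (inv_mem h0) h2
  · simpa using inv_mem h2

/-- The parameters `q_k` as units of `ℚ(q, t)(z₁, …, zₘ)`. -/
def coefUnit (m : ℕ) (hq : Q 0 * Q 1 * Q 2 = 1) (k : Fin 3) :
    (RatFn (coefField (Q 0) (Q 2 : ℂ)⁻¹) m)ˣ :=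
  Units.map (algebraMap (coefField (Q 0) (Q 2 : ℂ)⁻¹) (RatFn (coefField (Q 0) (Q 2 : ℂ)⁻¹) m) :
    _ →* _) (Units.mk0 (⟨Q k, mem_coefField hq k⟩ : coefField (Q 0) (Q 2 : ℂ)⁻¹) fun h => (Q k).ne_zero (congrArg Subtype.val h))

theorem ratVar_ne_zero (F : Type) [Field F] {k : ℕ} (i : Fin k) : ratVar F i ≠ 0 := by
  rw [ratVar, Ne, FaithfulSMul.algebraMap_eq_zero_iff]
  exact MvPolynomial.X_ne_zero i

/-- The variable `z_i` as a unit of the field of rational functions. -/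
def ratUnit (F : Type) [Field F] {k : ℕ} (i : Fin k) : (RatFn F k)ˣ :=
  Units.mk0 (ratVar F i) (ratVar_ne_zero F i)

theorem ratRename_ratVar (F : Type) [Field F] {k l : ℕ} (σ : Fin k ↪ Fin l) (i : Fin k) :
    ratRename F σ (ratVar F i) = ratVar F (σ i) := by
  simp [ratRename, ratVar, IsFractionRing.liftAlgHom]

theorem ratExpand_ratVar (q t : ℂ) (i : Fin m) :
    ratExpand q t m (ratVar _ i) = zVar i := by
  rw [ratExpand, ratVar, IsFractionRing.liftAlgHom_apply, IsFractionRing.lift_algebraMap]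
  exact MvPolynomial.aeval_X _ _

/-- The product of kernels as an element of `ℚ(q, t)(z₁, …, zₘ)⟦p⟧`. -/
def pairFn (hq : Q 0 * Q 1 * Q 2 = 1) (j : Fin m → Fin n) :
    EllFn (coefField (Q 0) (Q 2 : ℂ)⁻¹) m :=
  pairProd (coefUnit m hq) (ratUnit _) j

theorem ellRename_pairFn (hq : Q 0 * Q 1 * Q 2 = 1) (j : Fin m → Fin n) (τ : Equiv.Perm (Fin m)) :
    ellRename _ τ.toEmbedding (pairFn hq j) = pairFn hq (j ∘ τ.symm) := by
  rw [pairFn, pairFn, ← pairProd_comp]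
  refine (map_pairProd (ratRename (coefField (Q 0) (Q 2 : ℂ)⁻¹) τ.toEmbedding).toRingHom _ _ j).trans ?_
  congr 1
  · funext k
    exact Units.ext ((ratRename _ τ.toEmbedding).commutes _)
  · funext i
    exact Units.ext (ratRename_ratVar _ _ _)

/-- The kernels are given by one formula over every field, so expanding the rational functions gives
the same formula in the field of series. -/
theorem ellExpand_pairFn (hq : Q 0 * Q 1 * Q 2 = 1) (j : Fin m → Fin n) :
    ellExpand (Q 0) (Q 2 : ℂ)⁻¹ m (pairFn hq j) = ofPow m (pairProd (constUnit m Q) zUnit j) := by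
  change ofPow m (PowerSeries.map
    (ratExpand (Q 0) (Q 2 : ℂ)⁻¹ m : RatFn (coefField (Q 0) (Q 2 : ℂ)⁻¹) m →+* ZSeries m)
    (pairProd (coefUnit m hq) (ratUnit _) j)) = _
  rw [map_pairProd]
  exact congrArg₂ (fun q x => ofPow m (pairProd q x j))
    (funext fun k => Units.ext ((ratExpand (Q 0) (Q 2 : ℂ)⁻¹ m).commutes _))
    (funext fun i => Units.ext (ratExpand_ratVar _ _ i))

/-- The average of `∏ u_{j_i}` over all permutations of the variables. -/
def symOrbit (q t : ℂ) (j : Fin m → Fin n) : SymPoly q t n :=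
  ⟨((n.factorial : coefField q t)⁻¹) • ∑ σ : Equiv.Perm (Fin n), ∏ i, MvPolynomial.X (σ (j i)), by
    rw [MvPolynomial.mem_symmetricSubalgebra]
    intro e
    rw [map_smul, map_sum]
    congr 1
    simp only [map_prod, MvPolynomial.rename_X]
    exact Fintype.sum_equiv (Equiv.mulLeft e) _ _ fun σ => rfl⟩

/-- The correlation function as an element of `Λ ⊗ S`. -/
def starElement (n m : ℕ) (hq : Q 0 * Q 1 * Q 2 = 1) :
    SymPoly (Q 0) (Q 2 : ℂ)⁻¹ n ⊗[coefField (Q 0) (Q 2 : ℂ)⁻¹] StarAlgebra (Q 0) (Q 2 : ℂ)⁻¹ :=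
  -- A single term `∏ u_{j_i} ∏ F` is symmetric neither in `u` nor in `z`. Averaging each tensor
  -- factor puts it into `Λ ⊗ S`, and the total sum, being symmetric in both sets of variables, does
  -- not change.
  ∑ j : Fin m → Fin n, symOrbit (Q 0) (Q 2 : ℂ)⁻¹ j ⊗ₜ
    DirectSum.lof (coefField (Q 0) (Q 2 : ℂ)⁻¹) ℕ (fun k => SymFn (Q 0) (Q 2 : ℂ)⁻¹ k) m
      (symmetrize _ _ m (pairFn hq j))

theorem starElement_mem_degreePart (hq : Q 0 * Q 1 * Q 2 = 1) :
    starElement n m hq ∈ degreePart (Q 0) (Q 2 : ℂ)⁻¹ n m := by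
  refine Submodule.sum_mem _ fun j _ => ⟨symOrbit _ _ j ⊗ₜ symmetrize _ _ m (pairFn hq j), ?_⟩
  rw [LinearMap.lTensor_tmul]

theorem realize_tmul (q t : ℂ) (u : Fin n → ℂ) (P : SymPoly q t n) (g : SymFn q t m) :
    realize q t m u (P ⊗ₜ DirectSum.lof (coefField q t) ℕ (fun k => SymFn q t k) m g) =
      cst m (MvPolynomial.aeval u (P : MvPolynomial (Fin n) (coefField q t))) *
        ellExpand q t m g := by
  rw [realize, TensorProduct.lift.tmul]
  simp only [LinearMap.compl₁₂_apply, LinearMap.mul_apply', LinearMap.comp_apply,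
    DirectSum.component.lof_self]
  rfl

theorem realize_symOrbit_tmul (hq : Q 0 * Q 1 * Q 2 = 1) (u : Fin n → ℂ) (j : Fin m → Fin n) :
    realize (Q 0) (Q 2 : ℂ)⁻¹ m u
      (symOrbit (Q 0) (Q 2 : ℂ)⁻¹ j ⊗ₜ
        DirectSum.lof (coefField (Q 0) (Q 2 : ℂ)⁻¹) ℕ (fun k => SymFn (Q 0) (Q 2 : ℂ)⁻¹ k) m
          (symmetrize _ _ m (pairFn hq j))) =
      ((n.factorial : Corr m)⁻¹ * (m.factorial : Corr m)⁻¹) *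
        ∑ σ : Equiv.Perm (Fin n), ∑ τ : Equiv.Perm (Fin m),
          ofPow m ((∏ i, PowerSeries.C (HahnSeries.C (u (σ (j i))))) *
            pairProd (constUnit m Q) zUnit (j ∘ τ.symm)) := by
  have e1 : cst m (MvPolynomial.aeval u (symOrbit (Q 0) (Q 2 : ℂ)⁻¹ j :
      MvPolynomial (Fin n) (coefField (Q 0) (Q 2 : ℂ)⁻¹))) = (n.factorial : Corr m)⁻¹ *
        ∑ σ : Equiv.Perm (Fin n), ofPow m (∏ i, PowerSeries.C (HahnSeries.C (u (σ (j i))))) := by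
    simp only [symOrbit, map_smul, map_sum, map_prod, MvPolynomial.aeval_X, ofPow_C]
    rw [Algebra.smul_def, map_mul, map_inv₀, map_natCast, map_inv₀, map_natCast]
    simp only [map_sum, map_prod]
    rfl
  have e2 : ellExpand (Q 0) (Q 2 : ℂ)⁻¹ m (symmetrize _ _ m (pairFn hq j)) =
      (m.factorial : Corr m)⁻¹ * ∑ τ : Equiv.Perm (Fin m),
        ofPow m (pairProd (constUnit m Q) zUnit (j ∘ τ.symm)) := by
    change ellExpand (Q 0) (Q 2 : ℂ)⁻¹ m (_ • ∑ σ : Equiv.Perm (Fin m), _) = _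
    rw [map_smul, Algebra.smul_def, map_inv₀, map_natCast, map_sum]
    simp only [ellRename_pairFn, ellExpand_pairFn]
  rw [realize_tmul, e1, e2, mul_mul_mul_comm, Finset.sum_mul_sum]
  simp only [map_mul]

/-- The permutation `τ` of the positions is removed by reindexing `j`; the permutation `σ` of the
`u`'s is removed by Ruijsenaars' identity. -/
theorem sum_pairProd_comp (hq : Q 0 * Q 1 * Q 2 = 1) (h3 : Q 2 ≠ 1) (h3' : Q 2 ^ 2 ≠ 1)
    (u : Fin n → ℂ) (σ : Equiv.Perm (Fin n)) (τ : Equiv.Perm (Fin m)) :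
    ∑ j : Fin m → Fin n, (∏ i, PowerSeries.C (HahnSeries.C (u (σ (j i))))) *
        pairProd (constUnit m Q) zUnit (j ∘ τ.symm) =
      currentSum (constUnit m Q) zUnit fun k => PowerSeries.C (HahnSeries.C (u k)) := by
  have hp : constUnit m Q 0 * constUnit m Q 1 * constUnit m Q 2 = 1 := by
    simp only [constUnit, ← map_mul, hq, map_one]
  have hinj : Function.Injective (Units.map ((HahnSeries.C : ℂ →+* ZSeries m) : ℂ →* ZSeries m)) :=
    Units.map_injective (HahnSeries.C : ℂ →+* ZSeries m).injective
  rw [← currentSum_perm hp (fun h => h3 (hinj (h.trans (map_one _).symm)))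
    (fun h => h3' (hinj (by rw [map_one, map_pow]; exact h))) (inGeneralPosition_zUnit Q) σ]
  refine Fintype.sum_equiv (τ.arrowCongr (Equiv.refl (Fin n))) _ _ fun j => ?_
  refine congrArg (· * pairProd (constUnit m Q) zUnit (j ∘ τ.symm)) ?_
  exact (Equiv.prod_comp τ.symm fun i => PowerSeries.C (HahnSeries.C (u (σ (j i))))).symm

/-- Each of the `n! m!` pairs of permutations in the double average contributes the same sum. -/
theorem realize_starElement (hq : Q 0 * Q 1 * Q 2 = 1) (h3 : Q 2 ≠ 1) (h3' : Q 2 ^ 2 ≠ 1)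
    (u : Fin n → ℂ) :
    realize (Q 0) (Q 2 : ℂ)⁻¹ m u (starElement n m hq) =
      ofPow m (currentSum (constUnit m Q) zUnit fun k => PowerSeries.C (HahnSeries.C (u k))) := by
  have h1 : (n.factorial : Corr m) ≠ 0 := Nat.cast_ne_zero.mpr n.factorial_ne_zero
  have h2 : (m.factorial : Corr m) ≠ 0 := Nat.cast_ne_zero.mpr m.factorial_ne_zero
  have hσ := sum_pairProd_comp (m := m) hq h3 h3' u
  generalize currentSum (constUnit m Q) zUnit
    (fun k => PowerSeries.C (HahnSeries.C (u k)) : Fin n → PowerSeries (ZSeries m)) = c at hσ ⊢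
  rw [starElement, map_sum, Finset.sum_congr rfl fun j _ => realize_symOrbit_tmul hq u j,
    ← Finset.mul_sum, Finset.sum_comm, Finset.sum_congr rfl fun σ _ => Finset.sum_comm]
  simp only [← map_sum (ofPow m), hσ]
  rw [Finset.sum_const, Finset.sum_const, Finset.card_univ, Finset.card_univ, Fintype.card_perm,
    Fintype.card_perm, Fintype.card_fin, Fintype.card_fin, nsmul_eq_mul, nsmul_eq_mul]
  simp only [map_mul, map_natCast]
  generalize (n.factorial : Corr m) = a at h1 ⊢
  generalize (m.factorial : Corr m) = b at h2 ⊢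
  field_simp

end Target

end EllipticCorner

end

/-! ### The main theorem -/

theorem mainTheorem6 (n m : ℕ) (hn : 1 ≤ n) (q ρ : Fin 3 → ℂ)
    (hq : q 0 * q 1 * q 2 = 1)
    (hgen : ∀ L M N : ℤ, q 0 ^ L * q 1 ^ M * q 2 ^ N = 1 → L = M ∧ M = N)
    (hρ : ∀ i, ρ i ^ 4 = q i) (hρ' : ρ 0 ^ 2 * ρ 1 ^ 2 * ρ 2 ^ 2 = 1) :
    ∃ f : Fin m → Fin m → Corr m,
      (∀ i j, i < j → IsStructureFunction ρ n (zc j / zc i) (f i j)) ∧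
      ∃ X ∈ degreePart (q 0) (q 2)⁻¹ n m,
        ∀ u : Fin n → ℂ, ∃ G : Corr m,
          IsVacuumCorrelation ρ u G ∧
          (∏ i : Fin m, ∏ j ∈ Finset.Ioi i, f i j) * G = realize (q 0) (q 2)⁻¹ m u X := by
  have hq0 : ∀ i, q i ≠ 0 := by
    have h01 := left_ne_zero_of_mul (hq.trans_ne one_ne_zero)
    intro i
    fin_cases i
    · exact left_ne_zero_of_mul h01
    · exact right_ne_zero_of_mul h01
    · exact right_ne_zero_of_mul (hq.trans_ne one_ne_zero)
  lift q to Fin 3 → ℂˣ using fun i => (hq0 i).isUnit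
  beta_reduce at hq hgen hρ
  -- Genericity for the exponents `(r, 0, 0)` and its permutations: none of the parameters is a root
  -- of unity, which is the only form in which genericity is needed.
  have hpow : ∀ (i : Fin 3) (r : ℕ), r ≠ 0 → (q i : ℂ) ^ r ≠ 1 := by
    intro i r hr h
    have e0 := hgen r 0 0
    have e1 := hgen 0 r 0
    have e2 := hgen 0 0 r
    simp only [zpow_zero, zpow_natCast, one_mul, mul_one] at e0 e1 e2
    fin_cases i
    · exact hr (by exact_mod_cast (e0 h).1)
    · exact hr (by exact_mod_cast (e1 h).2)
    · exact hr (by exact_mod_cast (e2 h).2.symm)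
  have hqU : q 0 * q 1 * q 2 = 1 := Units.ext hq
  have h2 : ∀ r : ℕ, r ≠ 0 → q 2 ^ r ≠ 1 := fun r hr h =>
    hpow 2 r hr (by rw [← Units.val_pow_eq_pow_val, h, Units.val_one])
  have hρ2 : ρ 2 ≠ 0 := fun h => (q 2).ne_zero (by rw [← hρ, h, zero_pow four_ne_zero])
  have hκ : ∀ r : ℕ+, kappa ρ (r : ℕ) ≠ 0 := by
    intro r
    have h : ∀ i, qInt ρ i (r : ℕ) - 1 ≠ 0 := by
      intro i
      have : qInt ρ i (r : ℕ) = (q i : ℂ) ^ (r : ℕ) := by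
        rw [qInt, zpow_mul, ← hρ, zpow_natCast]
        norm_cast
      rw [this]
      exact sub_ne_zero.mpr (hpow i r r.ne_zero)
    exact mul_ne_zero (mul_ne_zero (h 0) (h 1)) (h 2)
  refine ⟨fun i l => expand m (structFn ρ n i l), fun i l h => isStructureFunction_structFn h,
    starElement n m hqU, starElement_mem_degreePart hqU, fun u => ⟨correlation ρ m u,
      isVacuumCorrelation_correlation hρ2 hκ u, ?_⟩⟩
  have h3 := h2 1 one_ne_zero
  rw [pow_one] at h3
  exact (ofPow_currentSum hρ hρ' h2 (Nat.one_le_iff_ne_zero.mp hn) u).trans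
    (realize_starElement hqU h3 (h2 2 two_ne_zero) u).symm
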